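/- **Model.** For $n\in\mathbb{Z}_+$, $d\ge 2$, $\alpha,\beta\in(0,1)$ and $R>0$, write $(y,\mu,A,X)\sim\mathrm{CSBM}(n,d,\alpha,\beta,R)$ if: $y$ and $\mu$ are independent and uniformly distributed on $\{\pm1\}^n$ and on $\{u\in\mathbb{R}^d:\|u\|_2=R\}$, respectively; and, given $(y,\mu)$, the network $A$ and the attributes $X=(x_1,\dots,x_n)^\top$ are independent, where $A\in\{0,1\}^{n\times n}$ is symmetric with zero diagonal and independent entries $A_{jk}$, $j<k$, with $\mathbb{P}(A_{jk}=1)=\alpha$ if $y_j=y_k$ and $\beta$ if $y_j\ne y_k$, and $x_j=y_j\mu+z_j$ with $z_1,\dots,z_n$ i.i.d. $N(0,I_d)$. Let $G\in\mathbb{R}^{n\times n}$ be the hollowed Gram matrix, $G_{jk}=\langle x_j,x_k\rangle$ for $j\ne k$ and $G_{jj}=0$, and let $y_{-i}$ denote the labels of all nodes except $i$. **Notation.** For random variables $U_n,V_n$ and deterministic $r_n$ (positive for large $n$), write $U_n=O_{\mathbb{P}}(V_n;r_n)$ if there is a constant $C_1>0$ such that for every $C>0$ there are $C'>0$ and $N$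 with $\mathbb{P}(|U_n|\ge C'|V_n|)\le C_1e^{-Cr_n}$ for all $n\ge N$. Write $U_n=o_{\mathbb{P}}(V_n;r_n)$ if $U_n=O_{\mathbb{P}}(w_nV_n;r_n)$ for some deterministic sequence $w_n\to0$. **Statement.** Let $a,b,c>0$ be constants, let $q_n\to\infty$ with $q_n\le\log n$ for all large $n$, and suppose that for all large $n$, $(y,\mu,A,X)\sim\mathrm{CSBM}(n,d_n,\alpha_n,\beta_n,R_n)$ with $\alpha_n=aq_n/n$, $\beta_n=bq_n/n$ and $R_n^4/(R_n^2+d_n/n)=c\,q_n$ (no other condition is imposed on $d_n\geq 2$). Let $i=i_n\in\{1,\dots,n\}$ be any deterministic choice of a node (for instance a fixed node). Then for all large $n$ the conditional probabilities $\mathbb{P}(y_i=\pm1\mid A,X,y_{-i})$ are almost surely positive, and $$\left|\log\left(\frac{\mathbb{P}(y_i=1\mid A,X,y_{-i})}{\mathbb{P}(y_i=-1\mid A,X,y_{-i})}\right)-\left[\left(\log(a/b)\,A+\frac{2}{n+d_n/R_n^2}\,G\right)y\right]_i\right|=o_{\mathbb{P}}(q_n;q_n).$$ -/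

import Mathlib

open MeasureTheory ProbabilityTheory Filter Topology

noncomputable section

/-- Every subset of the label set `{1, -1} = ℤˣ` is measurable. -/
instance instDiscreteMeasurableSpaceIntUnits : DiscreteMeasurableSpace ℤˣ where
  forall_measurableSet s :=
    ⟨Units.val '' s, MeasurableSet.of_discrete, Set.preimage_image_eq _ Units.val_injective⟩

namespace ContextualSBM

/-- `X_n = O_ℙ(Y_n; r_n)`: there is `C₁ > 0` such that for every `C > 0` there are `C' > 0` and `N`
with `ℙ(|X_n| ≥ C' |Y_n|) ≤ C₁ exp (-C r_n)` for all `n ≥ N`. -/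
def IsBigOP {Ω : ℕ+ → Type*} [∀ n, MeasurableSpace (Ω n)] (P : ∀ n, Measure (Ω n))
    (X Y : ∀ n, Ω n → ℝ) (r : ℕ+ → ℝ) : Prop :=
  ∃ C₁ : ℝ, 0 < C₁ ∧ ∀ C : ℝ, 0 < C → ∃ C' : ℝ, 0 < C' ∧ ∃ N : ℕ+, ∀ n ≥ N,
    (P n).real {ω | C' * |Y n ω| ≤ |X n ω|} ≤ C₁ * Real.exp (-C * r n)

/-- `X_n = o_ℙ(Y_n; r_n)`: `X_n = O_ℙ(w_n Y_n; r_n)` for a deterministic sequence `w_n → 0`. -/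
def IsLittleOP {Ω : ℕ+ → Type*} [∀ n, MeasurableSpace (Ω n)] (P : ∀ n, Measure (Ω n))
    (X Y : ∀ n, Ω n → ℝ) (r : ℕ+ → ℝ) : Prop :=
  ∃ w : ℕ+ → ℝ, Tendsto w atTop (𝓝 0) ∧ IsBigOP P X (fun n ω => w n * Y n ω) r

/-- The uniform distribution on the sphere `{u ∈ ℝᵈ : ‖u‖₂ = R}`: the image under `u ↦ R u` of the
normalized surface measure of the unit sphere. -/
def uniformSphere (d : ℕ) (R : ℝ) : Measure (EuclideanSpace ℝ (Fin d)) :=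
  (cond (volume : Measure (EuclideanSpace ℝ (Fin d))).toSphere Set.univ).map
    (fun u : Metric.sphere (0 : EuclideanSpace ℝ (Fin d)) 1 => R • u.1)

/-- The symmetric matrix with zero diagonal and with the given entries above the diagonal. -/
def symmMatrix {n : ℕ} (e : {p : Fin n × Fin n // p.1 < p.2} → ℝ) : Fin n → Fin n → ℝ :=
  fun i j =>
    if h : i < j then e ⟨(i, j), h⟩
    else if h : j < i then e ⟨(j, i), h⟩
    else 0

/-- A real parameter `p ∈ [0, 1]` as an element of the unit interval (clamped to it otherwise). -/
def toProb (p : ℝ) : unitInterval := Set.projIcc 0 1 zero_le_one p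

/-- The law `SBM(y, α, β)` of the adjacency matrix of a stochastic block model: symmetric, zero
diagonal, and independent `{0, 1}`-valued entries above the diagonal, equal to `1` with probability
`α` if `y i = y j` and with probability `β` otherwise. -/
def sbm {n : ℕ} (α β : ℝ) (y : Fin n → ℤˣ) : Measure (Fin n → Fin n → ℝ) :=
  (Measure.pi fun p : {p : Fin n × Fin n // p.1 < p.2} =>
    bernoulliMeasure (1 : ℝ) 0 (toProb (if y p.1.1 = y p.1.2 then α else β))).map symmMatrix

/-- The law `GMM(μ, y)` of `x i = y i • μ + z i` with `z i` i.i.d. standard Gaussian in `ℝᵈ`. -/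
def gmm {n d : ℕ} (μ : EuclideanSpace ℝ (Fin d)) (y : Fin n → ℤˣ) :
    Measure (Fin n → EuclideanSpace ℝ (Fin d)) :=
  (Measure.pi fun _ : Fin n => stdGaussian (EuclideanSpace ℝ (Fin d))).map
    (fun z i => ((y i : ℤ) : ℝ) • μ + z i)

lemma measurable_symmMatrix {n : ℕ} : Measurable (symmMatrix (n := n)) := by
  refine measurable_pi_lambda _ fun i => measurable_pi_lambda _ fun j => ?_
  unfold symmMatrix
  split_ifs <;> fun_prop

instance {n : ℕ} (α β : ℝ) (y : Fin n → ℤˣ) : IsProbabilityMeasure (sbm α β y) :=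
  Measure.isProbabilityMeasure_map measurable_symmMatrix.aemeasurable

lemma measurable_gmm_aux {n d : ℕ} (μ : EuclideanSpace ℝ (Fin d)) (y : Fin n → ℤˣ) :
    Measurable fun (z : Fin n → EuclideanSpace ℝ (Fin d)) (i : Fin n) =>
      ((y i : ℤ) : ℝ) • μ + z i :=
  measurable_pi_lambda _ fun i => measurable_const.add (measurable_pi_apply i)

instance {n d : ℕ} (μ : EuclideanSpace ℝ (Fin d)) (y : Fin n → ℤˣ) :
    IsProbabilityMeasure (gmm μ y) :=
  Measure.isProbabilityMeasure_map (measurable_gmm_aux μ y).aemeasurable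

lemma measurable_gmm {n d : ℕ} :
    Measurable fun p : (Fin n → ℤˣ) × EuclideanSpace ℝ (Fin d) => gmm p.2 p.1 := by
  refine measurable_from_prod_countable_right fun y => ?_
  refine Measure.measurable_of_measurable_coe _ fun s hs => ?_
  have hf : Measurable fun q : EuclideanSpace ℝ (Fin d) × (Fin n → EuclideanSpace ℝ (Fin d)) =>
      fun i => ((y i : ℤ) : ℝ) • q.1 + q.2 i := by fun_prop
  have h : ∀ μ : EuclideanSpace ℝ (Fin d), gmm μ y s =
      (Measure.pi fun _ : Fin n => stdGaussian (EuclideanSpace ℝ (Fin d)))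
        (Prod.mk μ ⁻¹' ((fun q : EuclideanSpace ℝ (Fin d) × (Fin n → EuclideanSpace ℝ (Fin d)) =>
          fun i => ((y i : ℤ) : ℝ) • q.1 + q.2 i) ⁻¹' s)) := by
    intro μ
    rw [gmm, Measure.map_apply (measurable_gmm_aux μ y) hs]
    rfl
  simp only [h]
  exact measurable_measure_prodMk_left (hf hs)

/-- The Markov kernel `(y, μ) ↦ SBM(y, α, β)`. -/
def sbmKernel (n d : ℕ) (α β : ℝ) :
    Kernel ((Fin n → ℤˣ) × EuclideanSpace ℝ (Fin d)) (Fin n → Fin n → ℝ) where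
  toFun p := sbm α β p.1
  measurable' := (measurable_of_countable (sbm α β)).comp measurable_fst

/-- The Markov kernel `(y, μ) ↦ GMM(μ, y)`. -/
def gmmKernel (n d : ℕ) :
    Kernel ((Fin n → ℤˣ) × EuclideanSpace ℝ (Fin d)) (Fin n → EuclideanSpace ℝ (Fin d)) where
  toFun p := gmm p.2 p.1
  measurable' := measurable_gmm

instance (n d : ℕ) (α β : ℝ) : IsMarkovKernel (sbmKernel n d α β) :=
  ⟨fun p => inferInstanceAs (IsProbabilityMeasure (sbm α β p.1))⟩

instance (n d : ℕ) : IsMarkovKernel (gmmKernel n d) :=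
  ⟨fun p => inferInstanceAs (IsProbabilityMeasure (gmm p.2 p.1))⟩

/-- `(y, μ, A, x) ∼ CSBM(n, d, α, β, R)`: the labels `y` and the separation vector `μ` are
independent and uniform on `{1, -1}ⁿ` and on the sphere of radius `R` in `ℝᵈ`; given `(y, μ)`, the
network `A` and the attributes `x` are independent with laws `SBM(y, α, β)` and `GMM(μ, y)`
(the conditional law of `(A, x)` is the product `×ₖ` of the two kernels). -/
structure IsCSBM {Ω : Type*} [MeasurableSpace Ω] (P : Measure Ω) (n d : ℕ) (α β R : ℝ)
    (y : Ω → Fin n → ℤˣ) (μ : Ω → EuclideanSpace ℝ (Fin d)) (A : Ω → Fin n → Fin n → ℝ)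
    (x : Ω → Fin n → EuclideanSpace ℝ (Fin d)) : Prop where
  alpha_mem : α ∈ Set.Ioo (0 : ℝ) 1
  beta_mem : β ∈ Set.Ioo (0 : ℝ) 1
  two_le_dim : 2 ≤ d
  radius_pos : 0 < R
  measurable_labels : Measurable y
  measurable_center : Measurable μ
  measurable_network : Measurable A
  measurable_attributes : Measurable x
  law_labels : HasLaw y (uniformOn (Set.univ : Set (Fin n → ℤˣ))) P
  law_center : HasLaw μ (uniformSphere d R) P
  indep : IndepFun y μ P
  cond_law : HasCondDistrib (fun ω => (A ω, x ω)) (fun ω => (y ω, μ ω))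
    (sbmKernel n d α β ×ₖ gmmKernel n d) P

/-- The hollowed Gram matrix: the Gram matrix of `x` with its diagonal replaced by zeros. -/
def hollowedGram {n d : ℕ} (x : Fin n → EuclideanSpace ℝ (Fin d)) : Matrix (Fin n) (Fin n) ℝ :=
  Matrix.of fun i j => if i = j then 0 else inner ℝ (x i) (x j)

/-- The label vector as a vector in `ℝⁿ`. -/
def labelVec {n : ℕ} (y : Fin n → ℤˣ) : Fin n → ℝ := fun i => ((y i : ℤ) : ℝ)

/-- The σ-algebra generated by `A`, `x` and all labels except the `i`-th one. -/
abbrev genieSigma {Ω : Type*} {n d : ℕ} (y : Ω → Fin n → ℤˣ) (A : Ω → Fin n → Fin n → ℝ)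
    (x : Ω → Fin n → EuclideanSpace ℝ (Fin d)) (i : Fin n) : MeasurableSpace Ω :=
  MeasurableSpace.comap (fun ω => (A ω, x ω, fun j : {j : Fin n // j ≠ i} => y ω j)) inferInstance

/-- The conditional probability `ℙ(y_i = s | A, x, y_{-i})`, as a random variable. -/
def genieProb {Ω : Type*} [MeasurableSpace Ω] (P : Measure Ω) {n d : ℕ} (y : Ω → Fin n → ℤˣ)
    (A : Ω → Fin n → Fin n → ℝ) (x : Ω → Fin n → EuclideanSpace ℝ (Fin d)) (i : Fin n) (s : ℤˣ) :
    Ω → ℝ :=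
  P⟦{ω | y ω i = s} | genieSigma y A x i⟧

/-- The genie-aided log-odds `log (ℙ(y_i = 1 | A, x, y_{-i}) / ℙ(y_i = -1 | A, x, y_{-i}))`. -/
def genieLogOdds {Ω : Type*} [MeasurableSpace Ω] (P : Measure Ω) {n d : ℕ} (y : Ω → Fin n → ℤˣ)
    (A : Ω → Fin n → Fin n → ℝ) (x : Ω → Fin n → EuclideanSpace ℝ (Fin d)) (i : Fin n) :
    Ω → ℝ :=
  fun ω => Real.log (genieProb P y A x i 1 ω / genieProb P y A x i (-1) ω)

end ContextualSBM

end

/-! Let `F` be the Laplace transform `sphereLaplace` of the uniform law on the unit sphere, and let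
S = ∑_{j≠i} y_j x_j. Bayes' formula is explicit here. The prior odds of y_i are 1, and integrating
out μ turns the attribute likelihood into the pure-noise law weighted by exp(-nR²/2) F(R ∑ y_j x_j).
Hence the log-odds are almost surely the sum of a network term ∑_{j≠i} y_j [A_ij log(α/β) + (1 -
A_ij) log((1-α)/(1-β))] and the increment log F(R(S + x_i)) - log F(R(S - x_i)); see
`IsCSBM.genieLogOdds_eq`. Positivity of both probabilities follows from the same formula.

In the network term, the part that is not log(a/b) (Ay)_i carries the factor log((1-α)/(1-β)) =
O(q/n). It is multiplied by ∑ y_j = O(√(nq)) and ∑ y_j A_ij = O(q), so it contributes O(q √(q/n)).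

For the attribute term, F depends only on the norm, and log F(v) - log F(w) = (‖v‖² - ‖w‖²)/(2y),
where t² ≤ y² - (d-1)y ≤ t² + d for some radius t between the two norms (`log_sphereLaplace_sub`).
These inequalities for a Bessel-type ratio come from integration by parts on the sphere and
Cauchy–Schwarz, with no restriction on the dimension. Put D = nR² + d. Both squared norms are
R²(n²R² + nd) = D² - dD up to a relative error O(1/√n) on the scale D², which forces y = D(1 +
O(1/√n)). Since ‖R(S + x_i)‖² - ‖R(S - x_i)‖² = 4R²⟨S, x_i⟩, the increment is 2R²⟨S, x_i⟩/D, which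
is the (Gy)_i term, and R²⟨S, x_i⟩/D = O(q) makes the error O(q/√n) (`attribute_log_ratio_bound`).

All these controls hold together outside an event of probability at most 16 exp(-Cq), by eight
Chernoff bounds whose constant K grows linearly in C (`IsCSBM.genieLogOdds_error_tail`). The rate is
therefore w_n = √(q/n). -/

namespace ContextualSBM

/-! ### Rotation invariance of the uniform law on the sphere -/

lemma uniformSphere_eq_map (d : ℕ) (R : ℝ) :
    uniformSphere d R = (uniformSphere d 1).map (R • ·) := by
  rw [uniformSphere, uniformSphere, Measure.map_map (by fun_prop) (by fun_prop)]
  simp [Function.comp_def]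

lemma isProbabilityMeasure_uniformSphere {d : ℕ} (hd : 0 < d) (R : ℝ) :
    IsProbabilityMeasure (uniformSphere d R) := by
  have : NeZero d := ⟨hd.ne'⟩
  have : IsProbabilityMeasure
      (cond (volume : Measure (EuclideanSpace ℝ (Fin d))).toSphere Set.univ) := by
    refine cond_isProbabilityMeasure ?_
    rw [Ne, Measure.measure_univ_eq_zero]
    exact Measure.toSphere_ne_zero _
  exact Measure.isProbabilityMeasure_map (by fun_prop)

lemma norm_eq_of_uniformSphere {d : ℕ} {R : ℝ} (hR : 0 ≤ R) :
    ∀ᵐ u ∂(uniformSphere d R), ‖u‖ = R := by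
  rw [uniformSphere, ae_map_iff (by fun_prop) (measurableSet_eq_fun (by fun_prop) (by fun_prop))]
  refine Eventually.of_forall fun u => ?_
  have := u.2
  rw [mem_sphere_zero_iff_norm] at this
  simp [norm_smul, this, abs_of_nonneg hR]

/-- The surface measure of a set is a multiple of the volume of the cone over it. A linear isometry
commutes with radial scaling and preserves volume. -/
lemma map_uniformSphere {d : ℕ} (R : ℝ)
    (U : EuclideanSpace ℝ (Fin d) ≃ₗᵢ[ℝ] EuclideanSpace ℝ (Fin d)) :
    (uniformSphere d R).map U = uniformSphere d R := by
  have hU : Measurable U := U.continuous.measurable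
  ext s hs
  rw [Measure.map_apply hU hs]
  simp only [uniformSphere]
  rw [Measure.map_apply (by fun_prop) (hU hs), Measure.map_apply (by fun_prop) hs,
    cond_apply .univ, cond_apply .univ, Set.univ_inter, Set.univ_inter]
  congr 1
  have hm : Measurable fun u : Metric.sphere (0 : EuclideanSpace ℝ (Fin d)) 1 => R • u.1 := by
    fun_prop
  rw [Measure.toSphere_apply' _ (hm (hU hs)), Measure.toSphere_apply' _ (hm hs)]
  conv_rhs => rw [← U.measurePreserving.measure_preimage_equiv (f := U.toMeasurableEquiv)]
  congr 2
  ext z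
  simp only [Set.mem_smul, Set.mem_preimage, Set.mem_image, Subtype.exists,
    mem_sphere_zero_iff_norm]
  constructor
  · rintro ⟨r, hr, v, ⟨v', hv', hvs, rfl⟩, rfl⟩
    exact ⟨r, hr, U v', ⟨U v', by simpa using hv', by simpa using hvs, rfl⟩, by simp⟩
  · rintro ⟨r, hr, v, ⟨v', hv', hvs, rfl⟩, h⟩
    refine ⟨r, hr, U.symm v', ⟨U.symm v', by simpa using hv', by simpa using hvs, rfl⟩, ?_⟩
    apply U.injective
    simpa using h

lemma integral_uniformSphere_comp {d : ℕ} (R : ℝ)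
    (U : EuclideanSpace ℝ (Fin d) ≃ₗᵢ[ℝ] EuclideanSpace ℝ (Fin d))
    (f : EuclideanSpace ℝ (Fin d) → ℝ) :
    ∫ u, f (U u) ∂(uniformSphere d R) = ∫ u, f u ∂(uniformSphere d R) := by
  have h : MeasurePreserving U.toMeasurableEquiv (uniformSphere d R) (uniformSphere d R) :=
    ⟨U.toMeasurableEquiv.measurable, map_uniformSphere R U⟩
  exact h.integral_comp' f

/-- The Laplace transform of the uniform distribution on the unit sphere. -/
noncomputable def sphereLaplace (d : ℕ) (v : EuclideanSpace ℝ (Fin d)) : ℝ :=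
  ∫ u, Real.exp (inner ℝ u v) ∂(uniformSphere d 1)

/-- A reflection carries one vector to any other of equal norm, and the uniform law is invariant
under it. -/
lemma sphereLaplace_congr_norm {d : ℕ} {v w : EuclideanSpace ℝ (Fin d)} (h : ‖v‖ = ‖w‖) :
    sphereLaplace d v = sphereLaplace d w := by
  obtain ⟨U, rfl⟩ : ∃ U : EuclideanSpace ℝ (Fin d) ≃ₗᵢ[ℝ] EuclideanSpace ℝ (Fin d), U v = w :=
    ⟨_, Submodule.reflection_sub h⟩
  rw [sphereLaplace, sphereLaplace,
    ← integral_uniformSphere_comp 1 U (fun u => Real.exp (inner ℝ u (U v)))]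
  simp

/-! ### Integration by parts on the sphere and tilted moments -/

lemma exists_planeRotation {d : ℕ} {p k : Fin d} (hpk : p ≠ k) (θ : ℝ) :
    ∃ U : EuclideanSpace ℝ (Fin d) ≃ₗᵢ[ℝ] EuclideanSpace ℝ (Fin d), ∀ u,
      U u p = Real.cos θ * u p + Real.sin θ * u k ∧
      U u k = -Real.sin θ * u p + Real.cos θ * u k := by
  let f : EuclideanSpace ℝ (Fin d) →ₗ[ℝ] EuclideanSpace ℝ (Fin d) :=
    { toFun := fun u => WithLp.toLp 2 fun j =>
        if j = p then Real.cos θ * u p + Real.sin θ * u k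
        else if j = k then -Real.sin θ * u p + Real.cos θ * u k else u j
      map_add' := fun u v => by
        ext j
        simp only [PiLp.add_apply]
        split_ifs <;> ring
      map_smul' := fun c u => by
        ext j
        simp only [PiLp.smul_apply, smul_eq_mul, RingHom.id_apply]
        split_ifs <;> ring }
  have hf : ∀ u, ‖f u‖ = ‖u‖ := by
    intro u
    rw [← sq_eq_sq₀ (norm_nonneg _) (norm_nonneg _), EuclideanSpace.real_norm_sq_eq,
      EuclideanSpace.real_norm_sq_eq, ← sub_eq_zero, ← Finset.sum_sub_distrib,
      Finset.sum_eq_add p k hpk]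
    · simp only [f, LinearMap.coe_mk, AddHom.coe_mk, if_true, if_neg hpk.symm]
      linear_combination (u p ^ 2 + u k ^ 2) * Real.sin_sq_add_cos_sq θ
    · intro j _ hj
      simp [f, hj.1, hj.2]
    · simp
    · simp
  refine ⟨(⟨f, hf⟩ : EuclideanSpace ℝ (Fin d) →ₗᵢ[ℝ] _).toLinearIsometryEquiv rfl, fun u => ?_⟩
  constructor
  · simp [f]
  · simp [f, hpk.symm]

lemma abs_apply_le_of_uniformSphere {d : ℕ} :
    ∀ᵐ u ∂(uniformSphere d 1), ∀ j : Fin d, |u j| ≤ 1 := by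
  filter_upwards [norm_eq_of_uniformSphere (d := d) zero_le_one] with u hu j
  have := PiLp.norm_apply_le (p := 2) u j
  rwa [hu] at this

lemma integrable_of_uniformSphere {d : ℕ} (hd : 0 < d) (p : Fin d) {f : ℝ → ℝ}
    (hf : Continuous f) : Integrable (fun u => f (u p)) (uniformSphere d 1) := by
  have := isProbabilityMeasure_uniformSphere hd 1
  obtain ⟨M, hM⟩ := isCompact_Icc.exists_bound_of_continuousOn (s := Set.Icc (-1 : ℝ) 1)
    hf.continuousOn
  refine Integrable.of_bound (C := M) (by fun_prop) ?_
  filter_upwards [abs_apply_le_of_uniformSphere] with u hu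
  exact hM _ (abs_le.1 (hu p))

/-- Rotating the plane of coordinates `p` and `k` by θ leaves ∫ φ(u_p) u_k unchanged. Its derivative
at θ = 0 is ∫ (φ'(u_p) u_k² - φ(u_p) u_p), which must vanish. -/
lemma integral_mul_eq_integral_sq_mul_deriv {d : ℕ} {p k : Fin d} (hpk : p ≠ k) {φ φ' : ℝ → ℝ}
    (hφ : ∀ s, HasDerivAt φ (φ' s) s) (hφ' : Continuous φ') :
    ∫ u, u p * φ (u p) ∂(uniformSphere d 1) = ∫ u, u k ^ 2 * φ' (u p) ∂(uniformSphere d 1) := by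
  have hd : 0 < d := p.pos
  have := isProbabilityMeasure_uniformSphere hd 1
  have hφc : Continuous φ := continuous_iff_continuousAt.2 fun s => (hφ s).continuousAt
  let G : ℝ → EuclideanSpace ℝ (Fin d) → ℝ := fun θ u =>
    φ (Real.cos θ * u p + Real.sin θ * u k) * (-Real.sin θ * u p + Real.cos θ * u k)
  let G' : ℝ → EuclideanSpace ℝ (Fin d) → ℝ := fun θ u =>
    (φ' (Real.cos θ * u p + Real.sin θ * u k) * (-Real.sin θ * u p + Real.cos θ * u k)) *
      (-Real.sin θ * u p + Real.cos θ * u k) +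
    φ (Real.cos θ * u p + Real.sin θ * u k) * (-Real.cos θ * u p + -Real.sin θ * u k)
  have hconst : ∀ θ, ∫ u, G θ u ∂(uniformSphere d 1) = ∫ u, φ (u p) * u k ∂(uniformSphere d 1) := by
    intro θ
    obtain ⟨U, hU⟩ := exists_planeRotation hpk θ
    rw [← integral_uniformSphere_comp 1 U (fun u => φ (u p) * u k)]
    simp only [hU, G]
  -- A rotated coordinate has absolute value at most 2 by the triangle inequality, so bounds of φ
  -- and φ' on [-2, 2] dominate the integrand and its θ-derivative.
  obtain ⟨M, hM⟩ := isCompact_Icc.exists_bound_of_continuousOn (s := Set.Icc (-2 : ℝ) 2)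
    hφc.continuousOn
  obtain ⟨M', hM'⟩ := isCompact_Icc.exists_bound_of_continuousOn (s := Set.Icc (-2 : ℝ) 2)
    hφ'.continuousOn
  have hbd : ∀ a b x y : ℝ, |a| ≤ 1 → |b| ≤ 1 → |x| ≤ 1 → |y| ≤ 1 → |a * x + b * y| ≤ 2 := by
    intro a b x y ha hb hx hy
    calc |a * x + b * y| ≤ |a| * |x| + |b| * |y| := by
          rw [← abs_mul, ← abs_mul]; exact abs_add_le _ _
      _ ≤ 1 * 1 + 1 * 1 := by gcongr
      _ = 2 := by norm_num
  have hder := (hasDerivAt_integral_of_dominated_loc_of_deriv_le (μ := uniformSphere d 1)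
    (F := G) (F' := G') (x₀ := (0 : ℝ)) (s := Set.univ) (bound := fun _ => M' * 2 * 2 + M * 2)
    Filter.univ_mem ?_ ?_ ?_ ?_ (integrable_const _) ?_).2
  · have h0 := (hasDerivAt_const (0 : ℝ) (∫ u, φ (u p) * u k ∂(uniformSphere d 1)))
    simp only [hconst] at hder
    have h1 := hder.unique h0
    simp only [G', Real.cos_zero, Real.sin_zero, one_mul, zero_mul, add_zero, neg_zero,
      zero_add] at h1
    have i1 : Integrable (fun u : EuclideanSpace ℝ (Fin d) => φ' (u p) * u k * u k)
        (uniformSphere d 1) := by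
      refine Integrable.of_bound (C := M' * 1 * 1) (by fun_prop) ?_
      filter_upwards [abs_apply_le_of_uniformSphere] with u hu
      have := hM' (u p) ⟨by linarith [(abs_le.1 (hu p)).1], by linarith [(abs_le.1 (hu p)).2]⟩
      rw [norm_mul, norm_mul]
      have hk := hu k
      rw [← Real.norm_eq_abs] at hk
      have := (norm_nonneg _).trans this
      gcongr
    have i2 := integrable_of_uniformSphere hd p (f := fun s => φ s * (-1 * s)) (by fun_prop)
    rw [integral_add i1 i2] at h1
    have h2 : ∫ u, φ (u p) * (-1 * u p) ∂(uniformSphere d 1)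
        = - ∫ u, u p * φ (u p) ∂(uniformSphere d 1) := by
      rw [← integral_neg]; congr with u; ring
    have h3 : ∫ u, φ' (u p) * u k * u k ∂(uniformSphere d 1)
        = ∫ u, u k ^ 2 * φ' (u p) ∂(uniformSphere d 1) := by
      congr with u; ring
    linarith
  · exact Eventually.of_forall fun θ => by simp only [G]; fun_prop
  · refine Integrable.of_bound (C := M * 2) (by simp only [G]; fun_prop) ?_
    filter_upwards [abs_apply_le_of_uniformSphere] with u hu
    have b1 := hbd (Real.cos 0) (Real.sin 0) _ _ (Real.abs_cos_le_one _) (Real.abs_sin_le_one _)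
      (hu p) (hu k)
    have b2 := hbd (-Real.sin 0) (Real.cos 0) _ _
      (by rw [abs_neg]; exact Real.abs_sin_le_one _) (Real.abs_cos_le_one _) (hu p) (hu k)
    have := hM _ (abs_le.1 b1)
    simp only [G]
    rw [norm_mul]
    rw [← Real.norm_eq_abs] at b2
    have := (norm_nonneg _).trans this
    gcongr
  · simp only [G']; fun_prop
  · filter_upwards [abs_apply_le_of_uniformSphere] with u hu θ _
    have b1 := hbd (Real.cos θ) (Real.sin θ) _ _ (Real.abs_cos_le_one _) (Real.abs_sin_le_one _)
      (hu p) (hu k)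
    have b2 := hbd (-Real.sin θ) (Real.cos θ) _ _
      (by rw [abs_neg]; exact Real.abs_sin_le_one _) (Real.abs_cos_le_one _) (hu p) (hu k)
    have b3 := hbd (-Real.cos θ) (-Real.sin θ) _ _
      (by rw [abs_neg]; exact Real.abs_cos_le_one _)
      (by rw [abs_neg]; exact Real.abs_sin_le_one _) (hu p) (hu k)
    have c1 := hM _ (abs_le.1 b1)
    have c2 := hM' _ (abs_le.1 b1)
    rw [← Real.norm_eq_abs] at b2 b3
    have := (norm_nonneg _).trans c1
    have := (norm_nonneg _).trans c2
    simp only [G']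
    refine (norm_add_le _ _).trans ?_
    rw [norm_mul, norm_mul, norm_mul]
    gcongr
  · refine Eventually.of_forall fun u θ _ => ?_
    have e1 : HasDerivAt (fun θ => Real.cos θ * u p + Real.sin θ * u k)
        (-Real.sin θ * u p + Real.cos θ * u k) θ :=
      ((Real.hasDerivAt_cos θ).mul_const _).add ((Real.hasDerivAt_sin θ).mul_const _)
    have e2 : HasDerivAt (fun θ => -Real.sin θ * u p + Real.cos θ * u k)
        (-Real.cos θ * u p + -Real.sin θ * u k) θ :=
      ((Real.hasDerivAt_sin θ).neg.mul_const _).add ((Real.hasDerivAt_cos θ).mul_const _)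
    exact ((hφ _).comp θ e1).mul e2

/-- Sum the identity for one plane over the d - 1 indices k ≠ p; on the sphere ∑_{k≠p} u_k² = 1 -
u_p². -/
lemma sphere_integration_by_parts {d : ℕ} (p : Fin d) {φ φ' : ℝ → ℝ}
    (hφ : ∀ s, HasDerivAt φ (φ' s) s) (hφ' : Continuous φ') :
    ((d : ℝ) - 1) * ∫ u, u p * φ (u p) ∂(uniformSphere d 1)
      = ∫ u, (1 - u p ^ 2) * φ' (u p) ∂(uniformSphere d 1) := by
  have hd : 0 < d := p.pos
  have := isProbabilityMeasure_uniformSphere hd 1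
  have h1 : ∫ u, (1 - u p ^ 2) * φ' (u p) ∂(uniformSphere d 1)
      = ∫ u, ∑ k ∈ Finset.univ.erase p, u k ^ 2 * φ' (u p) ∂(uniformSphere d 1) := by
    refine integral_congr_ae ?_
    filter_upwards [norm_eq_of_uniformSphere (d := d) zero_le_one] with u hu
    have : ∑ j, u j ^ 2 = 1 := by rw [← EuclideanSpace.real_norm_sq_eq, hu]; norm_num
    rw [← Finset.add_sum_erase _ _ (Finset.mem_univ p)] at this
    rw [← Finset.sum_mul, ← this]
    ring
  have hi : ∀ k ∈ Finset.univ.erase p,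
      Integrable (fun u : EuclideanSpace ℝ (Fin d) => u k ^ 2 * φ' (u p)) (uniformSphere d 1) := by
    intro k _
    refine (integrable_of_uniformSphere hd p hφ').bdd_mul (c := 1) (by fun_prop) ?_
    filter_upwards [abs_apply_le_of_uniformSphere] with u hu
    rw [norm_pow, Real.norm_eq_abs]
    exact pow_le_one₀ (abs_nonneg _) (hu k)
  rw [h1, integral_finsetSum _ hi, Finset.sum_congr rfl fun k hk =>
    (integral_mul_eq_integral_sq_mul_deriv (Finset.ne_of_mem_erase hk).symm hφ hφ').symm]
  simp [Finset.card_erase_of_mem, Nat.cast_sub (Nat.succ_le_of_lt hd)]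

/-- The moments of one coordinate on the sphere under an exponential tilt. -/
noncomputable def tiltMoment {d : ℕ} (p : Fin d) (j : ℕ) (t : ℝ) : ℝ :=
  ∫ u, u p ^ j * Real.exp (t * u p) ∂(uniformSphere d 1)

lemma integrable_tilt {d : ℕ} (p : Fin d) (j : ℕ) (t : ℝ) :
    Integrable (fun u => u p ^ j * Real.exp (t * u p)) (uniformSphere d 1) :=
  integrable_of_uniformSphere p.pos p (f := fun s => s ^ j * Real.exp (t * s)) (by fun_prop)

lemma tiltMoment_zero_pos {d : ℕ} (p : Fin d) (t : ℝ) : 0 < tiltMoment p 0 t := by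
  have := isProbabilityMeasure_uniformSphere p.pos 1
  have h := integral_exp_pos (μ := uniformSphere d 1) (f := fun u => t * u p)
    (by simpa using integrable_tilt p 0 t)
  simpa [tiltMoment] using h

/-- Integration by parts with φ(s) = s^j exp(ts). For j = 0 the truncated index `j - 1` is harmless,
because its coefficient vanishes. -/
lemma tiltMoment_identity {d : ℕ} (p : Fin d) (j : ℕ) (t : ℝ) :
    ((d : ℝ) - 1) * tiltMoment p (j + 1) t
      = j * (tiltMoment p (j - 1) t - tiltMoment p (j + 1) t)
        + t * (tiltMoment p j t - tiltMoment p (j + 2) t) := by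
  have h := sphere_integration_by_parts p (φ := fun s => s ^ j * Real.exp (t * s))
    (φ' := fun s => j * s ^ (j - 1) * Real.exp (t * s) + s ^ j * (Real.exp (t * s) * t))
    (fun s => (hasDerivAt_pow j s).mul
      (((hasDerivAt_id s).const_mul t).exp.congr_deriv (by simp))) (by fun_prop)
  have h1 : ∫ u, u p * (u p ^ j * Real.exp (t * u p)) ∂(uniformSphere d 1)
      = tiltMoment p (j + 1) t := by
    rw [tiltMoment]; congr with u; ring
  have h2 : ∫ u, (1 - u p ^ 2) * (j * u p ^ (j - 1) * Real.exp (t * u p) +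
        u p ^ j * (Real.exp (t * u p) * t)) ∂(uniformSphere d 1)
      = j * (tiltMoment p (j - 1) t - tiltMoment p (j + 1) t)
        + t * (tiltMoment p j t - tiltMoment p (j + 2) t) := by
    have i : ∀ (c : ℝ) (k l : ℕ), Integrable (fun u : EuclideanSpace ℝ (Fin d) =>
        c * (u p ^ k * Real.exp (t * u p) - u p ^ l * Real.exp (t * u p))) (uniformSphere d 1) :=
      fun c k l => ((integrable_tilt p k t).sub (integrable_tilt p l t)).const_mul c
    simp only [tiltMoment]
    rw [← integral_sub (integrable_tilt p _ t) (integrable_tilt p _ t),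
      ← integral_sub (integrable_tilt p _ t) (integrable_tilt p _ t),
      ← integral_const_mul, ← integral_const_mul, ← integral_add (i _ _ _) (i _ _ _)]
    congr with u
    rcases j with _ | j
    · simp; ring
    · simp only [Nat.add_sub_cancel]; ring
  rw [h1, h2] at h
  exact h

/-- Cauchy–Schwarz for the weight f: the quadratic s ↦ ∫ (s - g)² f is nonnegative, so its
discriminant is at most 0. -/
lemma sq_integral_mul_le {α : Type*} [MeasurableSpace α] {ν : Measure α} {f g : α → ℝ}
    (hf : 0 ≤ᵐ[ν] f) (i0 : Integrable f ν) (i1 : Integrable (fun x => g x * f x) ν)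
    (i2 : Integrable (fun x => g x ^ 2 * f x) ν) :
    (∫ x, g x * f x ∂ν) ^ 2 ≤ (∫ x, f x ∂ν) * ∫ x, g x ^ 2 * f x ∂ν := by
  have key : ∀ s : ℝ, 0 ≤ (∫ x, f x ∂ν) * (s * s) + (-2 * ∫ x, g x * f x ∂ν) * s
      + ∫ x, g x ^ 2 * f x ∂ν := by
    intro s
    have : 0 ≤ ∫ x, (s - g x) ^ 2 * f x ∂ν := by
      refine integral_nonneg_of_ae ?_
      filter_upwards [hf] with x hx
      exact mul_nonneg (sq_nonneg _) hx
    have e : ∀ x, (s - g x) ^ 2 * f x = s * s * f x + (-2 * s) * (g x * f x) + g x ^ 2 * f x := by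
      intro x; ring
    simp only [e] at this
    have i01 : Integrable (fun x => s * s * f x + (-2 * s) * (g x * f x)) ν :=
      (i0.const_mul _).add (i1.const_mul _)
    rw [integral_add i01 i2, integral_add (i0.const_mul _) (i1.const_mul _), integral_const_mul, integral_const_mul] at this
    linarith
  have := discrim_le_zero key
  rw [discrim] at this
  nlinarith

lemma tiltMoment_one_sq_le {d : ℕ} (p : Fin d) (t : ℝ) :
    tiltMoment p 1 t ^ 2 ≤ tiltMoment p 0 t * tiltMoment p 2 t := by
  have h := sq_integral_mul_le (ν := uniformSphere d 1) (f := fun u => Real.exp (t * u p))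
    (g := fun u => u p) (Eventually.of_forall fun u => (Real.exp_pos _).le)
    (by simpa using integrable_tilt p 0 t) (by simpa using integrable_tilt p 1 t)
    (integrable_tilt p 2 t)
  simpa [tiltMoment] using h

/-- The differences M_j - M_{j+2} are the moments of the nonnegative weight (1 - u_p²) exp(t u_p),
to which Cauchy–Schwarz applies. -/
lemma tiltMoment_sub_sq_le {d : ℕ} (p : Fin d) (t : ℝ) :
    (tiltMoment p 1 t - tiltMoment p 3 t) ^ 2
      ≤ (tiltMoment p 0 t - tiltMoment p 2 t) * (tiltMoment p 2 t - tiltMoment p 4 t) := by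
  have e : ∀ j (u : EuclideanSpace ℝ (Fin d)),
      u p ^ j * Real.exp (t * u p) - u p ^ (j + 2) * Real.exp (t * u p)
        = u p ^ j * ((1 - u p ^ 2) * Real.exp (t * u p)) := fun j u => by ring
  have i : ∀ j, Integrable (fun u : EuclideanSpace ℝ (Fin d) =>
      u p ^ j * ((1 - u p ^ 2) * Real.exp (t * u p))) (uniformSphere d 1) := fun j =>
    ((integrable_tilt p j t).sub (integrable_tilt p (j + 2) t)).congr
      (Eventually.of_forall fun u => e j u)
  have m : ∀ j, tiltMoment p j t - tiltMoment p (j + 2) t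
      = ∫ u, u p ^ j * ((1 - u p ^ 2) * Real.exp (t * u p)) ∂(uniformSphere d 1) := fun j => by
    rw [tiltMoment, tiltMoment,
      ← integral_sub (integrable_tilt p _ t) (integrable_tilt p _ t)]
    simp only [e]
  rw [m 0, m 1, m 2]
  have h := sq_integral_mul_le (ν := uniformSphere d 1)
    (f := fun u => (1 - u p ^ 2) * Real.exp (t * u p)) (g := fun u => u p) ?_
    (by simpa using i 0) (by simpa using i 1) (i 2)
  · simpa using h
  · filter_upwards [abs_apply_le_of_uniformSphere] with u hu
    have := (sq_le_one_iff_abs_le_one _).2 (hu p)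
    exact mul_nonneg (by linarith) (Real.exp_pos _).le

/-- By the identity (d-1) M₁ = t (M₀ - M₂) it suffices that M₀ > M₂. Equality would force M₁ = M₃ by
Cauchy–Schwarz, then (d-1) M₂ = 0 by the next identity, contradicting M₂ = M₀ > 0. -/
lemma tiltMoment_one_pos {d : ℕ} (hd : 2 ≤ d) (p : Fin d) {t : ℝ} (ht : 0 < t) :
    0 < tiltMoment p 1 t := by
  have hd' : (2 : ℝ) ≤ d := by exact_mod_cast hd
  have h0 := tiltMoment_zero_pos p t
  have e0 := tiltMoment_identity p 0 t
  have e1 := tiltMoment_identity p 1 t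
  have c := tiltMoment_sub_sq_le p t
  norm_num at e0 e1
  have hw : 0 ≤ tiltMoment p 0 t - tiltMoment p 2 t := by
    rw [tiltMoment, tiltMoment, ← integral_sub (integrable_tilt p _ t) (integrable_tilt p _ t)]
    refine integral_nonneg_of_ae ?_
    filter_upwards [abs_apply_le_of_uniformSphere] with u hu
    have := (sq_le_one_iff_abs_le_one _).2 (hu p)
    have h := mul_nonneg (sub_nonneg.2 this) (Real.exp_pos (t * u p)).le
    simp only [Pi.zero_apply]
    linarith
  rcases hw.eq_or_lt with hw | hw
  · rw [← hw, zero_mul] at c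
    have c' : tiltMoment p 1 t - tiltMoment p 3 t = 0 := by nlinarith
    rw [c', mul_zero, add_zero] at e1
    nlinarith
  · have : 0 < ((d : ℝ) - 1) * tiltMoment p 1 t := by rw [e0]; positivity
    exact pos_of_mul_pos_right this (by linarith)

/-- Two-sided bound on `t * M₀ / M₁`, the reciprocal of a normalized Bessel ratio. -/
lemma exists_tiltMoment_ratio {d : ℕ} (hd : 2 ≤ d) (p : Fin d) {t : ℝ} (ht : 0 < t) :
    ∃ y : ℝ, 0 < y ∧ t ^ 2 ≤ y ^ 2 - (d - 1) * y ∧ y ^ 2 - (d - 1) * y ≤ t ^ 2 + d ∧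
      tiltMoment p 1 t * y = t * tiltMoment p 0 t := by
  have hd' : (2 : ℝ) ≤ d := by exact_mod_cast hd
  have h0 := tiltMoment_zero_pos p t
  have h1 := tiltMoment_one_pos hd p ht
  have e0 := tiltMoment_identity p 0 t
  have e1 := tiltMoment_identity p 1 t
  have e2 := tiltMoment_identity p 2 t
  have c1 := tiltMoment_one_sq_le p t
  have c2 := tiltMoment_sub_sq_le p t
  norm_num at e0 e1 e2
  generalize tiltMoment p 0 t = M0 at *
  generalize tiltMoment p 1 t = M1 at *
  generalize tiltMoment p 2 t = M2 at *
  generalize tiltMoment p 3 t = M3 at *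
  generalize tiltMoment p 4 t = M4 at *
  have hM0 : M0 = M1 * (t * M0 / M1) / t := by field_simp
  obtain ⟨y, hy⟩ : ∃ y, y = t * M0 / M1 := ⟨_, rfl⟩
  have hy0 : 0 < y := by rw [hy]; positivity
  rw [← hy] at hM0
  have k0 : t * M0 = M1 * y := by rw [hM0]; field_simp
  refine ⟨y, hy0, ?_, ?_, k0.symm⟩
  -- Lower bound: the j = 0 identity gives t M₂ = M₁ (y - (d-1)), so M₁² ≤ M₀ M₂ multiplied by t² is
  -- the claim.
  · have : M1 ^ 2 * t ^ 2 ≤ M1 ^ 2 * (y ^ 2 - (d - 1) * y) := by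
      have a1 : t ^ 2 * (M0 * M2) = M1 ^ 2 * (y ^ 2 - (d - 1) * y) := by
        linear_combination (t * M2) * k0 + M1 * y * k0 + M1 * y * e0
      have := mul_le_mul_of_nonneg_left c1 (sq_nonneg t)
      linarith
    exact le_of_mul_le_mul_left this (by positivity)
  -- Upper bound: the identities express M₁ - M₃ and M₂ - M₄ as multiples of M₀ - M₂. The weighted
  -- Cauchy–Schwarz inequality then becomes (y - d)(y + 1) ≤ t², which is the claim expanded.
  · have hw0 : 0 < M0 - M2 := by
      have : 0 < t * (M0 - M2) := by rw [← e0]; exact mul_pos (by linarith) h1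
      exact pos_of_mul_pos_right this ht.le
    have a1 : t * (M1 - M3) = (M0 - M2) * (y - d) := by
      have a0 : y * (M0 - M2) = (d - 1) * M0 := by
        have : t * (y * (M0 - M2)) = t * ((d - 1) * M0) := by
          linear_combination -y * e0 - (d - 1) * k0
        exact mul_left_cancel₀ ht.ne' this
      linear_combination -e1 - a0
    have a2 : t * (M2 - M4) = t * (M0 - M2) - (d + 1) * (M1 - M3) := by
      linear_combination e0 - e2
    have a3 : (M0 - M2) ^ 2 * ((y - d) * (y + 1)) ≤ (M0 - M2) ^ 2 * t ^ 2 := by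
      have := mul_le_mul_of_nonneg_left c2 (sq_nonneg t)
      have b1 : t ^ 2 * (M1 - M3) ^ 2 = ((M0 - M2) * (y - d)) ^ 2 := by rw [← a1]; ring
      have b2 : t ^ 2 * ((M0 - M2) * (M2 - M4))
          = (M0 - M2) ^ 2 * t ^ 2 - (d + 1) * ((M0 - M2) ^ 2 * (y - d)) := by
        linear_combination t * (M0 - M2) * a2 - (d + 1) * (M0 - M2) * a1
      rw [b1, b2] at this
      linarith
    have := le_of_mul_le_mul_left a3 (by positivity)
    linarith

lemma hasDerivAt_tiltMoment_zero {d : ℕ} (p : Fin d) (t : ℝ) :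
    HasDerivAt (tiltMoment p 0) (tiltMoment p 1 t) t := by
  have := isProbabilityMeasure_uniformSphere p.pos 1
  have h := (hasDerivAt_integral_of_dominated_loc_of_deriv_le (μ := uniformSphere d 1)
    (F := fun s u => u p ^ 0 * Real.exp (s * u p)) (F' := fun s u => u p ^ 1 * Real.exp (s * u p))
    (x₀ := t) (s := Metric.ball t 1) (bound := fun _ => Real.exp (|t| + 1))
    (Metric.ball_mem_nhds _ one_pos) (Eventually.of_forall fun s => by fun_prop)
    (integrable_tilt p 0 t) (by fun_prop) ?_ (integrable_const _) ?_).2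
  · exact h
  · filter_upwards [abs_apply_le_of_uniformSphere] with u hu s hs
    rw [norm_mul, pow_one, Real.norm_eq_abs, Real.norm_eq_abs, Real.abs_exp]
    have hs' : |s| ≤ |t| + 1 := by
      rw [Metric.mem_ball, Real.dist_eq] at hs
      linarith [abs_sub_abs_le_abs_sub s t]
    calc |u p| * Real.exp (s * u p) ≤ 1 * Real.exp (|t| + 1) := by
          gcongr
          · exact hu p
          · calc s * u p ≤ |s| * |u p| := by rw [← abs_mul]; exact le_abs_self _
              _ ≤ (|t| + 1) * 1 := by gcongr; exact hu p
              _ = |t| + 1 := mul_one _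
      _ = _ := one_mul _
  · refine Eventually.of_forall fun u s _ => ?_
    simp only [pow_zero, one_mul, pow_one]
    exact (((hasDerivAt_id s).mul_const (u p)).exp).congr_deriv (by simp [mul_comm])

/-! ### Increments of the logarithm of the Laplace transform -/

lemma sphereLaplace_eq_tiltMoment {d : ℕ} (p : Fin d) (v : EuclideanSpace ℝ (Fin d)) :
    sphereLaplace d v = tiltMoment p 0 ‖v‖ := by
  rw [sphereLaplace_congr_norm (w := EuclideanSpace.single p ‖v‖) (by simp), sphereLaplace,
    tiltMoment]
  congr with u
  simp [EuclideanSpace.inner_single_right]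

lemma sphereLaplace_pos {d : ℕ} (hd : 0 < d) (v : EuclideanSpace ℝ (Fin d)) :
    0 < sphereLaplace d v := by
  rw [sphereLaplace_eq_tiltMoment ⟨0, hd⟩]
  exact tiltMoment_zero_pos _ _

/-- Cauchy's mean value theorem for s ↦ log M₀(s) against s ↦ s²/2: the ratio of derivatives at t is
M₁/(t M₀) = 1/y. Comparing with s²/2 makes the increment linear in the squared norms, which is the
form needed for ⟨S, x_i⟩. -/
lemma log_sphereLaplace_sub {d : ℕ} (hd : 2 ≤ d) {v w : EuclideanSpace ℝ (Fin d)}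
    (h : ‖w‖ < ‖v‖) : ∃ t y : ℝ, ‖w‖ < t ∧ t < ‖v‖ ∧ 0 < y ∧ t ^ 2 ≤ y ^ 2 - (d - 1) * y ∧
      y ^ 2 - (d - 1) * y ≤ t ^ 2 + d ∧
      Real.log (sphereLaplace d v) - Real.log (sphereLaplace d w)
        = (‖v‖ ^ 2 - ‖w‖ ^ 2) / (2 * y) := by
  let p : Fin d := ⟨0, by omega⟩
  have hder : ∀ s, HasDerivAt (fun s => Real.log (tiltMoment p 0 s))
      (tiltMoment p 1 s / tiltMoment p 0 s) s := fun s =>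
    (hasDerivAt_tiltMoment_zero p s).log (tiltMoment_zero_pos p s).ne'
  have hder2 : ∀ s : ℝ, HasDerivAt (fun s => s ^ 2 / 2) s s := fun s =>
    ((hasDerivAt_pow 2 s).div_const 2).congr_deriv (by simp)
  obtain ⟨t, ht, heq⟩ := exists_ratio_hasDerivAt_eq_ratio_slope
    (fun s => Real.log (tiltMoment p 0 s)) _ h
    (fun s _ => (hder s).continuousAt.continuousWithinAt) (fun s _ => hder s)
    (fun s => s ^ 2 / 2) _ (fun s _ => (hder2 s).continuousAt.continuousWithinAt)
    (fun s _ => hder2 s)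
  have ht0 : 0 < t := (norm_nonneg w).trans_lt ht.1
  obtain ⟨y, hy0, hy1, hy2, hy⟩ := exists_tiltMoment_ratio hd p ht0
  refine ⟨t, y, ht.1, ht.2, hy0, hy1, hy2, ?_⟩
  rw [sphereLaplace_eq_tiltMoment p, sphereLaplace_eq_tiltMoment p]
  have hM := tiltMoment_zero_pos p t
  have hr : tiltMoment p 1 t / tiltMoment p 0 t = t / y := by
    rw [div_eq_div_iff hM.ne' hy0.ne', hy]
  rw [hr] at heq
  have h2 : (Real.log (tiltMoment p 0 ‖v‖) - Real.log (tiltMoment p 0 ‖w‖)) * t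
      = (‖v‖ ^ 2 - ‖w‖ ^ 2) / (2 * y) * t := by
    rw [← heq]; field_simp
  exact mul_right_cancel₀ ht0.ne' h2

/-- `D` is the positive root of Y² - dY = D² - dD, while y nearly solves the same equation because
t² lies within δD² of the right-hand side. Stability of this root gives |y - D| ≤ 2(δ + 2/D) D, and
then 1/(2y) may be replaced by 1/(2D). -/
lemma abs_log_sphereLaplace_sub_le_aux {d : ℕ} (hd : 2 ≤ d) {v w : EuclideanSpace ℝ (Fin d)}
    (h : ‖w‖ < ‖v‖) {D δ : ℝ} (hdD : d ≤ D) (hD : 4 ≤ D) (hδ : δ + 2 / D ≤ 1 / 4)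
    (hv : |‖v‖ ^ 2 - (D ^ 2 - d * D)| ≤ δ * D ^ 2) (hw : |‖w‖ ^ 2 - (D ^ 2 - d * D)| ≤ δ * D ^ 2) :
    |Real.log (sphereLaplace d v) - Real.log (sphereLaplace d w) - (‖v‖ ^ 2 - ‖w‖ ^ 2) / (2 * D)|
      ≤ |‖v‖ ^ 2 - ‖w‖ ^ 2| / D * (2 * (δ + 2 / D)) := by
  have hd' : (2 : ℝ) ≤ d := by exact_mod_cast hd
  obtain ⟨t, y, hwt, htv, hy0, h1, h2, heq⟩ := log_sphereLaplace_sub hd h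
  have hD0 : 0 < D := by linarith
  have ht : |t ^ 2 - (D ^ 2 - d * D)| ≤ δ * D ^ 2 := by
    have a1 : ‖w‖ ^ 2 ≤ t ^ 2 := by gcongr
    have a2 : t ^ 2 ≤ ‖v‖ ^ 2 := by
      have := (norm_nonneg w).trans hwt.le
      gcongr
    rw [abs_le] at *
    constructor <;> linarith [hv.1, hv.2, hw.1, hw.2]
  have hyd : (d : ℝ) - 1 ≤ y := by
    by_contra hc
    push Not at hc
    nlinarith [sq_nonneg t]
  have hyD : |y - D| * (D - 2) ≤ δ * D ^ 2 + 2 * D := by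
    have b1 : |(y - D) * (y + D - d)| ≤ δ * D ^ 2 + d + y := by
      have : (y - D) * (y + D - d) = y ^ 2 - (d - 1) * y - y - (D ^ 2 - d * D) := by ring
      rw [this]
      rw [abs_le] at *
      constructor <;> linarith [ht.1, ht.2]
    rw [abs_mul] at b1
    -- The second factor is bounded below because y ≥ d - 1, so |y - D| is controlled by the defect
    -- of the quadratic equation.
    have b2 : D - 1 ≤ |y + D - d| := (by linarith : D - 1 ≤ y + D - d).trans (le_abs_self _)
    have b3 : |y - D| * (D - 1) ≤ |y - D| * |y + D - d| := by gcongr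
    have b4 : y ≤ D + |y - D| := by linarith [le_abs_self (y - D)]
    nlinarith
  have hyε : |y - D| ≤ 2 * (δ + 2 / D) * D := by
    have c1 : |y - D| * (D / 2) ≤ |y - D| * (D - 2) := by gcongr; linarith
    have c2 : |y - D| * (D / 2) ≤ 2 * (δ + 2 / D) * D * (D / 2) := by
      have : 2 * (δ + 2 / D) * D * (D / 2) = δ * D ^ 2 + 2 * D := by field_simp
      rw [this]; linarith
    exact le_of_mul_le_mul_right c2 (by positivity)
  have hε0 : 0 ≤ 2 * (δ + 2 / D) * D := (abs_nonneg _).trans hyε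
  have hε1 : 0 ≤ 2 * (δ + 2 / D) := nonneg_of_mul_nonneg_left hε0 hD0
  have hyhalf : D / 2 ≤ y := by
    have : |y - D| ≤ 1 / 2 * D := hyε.trans (by gcongr; linarith)
    linarith [(abs_le.1 this).1]
  rw [heq]
  have e : (‖v‖ ^ 2 - ‖w‖ ^ 2) / (2 * y) - (‖v‖ ^ 2 - ‖w‖ ^ 2) / (2 * D)
      = (‖v‖ ^ 2 - ‖w‖ ^ 2) * ((D - y) / (2 * y * D)) := by
    field_simp
  rw [e, abs_mul, abs_div, abs_of_pos (by positivity : 0 < 2 * y * D), abs_sub_comm D y,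
    div_mul_eq_mul_div, mul_div_assoc _ _ D]
  refine mul_le_mul_of_nonneg_left ?_ (abs_nonneg _)
  rw [div_le_div_iff₀ (by positivity) hD0]
  calc |y - D| * D ≤ 2 * (δ + 2 / D) * D * D := by gcongr
    _ ≤ 2 * (δ + 2 / D) * (2 * y * D) := by
      rw [mul_assoc _ D D]
      gcongr
      linarith

lemma abs_log_sphereLaplace_sub_le {d : ℕ} (hd : 2 ≤ d) {v w : EuclideanSpace ℝ (Fin d)}
    {D δ : ℝ} (hdD : d ≤ D) (hD : 4 ≤ D) (hδ : δ + 2 / D ≤ 1 / 4)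
    (hv : |‖v‖ ^ 2 - (D ^ 2 - d * D)| ≤ δ * D ^ 2) (hw : |‖w‖ ^ 2 - (D ^ 2 - d * D)| ≤ δ * D ^ 2) :
    |Real.log (sphereLaplace d v) - Real.log (sphereLaplace d w) - (‖v‖ ^ 2 - ‖w‖ ^ 2) / (2 * D)|
      ≤ |‖v‖ ^ 2 - ‖w‖ ^ 2| / D * (2 * (δ + 2 / D)) := by
  rcases lt_trichotomy ‖w‖ ‖v‖ with h | h | h
  · exact abs_log_sphereLaplace_sub_le_aux hd h hdD hD hδ hv hw
  · rw [sphereLaplace_congr_norm h, h]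
    simp
  · have := abs_log_sphereLaplace_sub_le_aux hd h hdD hD hδ hw hv
    rw [abs_sub_comm (‖w‖ ^ 2)] at this
    refine le_trans (le_of_eq ?_) this
    rw [← abs_neg]
    congr 1
    ring

/-! ### Gaussian likelihoods and integration over the center -/

lemma lintegral_pi_prod {ι : Type*} [Fintype ι] {X : ι → Type*} [∀ i, MeasurableSpace (X i)]
    (ν : ∀ i, Measure (X i)) [∀ i, IsProbabilityMeasure (ν i)] {f : ∀ i, X i → ENNReal}
    (hf : ∀ i, Measurable (f i)) :
    ∫⁻ x, ∏ i, f i (x i) ∂(Measure.pi ν) = ∏ i, ∫⁻ s, f i s ∂(ν i) := by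
  have h := lintegral_prod_eq_prod_lintegral_of_indepFun (μ := Measure.pi ν) Finset.univ
    (fun i (x : ∀ i, X i) => f i (x i)) (iIndepFun_pi fun i => (hf i).aemeasurable)
    (fun i => (hf i).comp (measurable_pi_apply i))
  rw [h]
  refine Finset.prod_congr rfl fun i _ => ?_
  exact (measurePreserving_eval ν i).lintegral_comp (hf i)

lemma pi_withDensity {ι : Type*} [Fintype ι] {X : ι → Type*} [∀ i, MeasurableSpace (X i)]
    (ν ν' : ∀ i, Measure (X i)) [∀ i, IsProbabilityMeasure (ν i)]
    [∀ i, IsProbabilityMeasure (ν' i)] {f : ∀ i, X i → ENNReal}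
    (hf : ∀ i, Measurable (f i)) (h : ∀ i, ν' i = (ν i).withDensity (f i)) :
    Measure.pi ν' = (Measure.pi ν).withDensity fun x => ∏ i, f i (x i) := by
  refine Measure.pi_eq fun s hs => ?_
  rw [withDensity_apply _ (.univ_pi hs), ← lintegral_indicator (.univ_pi hs)]
  have e : ∀ x : ∀ i, X i, (Set.univ.pi s).indicator (fun x => ∏ i, f i (x i)) x
      = ∏ i, (s i).indicator (f i) (x i) := by
    intro x
    by_cases hx : x ∈ Set.univ.pi s
    · rw [Set.indicator_of_mem hx]
      exact Finset.prod_congr rfl fun i _ =>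
        (Set.indicator_of_mem (hx i (Set.mem_univ i)) _).symm
    · rw [Set.indicator_of_notMem hx]
      simp only [Set.mem_univ_pi, not_forall] at hx
      obtain ⟨i, hi⟩ := hx
      exact (Finset.prod_eq_zero (Finset.mem_univ i) (Set.indicator_of_notMem hi _)).symm
  simp only [e]
  rw [lintegral_pi_prod ν fun i => (hf i).indicator (hs i)]
  refine Finset.prod_congr rfl fun i _ => ?_
  rw [h i, withDensity_apply _ (hs i), lintegral_indicator (hs i)]

lemma gaussianReal_one_eq_withDensity (m : ℝ) :
    gaussianReal m 1 = (gaussianReal 0 1).withDensity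
      fun x => ENNReal.ofReal (Real.exp (m * x - m ^ 2 / 2)) := by
  rw [gaussianReal_of_var_ne_zero _ one_ne_zero, gaussianReal_of_var_ne_zero _ one_ne_zero,
    ← withDensity_mul _ (measurable_gaussianPDF _ _) (by fun_prop)]
  congr with x
  rw [Pi.mul_apply, gaussianPDF, gaussianPDF, ← ENNReal.ofReal_mul (gaussianPDFReal_nonneg _ _ _),
    gaussianPDFReal, gaussianPDFReal, mul_assoc (√_)⁻¹, ← Real.exp_add]
  congr 3
  simp
  ring

lemma prod_ofReal_exp {ι : Type*} (s : Finset ι) (f : ι → ℝ) :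
    ∏ i ∈ s, ENNReal.ofReal (Real.exp (f i)) = ENNReal.ofReal (Real.exp (∑ i ∈ s, f i)) := by
  rw [Real.exp_sum, ENNReal.ofReal_prod_of_nonneg fun i _ => (Real.exp_pos _).le]

lemma stdGaussian_map_const_add {d : ℕ} (m : EuclideanSpace ℝ (Fin d)) :
    (stdGaussian (EuclideanSpace ℝ (Fin d))).map (m + ·)
      = (stdGaussian (EuclideanSpace ℝ (Fin d))).withDensity
        fun x => ENNReal.ofReal (Real.exp (inner ℝ m x - ‖m‖ ^ 2 / 2)) := by
  have h : Measure.pi (fun j => gaussianReal (m j) 1)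
      = (Measure.pi fun _ : Fin d => gaussianReal 0 1).map (fun x j => m j + x j) := by
    rw [Measure.pi_map_pi (f := fun j x => m j + x) fun j => by fun_prop]
    congr with j
    rw [gaussianReal_map_const_add, zero_add]
  have h' := pi_withDensity (fun _ : Fin d => gaussianReal 0 1) (fun j => gaussianReal (m j) 1)
    (fun j => by fun_prop) (fun j => gaussianReal_one_eq_withDensity (m j))
  rw [h] at h'
  have hm : Measurable (WithLp.toLp 2 : (Fin d → ℝ) → EuclideanSpace ℝ (Fin d)) := by fun_prop
  rw [← map_pi_eq_stdGaussian, Measure.map_map (by fun_prop) hm]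
  have e : (m + ·) ∘ (WithLp.toLp 2 : (Fin d → ℝ) → EuclideanSpace ℝ (Fin d))
      = WithLp.toLp 2 ∘ fun x j => m j + x j := by
    ext x j; simp
  rw [e, ← Measure.map_map hm (by fun_prop), h']
  ext s hs
  rw [Measure.map_apply hm hs, withDensity_apply _ (hm hs), withDensity_apply _ hs,
    setLIntegral_map hs (by fun_prop) hm]
  refine lintegral_congr fun x => ?_
  rw [prod_ofReal_exp, Finset.sum_sub_distrib, EuclideanSpace.real_norm_sq_eq, Finset.sum_div]
  congr 3
  simp [PiLp.inner_apply, mul_comm]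

lemma lintegral_exp_inner_stdGaussian {d : ℕ} (m : EuclideanSpace ℝ (Fin d)) :
    ∫⁻ x, ENNReal.ofReal (Real.exp (inner ℝ m x)) ∂(stdGaussian (EuclideanSpace ℝ (Fin d)))
      = ENNReal.ofReal (Real.exp (‖m‖ ^ 2 / 2)) := by
  have h := congrArg (fun ν => ν Set.univ) (stdGaussian_map_const_add m)
  simp only at h
  rw [Measure.map_apply (by fun_prop) .univ, Set.preimage_univ, measure_univ,
    withDensity_apply _ .univ, Measure.restrict_univ] at h
  have e : ∀ x, ENNReal.ofReal (Real.exp (inner ℝ m x)) = ENNReal.ofReal (Real.exp (‖m‖ ^ 2 / 2))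
      * ENNReal.ofReal (Real.exp (inner ℝ m x - ‖m‖ ^ 2 / 2)) := by
    intro x
    rw [← ENNReal.ofReal_mul (Real.exp_pos _).le, ← Real.exp_add]
    congr 2; ring
  simp only [e]
  rw [lintegral_const_mul _ (by fun_prop), ← h, mul_one]

/-- Multiply the densities of the shifted Gaussians. Since y_j² = 1, the labels enter only through ∑
y_j x_j. -/
lemma gmm_eq_withDensity {n d : ℕ} (μ : EuclideanSpace ℝ (Fin d)) (y : Fin n → ℤˣ) :
    gmm μ y = (Measure.pi fun _ : Fin n => stdGaussian (EuclideanSpace ℝ (Fin d))).withDensity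
      fun x => ENNReal.ofReal
        (Real.exp (inner ℝ μ (∑ j, ((y j : ℤ) : ℝ) • x j) - n * ‖μ‖ ^ 2 / 2)) := by
  have hp : ∀ j, IsProbabilityMeasure ((stdGaussian (EuclideanSpace ℝ (Fin d))).map
      ((((y j : ℤ) : ℝ) • μ) + ·)) := fun j =>
    Measure.isProbabilityMeasure_map (by fun_prop)
  rw [gmm, Measure.pi_map_pi (f := fun j x => ((y j : ℤ) : ℝ) • μ + x) fun j => by fun_prop,
    pi_withDensity (fun _ : Fin n => stdGaussian (EuclideanSpace ℝ (Fin d))) _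
      (fun j => by fun_prop) (fun j => stdGaussian_map_const_add _)]
  congr with x
  rw [prod_ofReal_exp]
  congr 2
  rw [Finset.sum_sub_distrib, inner_sum]
  congr 1
  · refine Finset.sum_congr rfl fun j _ => ?_
    rw [inner_smul_left, inner_smul_right]; simp
  · have : ∀ j, ‖((y j : ℤ) : ℝ) • μ‖ = ‖μ‖ := fun j => by
      rw [norm_smul]
      rcases Int.units_eq_one_or (y j) with h | h <;> simp [h]
    simp [this]
    ring

lemma lintegral_uniformSphere_exp {d : ℕ} (hd : 0 < d) (R : ℝ) (v : EuclideanSpace ℝ (Fin d)) :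
    ∫⁻ μ, ENNReal.ofReal (Real.exp (inner ℝ μ v)) ∂(uniformSphere d R)
      = ENNReal.ofReal (sphereLaplace d (R • v)) := by
  have := isProbabilityMeasure_uniformSphere hd 1
  rw [uniformSphere_eq_map, lintegral_map (by fun_prop) (by fun_prop), sphereLaplace,
    ofReal_integral_eq_lintegral_ofReal _ (Eventually.of_forall fun u => (Real.exp_pos _).le)]
  · simp [inner_smul_left, inner_smul_right]
  · refine Integrable.of_bound (C := Real.exp ‖R • v‖) (by fun_prop) ?_
    filter_upwards [norm_eq_of_uniformSphere (d := d) zero_le_one] with u hu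
    rw [Real.norm_eq_abs, Real.abs_exp]
    gcongr
    simpa [hu] using real_inner_le_norm u (R • v)

lemma measurable_sphereLaplace {d : ℕ} (hd : 0 < d) : Measurable (sphereLaplace d) := by
  have := isProbabilityMeasure_uniformSphere hd 1
  have h : StronglyMeasurable (fun p : EuclideanSpace ℝ (Fin d) × EuclideanSpace ℝ (Fin d) =>
      Real.exp (inner ℝ p.2 p.1)) := by fun_prop
  exact h.integral_prod_right.measurable

/-- Tonelli moves the average over μ inside, where the exponential of ⟨μ, ∑ y_j x_j⟩ averages to the
Laplace transform. The factor exp(-nR²/2) does not depend on the labels and so cancels in the odds.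
-/
lemma lintegral_gmm_uniformSphere {n d : ℕ} (hd : 0 < d) {R : ℝ} (hR : 0 ≤ R) (y : Fin n → ℤˣ)
    {g : (Fin n → EuclideanSpace ℝ (Fin d)) → ENNReal} (hg : Measurable g) :
    ∫⁻ μ, ∫⁻ x, g x ∂(gmm μ y) ∂(uniformSphere d R)
      = ∫⁻ x, g x * ENNReal.ofReal (Real.exp (-(n * R ^ 2 / 2)) *
          sphereLaplace d (R • ∑ j, ((y j : ℤ) : ℝ) • x j))
        ∂(Measure.pi fun _ : Fin n => stdGaussian (EuclideanSpace ℝ (Fin d))) := by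
  have := isProbabilityMeasure_uniformSphere hd R
  have h1 : ∫⁻ μ, ∫⁻ x, g x ∂(gmm μ y) ∂(uniformSphere d R)
      = ∫⁻ μ, ∫⁻ x, g x * (ENNReal.ofReal (Real.exp (-(n * R ^ 2 / 2))) *
          ENNReal.ofReal (Real.exp (inner ℝ μ (∑ j, ((y j : ℤ) : ℝ) • x j))))
        ∂(Measure.pi fun _ : Fin n => stdGaussian (EuclideanSpace ℝ (Fin d)))
        ∂(uniformSphere d R) := by
    refine lintegral_congr_ae ?_
    filter_upwards [norm_eq_of_uniformSphere hR] with μ hμ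
    rw [gmm_eq_withDensity, lintegral_withDensity_eq_lintegral_mul _ (by fun_prop) hg]
    refine lintegral_congr fun x => ?_
    rw [Pi.mul_apply, mul_comm, ← ENNReal.ofReal_mul (Real.exp_pos _).le, ← Real.exp_add, hμ]
    congr 3
    ring
  rw [h1, lintegral_lintegral_swap (by fun_prop)]
  refine lintegral_congr fun x => ?_
  rw [lintegral_const_mul _ (by fun_prop), lintegral_const_mul _ (by fun_prop),
    lintegral_uniformSphere_exp hd, ENNReal.ofReal_mul (Real.exp_pos _).le]

/-- Both laws have characteristic function exp(-τ²‖t‖²/2). -/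
lemma pi_stdGaussian_map_sum {n d : ℕ} (c : Fin n → ℝ) {τ : ℝ} (hτ : ∑ j, c j ^ 2 = τ ^ 2) :
    (Measure.pi fun _ : Fin n => stdGaussian (EuclideanSpace ℝ (Fin d))).map
      (fun z => ∑ j, c j • z j) = (stdGaussian (EuclideanSpace ℝ (Fin d))).map (τ • ·) := by
  have hm : Measurable fun z : Fin n → EuclideanSpace ℝ (Fin d) => ∑ j, c j • z j := by fun_prop
  have : IsProbabilityMeasure ((Measure.pi fun _ : Fin n =>
      stdGaussian (EuclideanSpace ℝ (Fin d))).map (fun z => ∑ j, c j • z j)) :=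
    Measure.isProbabilityMeasure_map hm.aemeasurable
  apply Measure.ext_of_charFun
  ext t
  have h2 : ∀ c : ℝ, ∫ z, Complex.exp ((inner ℝ (c • z) t : ℝ) * Complex.I)
      ∂(stdGaussian (EuclideanSpace ℝ (Fin d))) = Complex.exp (-(c * ‖t‖) ^ 2 / 2) := by
    intro c
    have := charFun_stdGaussian (c • t)
    rw [charFun_apply] at this
    simp only [inner_smul_right] at this
    simp only [real_inner_smul_left]
    rw [this, norm_smul]
    congr 3
    norm_cast
    rw [mul_pow, mul_pow, Real.norm_eq_abs, sq_abs]
  rw [charFun_apply, charFun_apply, integral_map hm.aemeasurable (by fun_prop),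
    integral_map (by fun_prop) (by fun_prop), h2]
  simp_rw [sum_inner, Complex.ofReal_sum, Finset.sum_mul, Complex.exp_sum]
  rw [integral_fintype_prod_eq_prod
    (f := fun (j : Fin n) (z : EuclideanSpace ℝ (Fin d)) =>
      Complex.exp ((inner ℝ (c j • z) t : ℝ) * Complex.I))]
  simp only [h2]
  rw [← Complex.exp_sum]
  congr 1
  have : (τ : ℂ) ^ 2 = ∑ j, (c j : ℂ) ^ 2 := by rw [← Complex.ofReal_pow, ← hτ]; push_cast; rfl
  rw [mul_pow, this, Finset.sum_mul, ← Finset.sum_neg_distrib, Finset.sum_div]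
  simp only [mul_pow]

/-! ### Chernoff bounds for Gaussian vectors -/

lemma measure_ge_le_exp {α : Type*} [MeasurableSpace α] {ν : Measure α} {X : α → ℝ}
    (hX : Measurable X) {l B : ℝ} (hl : 0 ≤ l) (s : ℝ)
    (h : ∫⁻ x, ENNReal.ofReal (Real.exp (l * X x)) ∂ν ≤ ENNReal.ofReal (Real.exp B)) :
    ν {x | s ≤ X x} ≤ ENNReal.ofReal (Real.exp (B - l * s)) := by
  have h1 := mul_meas_ge_le_lintegral (μ := ν)
    (f := fun x => ENNReal.ofReal (Real.exp (l * X x))) (by fun_prop)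
    (ENNReal.ofReal (Real.exp (l * s)))
  have h2 : ν {x | s ≤ X x}
      ≤ ν {x | ENNReal.ofReal (Real.exp (l * s)) ≤ ENNReal.ofReal (Real.exp (l * X x))} := by
    refine measure_mono fun x hx => ?_
    simp only [Set.mem_ofPred_eq] at hx ⊢
    gcongr
  have h3 : ENNReal.ofReal (Real.exp (B - l * s))
      = ENNReal.ofReal (Real.exp (-(l * s))) * ENNReal.ofReal (Real.exp B) := by
    rw [← ENNReal.ofReal_mul (Real.exp_pos _).le, ← Real.exp_add]
    congr 2; ring
  have h4 : ENNReal.ofReal (Real.exp (-(l * s))) * ENNReal.ofReal (Real.exp (l * s)) = 1 := by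
    rw [← ENNReal.ofReal_mul (Real.exp_pos _).le, ← Real.exp_add]
    simp
  calc ν {x | s ≤ X x} = ENNReal.ofReal (Real.exp (-(l * s))) *
        (ENNReal.ofReal (Real.exp (l * s)) * ν {x | s ≤ X x}) := by
        rw [← mul_assoc, h4, one_mul]
    _ ≤ ENNReal.ofReal (Real.exp (-(l * s))) * ENNReal.ofReal (Real.exp B) := by
        gcongr
        exact (mul_le_mul_right h2 _).trans (h1.trans h)
    _ = _ := h3.symm

lemma measure_abs_ge_le_exp {α : Type*} [MeasurableSpace α] {ν : Measure α} {X : α → ℝ}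
    (hX : Measurable X) {l B : ℝ} (hl : 0 ≤ l) (s : ℝ)
    (h : ∀ r : ℝ, |r| = l →
      ∫⁻ x, ENNReal.ofReal (Real.exp (r * X x)) ∂ν ≤ ENNReal.ofReal (Real.exp B)) :
    ν {x | s ≤ |X x|} ≤ 2 * ENNReal.ofReal (Real.exp (B - l * s)) := by
  have h1 := measure_ge_le_exp hX hl s (h l (abs_of_nonneg hl))
  have h2 := measure_ge_le_exp hX.neg hl s (ν := ν) (B := B) (by
    have := h (-l) (by rw [abs_neg, abs_of_nonneg hl])
    simpa using this)
  have : {x | s ≤ |X x|} ⊆ {x | s ≤ X x} ∪ {x | s ≤ (-X) x} := by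
    intro x hx
    simpa [le_abs] using hx
  calc ν {x | s ≤ |X x|} ≤ ν {x | s ≤ X x} + ν {x | s ≤ (-X) x} :=
        (measure_mono this).trans (measure_union_le _ _)
    _ ≤ _ := by rw [two_mul]; exact add_le_add h1 h2

lemma stdGaussian_inner_tail {d : ℕ} (e : EuclideanSpace ℝ (Fin d)) {K q : ℝ}
    (hq : 0 ≤ q) (he : e ≠ 0) :
    stdGaussian (EuclideanSpace ℝ (Fin d)) {h | K * (‖e‖ * √q) ≤ |inner ℝ e h|}
      ≤ 2 * ENNReal.ofReal (Real.exp (-(K - 1 / 2) * q)) := by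
  have he' : 0 < ‖e‖ := norm_pos_iff.2 he
  -- With this exponent the log-moment is q/2 and the threshold contributes -Kq. Optimizing over `l`
  -- is unnecessary, since K is free.
  refine (measure_abs_ge_le_exp (l := √q / ‖e‖) (B := q / 2) (by fun_prop) (by positivity) _
    fun r hr => ?_).trans (le_of_eq ?_)
  · have := lintegral_exp_inner_stdGaussian (r • e)
    simp only [real_inner_smul_left] at this
    rw [this, norm_smul, Real.norm_eq_abs, hr, div_mul_cancel₀ _ he'.ne', Real.sq_sqrt hq]
  · congr 3
    have := Real.mul_self_sqrt hq
    field_simp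
    rw [Real.sq_sqrt hq]
    ring

/-- This is -log(1 - u) ≤ u + u² near 0, used with u = 2r to bound the moment generating function
exp(-r)(1 - 2r)^(-1/2) of a centered squared Gaussian by exp(2r²). -/
lemma one_le_one_sub_mul_exp {u : ℝ} (hu : |u| ≤ 1 / 2) : 1 ≤ (1 - u) * Real.exp (u + u ^ 2) := by
  rw [abs_le] at hu
  rcases le_total 0 u with h | h
  · have := Real.quadratic_le_exp_of_nonneg (x := u + u ^ 2) (by positivity)
    have h1 : 0 ≤ 1 - u := by linarith
    refine le_trans ?_ (mul_le_mul_of_nonneg_left this h1)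
    have : 0 ≤ u ^ 2 * (1 - u - u ^ 2 - u ^ 3) := by
      have : u ^ 2 ≤ (1 / 2) ^ 2 := by gcongr; exact hu.2
      have : u ^ 3 ≤ (1 / 2) ^ 3 := by gcongr; exact hu.2
      have : 0 ≤ 1 - u - u ^ 2 - u ^ 3 := by linarith [hu.2]
      positivity
    nlinarith
  · have := Real.add_one_le_exp (u + u ^ 2)
    have h1 : 0 ≤ 1 - u := by linarith
    refine le_trans ?_ (mul_le_mul_of_nonneg_left this h1)
    have : 0 ≤ u ^ 2 * (-u) := mul_nonneg (sq_nonneg _) (by linarith)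
    nlinarith

lemma lintegral_exp_sq_gaussianReal {r : ℝ} (hr : |r| ≤ 1 / 4) :
    ∫⁻ x, ENNReal.ofReal (Real.exp (r * (x ^ 2 - 1))) ∂(gaussianReal 0 1)
      ≤ ENNReal.ofReal (Real.exp (2 * r ^ 2)) := by
  have hr' := abs_le.1 hr
  have hb : 0 < 1 / 2 - r := by linarith [hr'.2]
  rw [gaussianReal_of_var_ne_zero _ one_ne_zero,
    lintegral_withDensity_eq_lintegral_mul _ (measurable_gaussianPDF _ _) (by fun_prop)]
  have e : ∀ x, (gaussianPDF 0 1 * fun x => ENNReal.ofReal (Real.exp (r * (x ^ 2 - 1)))) x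
      = ENNReal.ofReal ((√(2 * Real.pi))⁻¹ * Real.exp (-r) *
        Real.exp (-(1 / 2 - r) * x ^ 2)) := by
    intro x
    rw [Pi.mul_apply, gaussianPDF, ← ENNReal.ofReal_mul (gaussianPDFReal_nonneg _ _ _),
      gaussianPDFReal, mul_assoc (√_)⁻¹, mul_assoc (√_)⁻¹, ← Real.exp_add, ← Real.exp_add]
    congr 3
    · simp
    · simp; ring
  simp only [e]
  rw [← ofReal_integral_eq_lintegral_ofReal ((integrable_exp_neg_mul_sq hb).const_mul _)
    (Eventually.of_forall fun x => by positivity), integral_const_mul, integral_gaussian]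
  refine ENNReal.ofReal_le_ofReal ?_
  have h1 := one_le_one_sub_mul_exp (u := 2 * r) (by rw [abs_mul, abs_two]; linarith)
  have h2 : √(Real.pi / (1 / 2 - r)) = √(2 * Real.pi) * (√(1 - 2 * r))⁻¹ := by
    rw [← Real.sqrt_inv, ← Real.sqrt_mul (by positivity)]
    congr 1
    have : 1 - 2 * r ≠ 0 := by linarith
    field_simp
  have h3 : 0 < √(2 * Real.pi) := by positivity
  have h4 : 0 < 1 - 2 * r := by linarith
  have h5 : 1 ≤ √(1 - 2 * r) * Real.exp (r + 2 * r ^ 2) := by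
    rw [← Real.sqrt_sq (Real.exp_pos (r + 2 * r ^ 2)).le, ← Real.sqrt_mul h4.le, Real.one_le_sqrt,
      ← Real.exp_nat_mul]
    convert h1 using 3
    push_cast; ring
  calc (√(2 * Real.pi))⁻¹ * Real.exp (-r) * √(Real.pi / (1 / 2 - r))
      = Real.exp (-r) * (√(1 - 2 * r))⁻¹ := by rw [h2]; field_simp
    _ ≤ Real.exp (-r) * Real.exp (r + 2 * r ^ 2) := by
        gcongr
        rwa [inv_le_iff_one_le_mul₀' (by positivity)]
    _ = _ := by rw [← Real.exp_add]; congr 1; ring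

lemma stdGaussian_norm_sq_tail {d : ℕ} {K q : ℝ} (hq : 0 < q) :
    stdGaussian (EuclideanSpace ℝ (Fin d)) {h | K * (√(d * q) + q) ≤ |‖h‖ ^ 2 - d|}
      ≤ 2 * ENNReal.ofReal (Real.exp (-(K / 4 - 1 / 2) * q)) := by
  have hsd := Real.sqrt_nonneg (d : ℝ)
  have hsq := Real.sqrt_pos.2 hq
  have hden : 0 < √(d : ℝ) + √q := by positivity
  have hl : √q / (√d + √q) ≤ 1 := by rw [div_le_one hden]; linarith
  -- The exponent is at most 1/4, as the squared-Gaussian bound requires. The d coordinates cost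
  -- 2dl² ≤ q/8, and l(√(dq) + q) = q/4 exactly, in small and large dimension alike.
  refine (measure_abs_ge_le_exp (l := √q / (√d + √q) / 4) (B := q / 2) (by fun_prop)
    (by positivity) _ fun r hr => ?_).trans (le_of_eq ?_)
  · have hr4 : |r| ≤ 1 / 4 := by rw [hr]; linarith
    rw [← map_pi_eq_stdGaussian, lintegral_map (by fun_prop) (by fun_prop)]
    have e : ∀ x : Fin d → ℝ, ENNReal.ofReal (Real.exp (r *
        (‖(WithLp.toLp 2 x : EuclideanSpace ℝ (Fin d))‖ ^ 2 - d)))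
        = ∏ j, ENNReal.ofReal (Real.exp (r * (x j ^ 2 - 1))) := by
      intro x
      rw [prod_ofReal_exp, ← Finset.mul_sum, Finset.sum_sub_distrib,
        EuclideanSpace.real_norm_sq_eq]
      simp
    simp only [e]
    rw [lintegral_pi_prod (fun _ : Fin d => gaussianReal 0 1)
      (f := fun _ s => ENNReal.ofReal (Real.exp (r * (s ^ 2 - 1)))) (fun _ => by fun_prop)]
    calc ∏ _j : Fin d, ∫⁻ s, ENNReal.ofReal (Real.exp (r * (s ^ 2 - 1))) ∂(gaussianReal 0 1)
        ≤ ∏ _j : Fin d, ENNReal.ofReal (Real.exp (2 * r ^ 2)) :=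
          Finset.prod_le_prod' fun _ _ => lintegral_exp_sq_gaussianReal hr4
      _ = ENNReal.ofReal (Real.exp (d * (2 * r ^ 2))) := by rw [prod_ofReal_exp]; simp
      _ ≤ _ := by
        refine ENNReal.ofReal_le_ofReal (Real.exp_le_exp.2 ?_)
        rw [← sq_abs r, hr]
        have : √(d : ℝ) * (√q / (√d + √q)) ≤ √q := by
          rw [mul_div_assoc', div_le_iff₀ hden, mul_comm]
          gcongr
          linarith
        have h2 : (√(d : ℝ) * (√q / (√d + √q))) ^ 2 ≤ √q ^ 2 := by gcongr
        rw [mul_pow, Real.sq_sqrt (Nat.cast_nonneg d), Real.sq_sqrt hq.le] at h2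
        nlinarith
  · congr 3
    have e : √(d * q) + q = √q * (√d + √q) := by
      rw [Real.sqrt_mul (Nat.cast_nonneg d), mul_add, Real.mul_self_sqrt hq.le]; ring
    rw [e]
    field_simp
    rw [Real.sq_sqrt hq.le]
    ring

/-! ### Likelihood ratio and row sums of the block model -/

lemma coe_toProb {p : ℝ} (hp : p ∈ Set.Ioo (0 : ℝ) 1) : ((toProb p : unitInterval) : ℝ) = p := by
  rw [toProb, Set.projIcc_of_mem _ (Set.Ioo_subset_Icc_self hp)]

lemma bernoulliMeasure_toProb {p : ℝ} (hp : p ∈ Set.Ioo (0 : ℝ) 1) :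
    bernoulliMeasure (1 : ℝ) 0 (toProb p)
      = ENNReal.ofReal p • Measure.dirac 1 + ENNReal.ofReal (1 - p) • Measure.dirac 0 := by
  have h1 : unitInterval.toNNReal (toProb p) = p.toNNReal := by
    ext
    simp [coe_toProb hp, hp.1.le]
  have h2 : unitInterval.toNNReal (unitInterval.symm (toProb p)) = (1 - p).toNNReal := by
    ext
    simp [coe_toProb hp, hp.2.le]
  rw [bernoulliMeasure_def, h1, h2]
  rfl

lemma lintegral_bernoulliMeasure_toProb {p : ℝ} (hp : p ∈ Set.Ioo (0 : ℝ) 1) (f : ℝ → ENNReal) :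
    ∫⁻ v, f v ∂(bernoulliMeasure (1 : ℝ) 0 (toProb p))
      = ENNReal.ofReal p * f 1 + ENNReal.ofReal (1 - p) * f 0 := by
  rw [bernoulliMeasure_toProb hp, lintegral_add_measure, lintegral_smul_measure,
    lintegral_smul_measure, lintegral_dirac, lintegral_dirac]
  rfl

lemma bernoulliMeasure_eq_withDensity {p p' : ℝ} (hp : p ∈ Set.Ioo (0 : ℝ) 1)
    (hp' : p' ∈ Set.Ioo (0 : ℝ) 1) :
    bernoulliMeasure (1 : ℝ) 0 (toProb p) = (bernoulliMeasure (1 : ℝ) 0 (toProb p')).withDensity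
      fun v => ENNReal.ofReal
        (Real.exp (v * Real.log (p / p') + (1 - v) * Real.log ((1 - p) / (1 - p')))) := by
  have h1 : 0 < 1 - p := sub_pos.2 hp.2
  have h1' : 0 < 1 - p' := sub_pos.2 hp'.2
  have e1 : p' * (p / p') = p := mul_div_cancel₀ _ hp'.1.ne'
  have e2 : (1 - p') * ((1 - p) / (1 - p')) = 1 - p := mul_div_cancel₀ _ h1'.ne'
  ext s hs
  rw [withDensity_apply _ hs, ← lintegral_indicator hs, lintegral_bernoulliMeasure_toProb hp',
    ← lintegral_indicator_one hs, lintegral_bernoulliMeasure_toProb hp]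
  congr 1
  · by_cases h : (1 : ℝ) ∈ s
    · rw [Set.indicator_of_mem h, Set.indicator_of_mem h, one_mul, sub_self, zero_mul, add_zero,
        Real.exp_log (div_pos hp.1 hp'.1), ← ENNReal.ofReal_mul hp'.1.le, e1]
      simp
    · simp [h]
  · by_cases h : (0 : ℝ) ∈ s
    · rw [Set.indicator_of_mem h, Set.indicator_of_mem h, zero_mul, sub_zero, zero_add, one_mul,
        Real.exp_log (div_pos h1 h1'), ← ENNReal.ofReal_mul h1'.le, e2]
      simp
    · simp [h]

/-- Ordered pairs with an endpoint i correspond to the other endpoint j ≠ i. This translates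
products over independent edges into sums along row i of the symmetric matrix. -/
lemma sum_incident_edges {n : ℕ} (i : Fin n) (e : {p : Fin n × Fin n // p.1 < p.2} → ℝ)
    (g : Fin n → ℝ → ℝ) :
    ∑ p : {p : Fin n × Fin n // p.1 < p.2}, (if p.1.1 = i then g p.1.2 (e p)
        else if p.1.2 = i then g p.1.1 (e p) else 0)
      = ∑ j ∈ Finset.univ.erase i, g j (symmMatrix e i j) := by
  rw [← Finset.sum_filter_of_ne
    (p := fun p : {p : Fin n × Fin n // p.1 < p.2} => p.1.1 = i ∨ p.1.2 = i)]
  · refine Finset.sum_nbij (fun p => if p.1.1 = i then p.1.2 else p.1.1) ?_ ?_ ?_ ?_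
    · rintro ⟨⟨j, k⟩, hjk⟩ hp
      have hne := hjk.ne
      simp only [Finset.mem_filter, Finset.mem_univ, true_and] at hp
      rcases hp with rfl | rfl
      · simp [hne.symm]
      · simp [hne]
    · rintro ⟨⟨j, k⟩, hjk⟩ hp ⟨⟨j', k'⟩, hjk'⟩ hp' h
      simp only [Finset.coe_filter, Finset.mem_univ, true_and, Set.mem_ofPred_eq] at hp hp' hjk hjk' h
      simp only [Subtype.mk.injEq, Prod.mk.injEq]
      split_ifs at h <;> grind
    · intro j hj
      have hj : j ≠ i := by simpa using hj
      rcases lt_or_gt_of_ne hj with h | h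
      · exact ⟨⟨(j, i), h⟩, by simp, by simp [h.ne]⟩
      · exact ⟨⟨(i, j), h⟩, by simp, by simp⟩
    · rintro ⟨⟨j, k⟩, hjk⟩ hp
      have hne := hjk.ne
      simp only [Finset.mem_filter, Finset.mem_univ, true_and] at hp hjk
      rcases hp with rfl | rfl
      · simp [symmMatrix, hjk]
      · simp [symmMatrix, hjk, hjk.not_gt, hne]
  · intro p _ h
    by_contra hc
    push Not at hc
    simp [hc.1, hc.2] at h

/-- The conditional edge probability in the stochastic block model. -/
noncomputable def edgeProb {n : ℕ} (α β : ℝ) (y : Fin n → ℤˣ)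
    (p : {p : Fin n × Fin n // p.1 < p.2}) : ℝ :=
  if y p.1.1 = y p.1.2 then α else β

lemma edgeProb_mem {n : ℕ} {α β : ℝ} (hα : α ∈ Set.Ioo (0 : ℝ) 1) (hβ : β ∈ Set.Ioo (0 : ℝ) 1)
    (y : Fin n → ℤˣ) (p : {p : Fin n × Fin n // p.1 < p.2}) :
    edgeProb α β y p ∈ Set.Ioo (0 : ℝ) 1 := by
  rw [edgeProb]; split_ifs <;> assumption

/-- The network part of the genie-aided log-likelihood ratio. -/
noncomputable def networkLogRatio {n : ℕ} (α β : ℝ) (i : Fin n) (y : Fin n → ℤˣ)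
    (A : Fin n → Fin n → ℝ) : ℝ :=
  ∑ j ∈ Finset.univ.erase i, ((y j : ℤ) : ℝ) *
    (A i j * Real.log (α / β) + (1 - A i j) * Real.log ((1 - α) / (1 - β)))

/-- Changing y_i affects only the edges at i. Each such edge swaps α and β, so its log-likelihood
ratio changes sign with y_j; every other edge has ratio 1. -/
lemma sbm_update_eq_withDensity {n : ℕ} {α β : ℝ} (hα : α ∈ Set.Ioo (0 : ℝ) 1)
    (hβ : β ∈ Set.Ioo (0 : ℝ) 1) (i : Fin n) (y : Fin n → ℤˣ) :
    sbm α β (Function.update y i 1) = (sbm α β (Function.update y i (-1))).withDensity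
      fun A => ENNReal.ofReal (Real.exp (networkLogRatio α β i y A)) := by
  have hα1 : 0 < 1 - α := sub_pos.2 hα.2
  have hβ1 : 0 < 1 - β := sub_pos.2 hβ.2
  have hm : Measurable fun A : Fin n → Fin n → ℝ =>
      ENNReal.ofReal (Real.exp (networkLogRatio α β i y A)) := by
    unfold networkLogRatio; fun_prop
  have h := pi_withDensity
    (fun p => bernoulliMeasure (1 : ℝ) 0 (toProb (edgeProb α β (Function.update y i (-1)) p)))
    (fun p => bernoulliMeasure (1 : ℝ) 0 (toProb (edgeProb α β (Function.update y i 1) p)))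
    (fun p => by fun_prop) (fun p => bernoulliMeasure_eq_withDensity
      (edgeProb_mem hα hβ _ p) (edgeProb_mem hα hβ _ p))
  have e : ∀ e : {p : Fin n × Fin n // p.1 < p.2} → ℝ,
      ∏ p, ENNReal.ofReal (Real.exp (e p * Real.log (edgeProb α β (Function.update y i 1) p /
        edgeProb α β (Function.update y i (-1)) p) + (1 - e p) *
        Real.log ((1 - edgeProb α β (Function.update y i 1) p) /
          (1 - edgeProb α β (Function.update y i (-1)) p))))
      = ENNReal.ofReal (Real.exp (networkLogRatio α β i y (symmMatrix e))) := by
    intro e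
    rw [prod_ofReal_exp, networkLogRatio, ← sum_incident_edges i e (fun j v => ((y j : ℤ) : ℝ) *
      (v * Real.log (α / β) + (1 - v) * Real.log ((1 - α) / (1 - β))))]
    congr 2
    refine Finset.sum_congr rfl fun p _ => ?_
    obtain ⟨⟨j, k⟩, hjk⟩ := p
    have hne : j ≠ k := hjk.ne
    have l1 : Real.log (β / α) = - Real.log (α / β) := by rw [← Real.log_inv, inv_div]
    have l2 : Real.log ((1 - β) / (1 - α)) = - Real.log ((1 - α) / (1 - β)) := by
      rw [← Real.log_inv, inv_div]
    simp only [edgeProb]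
    by_cases hj : j = i
    · subst hj
      rcases Int.units_eq_one_or (y k) with h | h
      · simp [Function.update_of_ne hne.symm, h]
      · simp [Function.update_of_ne hne.symm, h, l1, l2]
        ring
    · by_cases hk : k = i
      · subst hk
        rcases Int.units_eq_one_or (y j) with h | h
        · simp [h, hj]
        · simp [h, hj, l1, l2]
          ring
      · have hαα : α / α = 1 := div_self hα.1.ne'
        have hββ : β / β = 1 := div_self hβ.1.ne'
        have hα1 : (1 - α) / (1 - α) = 1 := div_self hα1.ne'
        have hβ1 : (1 - β) / (1 - β) = 1 := div_self hβ1.ne'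
        simp only [Function.update_of_ne hj, Function.update_of_ne hk, hj, hk, if_false]
        split_ifs <;> simp [*]
  simp only [e] at h
  have hs := measurable_symmMatrix (n := n)
  simp only [sbm]
  ext s hs'
  rw [Measure.map_apply hs hs', withDensity_apply _ hs', setLIntegral_map hs' hm hs]
  change Measure.pi (fun p => bernoulliMeasure (1 : ℝ) 0
    (toProb (edgeProb α β (Function.update y i 1) p))) _ = _
  rw [h, withDensity_apply _ (hs hs')]
  rfl

/-- Chernoff with exponent 1. An edge of probability π has exponential moment at most 1 + 2π ≤
exp(2(α + β)), using e ≤ 3, and row i meets fewer than n edges. -/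
lemma sbm_row_tail {n : ℕ} {α β : ℝ} (hα : α ∈ Set.Ioo (0 : ℝ) 1)
    (hβ : β ∈ Set.Ioo (0 : ℝ) 1) (i : Fin n) (y : Fin n → ℤˣ) (s : ℝ) :
    sbm α β y {A | s ≤ |∑ j ∈ Finset.univ.erase i, ((y j : ℤ) : ℝ) * A i j|}
      ≤ 2 * ENNReal.ofReal (Real.exp (2 * n * (α + β) - s)) := by
  have key := measure_abs_ge_le_exp (ν := sbm α β y) (l := 1) (B := 2 * n * (α + β))
    (X := fun A => ∑ j ∈ Finset.univ.erase i, ((y j : ℤ) : ℝ) * A i j) (by fun_prop) zero_le_one s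
    fun r hr => ?_
  · simpa using key
  rw [sbm, lintegral_map (by fun_prop) measurable_symmMatrix]
  let c : {p : Fin n × Fin n // p.1 < p.2} → ℝ := fun p =>
    if p.1.1 = i then r * ((y p.1.2 : ℤ) : ℝ) else if p.1.2 = i then r * ((y p.1.1 : ℤ) : ℝ) else 0
  let b : {p : Fin n × Fin n // p.1 < p.2} → ℝ := fun p =>
    if p.1.1 = i then 2 * (α + β) else if p.1.2 = i then 2 * (α + β) else 0
  have e : ∀ e : {p : Fin n × Fin n // p.1 < p.2} → ℝ, ENNReal.ofReal (Real.exp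
      (r * ∑ j ∈ Finset.univ.erase i, ((y j : ℤ) : ℝ) * symmMatrix e i j))
      = ∏ p, ENNReal.ofReal (Real.exp (c p * e p)) := by
    intro e
    rw [prod_ofReal_exp, ← sum_incident_edges i e (fun j v => ((y j : ℤ) : ℝ) * v), Finset.mul_sum]
    congr 2
    refine Finset.sum_congr rfl fun p _ => ?_
    simp only [c]
    split_ifs <;> ring
  simp only [e]
  rw [lintegral_pi_prod _ (f := fun p v => ENNReal.ofReal (Real.exp (c p * v)))
    (fun p => by fun_prop)]
  calc _ ≤ ∏ p, ENNReal.ofReal (Real.exp (b p)) := by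
        refine Finset.prod_le_prod' fun p _ => ?_
        have hp := edgeProb_mem hα hβ y p
        have hle : edgeProb α β y p ≤ α + β := by
          rw [edgeProb]; split_ifs <;> linarith [hα.1, hβ.1]
        change ∫⁻ v, _ ∂(bernoulliMeasure (1 : ℝ) 0 (toProb (edgeProb α β y p))) ≤ _
        generalize edgeProb α β y p = π at hp hle
        rw [lintegral_bernoulliMeasure_toProb hp, ← ENNReal.ofReal_mul hp.1.le,
          ← ENNReal.ofReal_mul (sub_pos.2 hp.2).le, ← ENNReal.ofReal_add
          (by have := hp.1; positivity) (by have := sub_pos.2 hp.2; positivity)]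
        refine ENNReal.ofReal_le_ofReal ?_
        have hc : ∀ k, |r * ((y k : ℤ) : ℝ)| = 1 := fun k => by
          rcases Int.units_eq_one_or (y k) with h | h <;> simp [h, hr]
        have main : ∀ c : ℝ, |c| = 1 →
            π * Real.exp (c * 1) + (1 - π) * Real.exp (c * 0) ≤ Real.exp (2 * (α + β)) := by
          intro c hc
          have h1 : Real.exp (c * 1) ≤ 3 := by
            have : Real.exp (c * 1) ≤ Real.exp 1 := by
              gcongr; rw [mul_one, ← hc]; exact le_abs_self c
            linarith [Real.exp_one_lt_d9]
          have h2 := Real.add_one_le_exp (2 * (α + β))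
          rw [mul_zero, Real.exp_zero]
          have h3 := mul_le_mul_of_nonneg_left h1 hp.1.le
          linarith
        simp only [c, b]
        split_ifs
        · exact main _ (hc _)
        · exact main _ (hc _)
        · simp
    _ = ENNReal.ofReal (Real.exp (((n : ℝ) - 1) * (2 * (α + β)))) := by
        have hn : 1 ≤ n := i.pos
        rw [prod_ofReal_exp, sum_incident_edges i 0 (fun _ _ => 2 * (α + β))]
        simp [Finset.card_erase_of_mem, Nat.cast_sub hn]
    _ ≤ _ := by
        refine ENNReal.ofReal_le_ofReal (Real.exp_le_exp.2 ?_)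
        nlinarith [hα.1, hβ.1]

/-! ### Hoeffding's bound for the labels -/

lemma lintegral_uniformOn_univ {α : Type*} [Fintype α] [MeasurableSpace α]
    [MeasurableSingletonClass α] (f : α → ENNReal) :
    ∫⁻ a, f a ∂(uniformOn (Set.univ : Set α)) = (Fintype.card α : ENNReal)⁻¹ * ∑ a, f a := by
  rw [uniformOn, ProbabilityTheory.cond, Measure.restrict_univ, lintegral_smul_measure, lintegral_count,
    tsum_fintype, Measure.count_univ]
  simp

lemma uniformOn_labels_tail {n : ℕ} (i : Fin n) {K q : ℝ} (hq : 0 ≤ q) :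
    uniformOn (Set.univ : Set (Fin n → ℤˣ))
        {y | K * √(n * q) ≤ |∑ j ∈ Finset.univ.erase i, ((y j : ℤ) : ℝ)|}
      ≤ 2 * ENNReal.ofReal (Real.exp (-(K - 1 / 2) * q)) := by
  have hn : (0 : ℝ) < n := by exact_mod_cast i.pos
  refine (measure_abs_ge_le_exp (l := √(q / n)) (B := q / 2) (measurable_of_finite _)
    (by positivity) _ fun r hr => ?_).trans (le_of_eq ?_)
  · rw [lintegral_uniformOn_univ]
    -- Index i, absent from the sum, gets the constant factor 1, so that the average factors over
    -- all n labels; its total 2 obeys the same bound 2 exp(r²/2) as the others, which use cosh r ≤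
    -- exp(r²/2).
    let f : Fin n → ℤˣ → ENNReal := fun j s =>
      if j = i then 1 else ENNReal.ofReal (Real.exp (r * ((s : ℤ) : ℝ)))
    have e : ∀ y : Fin n → ℤˣ, ENNReal.ofReal (Real.exp (r *
        ∑ j ∈ Finset.univ.erase i, ((y j : ℤ) : ℝ))) = ∏ j, f j (y j) := by
      intro y
      rw [Finset.mul_sum, ← prod_ofReal_exp, ← Finset.mul_prod_erase _ _ (Finset.mem_univ i)]
      simp only [f, if_true, one_mul]
      exact Finset.prod_congr rfl fun j hj => by rw [if_neg (Finset.ne_of_mem_erase hj)]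
    simp only [e]
    have hs := Finset.prod_univ_sum (fun _ : Fin n => (Finset.univ : Finset ℤˣ)) f
    rw [Fintype.piFinset_univ] at hs
    rw [← hs]
    have hf : ∀ j, ∑ s, f j s ≤ 2 * ENNReal.ofReal (Real.exp (r ^ 2 / 2)) := by
      intro j
      have h2 : (2 : ENNReal) = ENNReal.ofReal 2 := by simp
      have hu : (Finset.univ : Finset ℤˣ) = {1, -1} := rfl
      have hne : (1 : ℤˣ) ≠ -1 := by decide
      rw [hu, Finset.sum_pair hne]
      simp only [f]
      split_ifs
      · rw [h2, ← ENNReal.ofReal_mul (by norm_num), ← ENNReal.ofReal_one, ← ENNReal.ofReal_add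
          zero_le_one zero_le_one]
        refine ENNReal.ofReal_le_ofReal ?_
        have := Real.one_le_exp (x := r ^ 2 / 2) (by positivity)
        linarith
      · rw [h2, ← ENNReal.ofReal_mul (by norm_num), ← ENNReal.ofReal_add (Real.exp_pos _).le
          (Real.exp_pos _).le]
        refine ENNReal.ofReal_le_ofReal ?_
        have := Real.cosh_le_exp_half_sq r
        rw [Real.cosh_eq] at this
        simp only [Units.val_one, Int.cast_one, mul_one, Units.val_neg, Int.cast_neg, mul_neg]
        linarith
    have hcard : (Fintype.card (Fin n → ℤˣ) : ENNReal) = 2 ^ n := by simp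
    calc _ ≤ ((2 : ENNReal) ^ n)⁻¹ * ∏ _j : Fin n, (2 * ENNReal.ofReal (Real.exp (r ^ 2 / 2))) := by
          rw [hcard]
          gcongr with j
          exact hf j
      _ = ∏ _j : Fin n, ENNReal.ofReal (Real.exp (r ^ 2 / 2)) := by
          rw [Finset.prod_mul_distrib, ← mul_assoc, Finset.prod_const, Finset.card_univ,
            Fintype.card_fin, ENNReal.inv_mul_cancel (by simp) (by simp), one_mul]
      _ ≤ _ := by
          rw [prod_ofReal_exp]
          refine ENNReal.ofReal_le_ofReal (Real.exp_le_exp.2 ?_)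
          rw [← sq_abs, hr, Real.sq_sqrt (by positivity)]
          simp only [Finset.sum_const, Finset.card_univ, Fintype.card_fin, nsmul_eq_mul]
          field_simp
          rfl
  · congr 3
    have : √(q / n) * √(n * q) = q := by
      rw [← Real.sqrt_mul (by positivity)]
      have : q / n * (n * q) = q ^ 2 := by field_simp
      rw [this, Real.sqrt_sq hq]
    linear_combination -K * this

/-! ### Disintegration of the model and the effect of flipping one label -/

section Model

variable {Ω : Type*} [MeasurableSpace Ω] {P : Measure Ω} [IsProbabilityMeasure P]
  {n d : ℕ} {α β R : ℝ} {y : Ω → Fin n → ℤˣ} {μ : Ω → EuclideanSpace ℝ (Fin d)}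
  {A : Ω → Fin n → Fin n → ℝ} {x : Ω → Fin n → EuclideanSpace ℝ (Fin d)}

lemma IsCSBM.map_eq (h : IsCSBM P n d α β R y μ A x) :
    P.map (fun ω => ((y ω, μ ω), (A ω, x ω)))
      = ((uniformOn (Set.univ : Set (Fin n → ℤˣ))).prod (uniformSphere d R)) ⊗ₘ
        (sbmKernel n d α β ×ₖ gmmKernel n d) := by
  have h1 := h.cond_law.map_eq
  rw [h1, (indepFun_iff_map_prod_eq_prod_map_map h.measurable_labels.aemeasurable
    h.measurable_center.aemeasurable).1 h.indep, h.law_labels.map_eq, h.law_center.map_eq]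

lemma IsCSBM.lintegral_eq (h : IsCSBM P n d α β R y μ A x)
    {g : ((Fin n → ℤˣ) × EuclideanSpace ℝ (Fin d)) ×
      ((Fin n → Fin n → ℝ) × (Fin n → EuclideanSpace ℝ (Fin d))) → ENNReal} (hg : Measurable g) :
    ∫⁻ ω, g ((y ω, μ ω), (A ω, x ω)) ∂P
      = ∫⁻ y, ∫⁻ μ, ∫⁻ A, ∫⁻ x, g ((y, μ), (A, x)) ∂(gmm μ y) ∂(sbm α β y)
        ∂(uniformSphere d R) ∂(uniformOn Set.univ) := by
  have := isProbabilityMeasure_uniformSphere (d := d) (by have := h.two_le_dim; omega) R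
  have hm : Measurable fun ω => ((y ω, μ ω), (A ω, x ω)) :=
    (h.measurable_labels.prodMk h.measurable_center).prodMk
      (h.measurable_network.prodMk h.measurable_attributes)
  rw [← lintegral_map hg hm, h.map_eq, Measure.lintegral_compProd hg,
    lintegral_prod _ hg.lintegral_kernel_prod_right'.aemeasurable]
  refine lintegral_congr fun y => lintegral_congr fun μ => ?_
  rw [Kernel.prod_apply, lintegral_prod _ (by fun_prop)]
  rfl

/-- It suffices to bound an event conditionally, uniformly over labels and centers of norm R. The
tail bounds below can thus treat y and μ as fixed. -/
lemma IsCSBM.measure_le (h : IsCSBM P n d α β R y μ A x)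
    {B : Set (((Fin n → ℤˣ) × EuclideanSpace ℝ (Fin d)) ×
      ((Fin n → Fin n → ℝ) × (Fin n → EuclideanSpace ℝ (Fin d))))} (hB : MeasurableSet B)
    {c : ENNReal} (hc : ∀ (y : Fin n → ℤˣ) (μ : EuclideanSpace ℝ (Fin d)), ‖μ‖ = R →
      ∫⁻ A, gmm μ y {x | ((y, μ), (A, x)) ∈ B} ∂(sbm α β y) ≤ c) :
    P {ω | ((y ω, μ ω), (A ω, x ω)) ∈ B} ≤ c := by
  have := isProbabilityMeasure_uniformSphere (d := d) (by have := h.two_le_dim; omega) R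
  have hm : Measurable fun ω => ((y ω, μ ω), (A ω, x ω)) :=
    (h.measurable_labels.prodMk h.measurable_center).prodMk
      (h.measurable_network.prodMk h.measurable_attributes)
  have h1 : P {ω | ((y ω, μ ω), (A ω, x ω)) ∈ B}
      = ∫⁻ ω, B.indicator 1 ((y ω, μ ω), (A ω, x ω)) ∂P :=
    (lintegral_indicator_one (hm hB)).symm
  rw [h1, h.lintegral_eq (measurable_one.indicator hB)]
  have : IsProbabilityMeasure (uniformOn (Set.univ : Set (Fin n → ℤˣ))) :=
    isProbabilityMeasure_uniformOn Set.finite_univ Set.univ_nonempty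
  have h2 : ∀ y : Fin n → ℤˣ, ∫⁻ μ, ∫⁻ A, ∫⁻ x, B.indicator 1 ((y, μ), (A, x)) ∂(gmm μ y)
      ∂(sbm α β y) ∂(uniformSphere d R) ≤ c := by
    intro y
    calc _ ≤ ∫⁻ _μ, c ∂(uniformSphere d R) := by
          refine lintegral_mono_ae ?_
          filter_upwards [norm_eq_of_uniformSphere h.radius_pos.le] with μ hμ
          refine le_trans (le_of_eq ?_) (hc y μ hμ)
          refine lintegral_congr fun A => ?_
          have hs : MeasurableSet {x | ((y, μ), (A, x)) ∈ B} := measurable_const.prodMk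
            (measurable_const.prodMk measurable_id) hB
          rw [← lintegral_indicator_one hs]; rfl
      _ = c := by simp
  calc _ ≤ ∫⁻ _y : Fin n → ℤˣ, c ∂(uniformOn Set.univ) := lintegral_mono h2
    _ = c := by simp

/-- The signed sum of the attributes of all nodes except `i`. -/
noncomputable def signedSum {n d : ℕ} (i : Fin n) (y : Fin n → ℤˣ)
    (x : Fin n → EuclideanSpace ℝ (Fin d)) : EuclideanSpace ℝ (Fin d) :=
  ∑ j ∈ Finset.univ.erase i, ((y j : ℤ) : ℝ) • x j

/-- The attribute part of the genie-aided likelihood ratio. -/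
noncomputable def attributeRatio {n d : ℕ} (R : ℝ) (i : Fin n) (y : Fin n → ℤˣ)
    (x : Fin n → EuclideanSpace ℝ (Fin d)) : ℝ :=
  sphereLaplace d (R • (signedSum i y x + x i)) / sphereLaplace d (R • (signedSum i y x - x i))

/-- The genie-aided likelihood ratio of the two values of the label of `i`. -/
noncomputable def genieRatio {n d : ℕ} (α β R : ℝ) (i : Fin n) (y : Fin n → ℤˣ)
    (A : Fin n → Fin n → ℝ) (x : Fin n → EuclideanSpace ℝ (Fin d)) : ℝ :=
  Real.exp (networkLogRatio α β i y A) * attributeRatio R i y x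

lemma attributeRatio_pos (hd : 0 < d) (i : Fin n) (y : Fin n → ℤˣ)
    (x : Fin n → EuclideanSpace ℝ (Fin d)) : 0 < attributeRatio R i y x :=
  div_pos (sphereLaplace_pos hd _) (sphereLaplace_pos hd _)

lemma genieRatio_pos (hd : 0 < d) (i : Fin n) (y : Fin n → ℤˣ) (A : Fin n → Fin n → ℝ)
    (x : Fin n → EuclideanSpace ℝ (Fin d)) : 0 < genieRatio α β R i y A x :=
  mul_pos (Real.exp_pos _) (attributeRatio_pos hd i y x)

lemma genieRatio_congr {i : Fin n} {y y' : Fin n → ℤˣ} (h : ∀ j ≠ i, y j = y' j)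
    (A : Fin n → Fin n → ℝ) (x : Fin n → EuclideanSpace ℝ (Fin d)) :
    genieRatio α β R i y A x = genieRatio α β R i y' A x := by
  have h1 : networkLogRatio α β i y A = networkLogRatio α β i y' A :=
    Finset.sum_congr rfl fun j hj => by rw [h j (Finset.ne_of_mem_erase hj)]
  have h2 : signedSum i y x = signedSum i y' x :=
    Finset.sum_congr rfl fun j hj => by rw [h j (Finset.ne_of_mem_erase hj)]
  rw [genieRatio, genieRatio, attributeRatio, attributeRatio, h1, h2]

lemma measurable_genieRatio (hd : 0 < d) (i : Fin n) :
    Measurable fun p : (Fin n → ℤˣ) × (Fin n → Fin n → ℝ) × (Fin n → EuclideanSpace ℝ (Fin d)) =>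
      genieRatio α β R i p.1 p.2.1 p.2.2 := by
  have hF := measurable_sphereLaplace hd
  refine measurable_from_prod_countable_right fun y => ?_
  simp only [genieRatio, attributeRatio, networkLogRatio, signedSum]
  fun_prop

lemma sum_smul_update (i : Fin n) (y : Fin n → ℤˣ) (s : ℤˣ)
    (x : Fin n → EuclideanSpace ℝ (Fin d)) :
    ∑ j, ((Function.update y i s j : ℤ) : ℝ) • x j = signedSum i y x + ((s : ℤ) : ℝ) • x i := by
  rw [← Finset.add_sum_erase _ _ (Finset.mem_univ i), Function.update_self, add_comm, signedSum]
  congr 1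
  exact Finset.sum_congr rfl fun j hj => by rw [Function.update_of_ne (Finset.ne_of_mem_erase hj)]

/-- The flip is a change of measure in each factor: the network contributes
`sbm_update_eq_withDensity`, and after averaging over μ the attributes contribute a quotient of
Laplace transforms. The averaging is essential, since the ratio may not depend on μ. -/
lemma lintegral_sbm_gmm_update (hα : α ∈ Set.Ioo (0 : ℝ) 1) (hβ : β ∈ Set.Ioo (0 : ℝ) 1)
    (hd : 0 < d) (hR : 0 ≤ R) (i : Fin n) (y : Fin n → ℤˣ)
    {g : (Fin n → Fin n → ℝ) × (Fin n → EuclideanSpace ℝ (Fin d)) → ENNReal} (hg : Measurable g) :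
    ∫⁻ μ, ∫⁻ A, ∫⁻ x, g (A, x) ∂(gmm μ (Function.update y i 1))
        ∂(sbm α β (Function.update y i 1)) ∂(uniformSphere d R)
      = ∫⁻ μ, ∫⁻ A, ∫⁻ x, ENNReal.ofReal (genieRatio α β R i y A x) * g (A, x)
        ∂(gmm μ (Function.update y i (-1))) ∂(sbm α β (Function.update y i (-1)))
        ∂(uniformSphere d R) := by
  have := isProbabilityMeasure_uniformSphere hd R
  have hF := measurable_sphereLaplace hd
  have hΛ : Measurable fun p : (Fin n → Fin n → ℝ) × (Fin n → EuclideanSpace ℝ (Fin d)) =>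
      genieRatio α β R i y p.1 p.2 := by
    have h := (measurable_genieRatio (α := α) (β := β) (R := R) hd i).comp
      (measurable_prodMk_left (x := y))
    simpa only [Function.comp_def] using h
  have swap : ∀ (y : Fin n → ℤˣ) (f : (Fin n → Fin n → ℝ) × (Fin n → EuclideanSpace ℝ (Fin d)) →
      ENNReal), Measurable f → ∫⁻ μ, ∫⁻ A, ∫⁻ x, f (A, x) ∂(gmm μ y) ∂(sbm α β y)
        ∂(uniformSphere d R) = ∫⁻ A, ∫⁻ x, f (A, x) * ENNReal.ofReal (Real.exp (-(n * R ^ 2 / 2)) *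
          sphereLaplace d (R • ∑ j, ((y j : ℤ) : ℝ) • x j))
        ∂(Measure.pi fun _ : Fin n => stdGaussian (EuclideanSpace ℝ (Fin d))) ∂(sbm α β y) := by
    intro y f hf
    have hk : Measurable fun p : EuclideanSpace ℝ (Fin d) × (Fin n → Fin n → ℝ) =>
        ∫⁻ x, f (p.2, x) ∂(gmm p.1 y) := by
      have hκ : Measurable fun μ : EuclideanSpace ℝ (Fin d) => gmm μ y := by
        have h := (measurable_gmm (n := n) (d := d)).comp (measurable_prodMk_left (x := y))
        simpa only [Function.comp_def] using h
      let κ : Kernel (EuclideanSpace ℝ (Fin d) × (Fin n → Fin n → ℝ))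
        (Fin n → EuclideanSpace ℝ (Fin d)) := ⟨fun p => gmm p.1 y, hκ.comp measurable_fst⟩
      have : IsMarkovKernel κ := ⟨fun p => inferInstanceAs (IsProbabilityMeasure (gmm p.1 y))⟩
      exact Measurable.lintegral_kernel_prod_right' (κ := κ)
        (f := fun p => f (p.1.2, p.2)) (by fun_prop)
    rw [lintegral_lintegral_swap hk.aemeasurable]
    apply lintegral_congr
    intro A
    exact lintegral_gmm_uniformSphere hd hR y (g := fun x => f (A, x)) (by fun_prop)
  rw [swap _ _ hg, swap _ (fun p => ENNReal.ofReal (genieRatio α β R i y p.1 p.2) * g p)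
    (by fun_prop), sbm_update_eq_withDensity hα hβ,
    lintegral_withDensity_eq_lintegral_mul _ (by unfold networkLogRatio; fun_prop) (by fun_prop)]
  apply lintegral_congr
  intro A
  rw [Pi.mul_apply, ← lintegral_const_mul _ (by fun_prop)]
  apply lintegral_congr
  intro x
  rw [sum_smul_update, sum_smul_update, genieRatio, attributeRatio]
  have hp := sphereLaplace_pos hd (R • (signedSum i y x - x i))
  have e1 : signedSum i y x + (((1 : ℤˣ) : ℤ) : ℝ) • x i = signedSum i y x + x i := by simp
  have e2 : signedSum i y x + (((-1 : ℤˣ) : ℤ) : ℝ) • x i = signedSum i y x - x i := by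
    simp [sub_eq_add_neg]
  simp only [e1, e2]
  rw [mul_comm _ (g (A, x)), mul_left_comm, mul_assoc,
    ← ENNReal.ofReal_mul (Real.exp_pos _).le, ← ENNReal.ofReal_mul
    (mul_nonneg (Real.exp_pos _).le (div_nonneg (sphereLaplace_pos hd _).le hp.le))]
  congr 2
  field_simp

lemma sum_filter_apply_eq_one (i : Fin n) (f : (Fin n → ℤˣ) → ENNReal) :
    ∑ y, (if y i = 1 then f y else 0)
      = ∑ y, (if y i = -1 then f (Function.update y i 1) else 0) := by
  rw [← Finset.sum_filter, ← Finset.sum_filter]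
  refine Finset.sum_nbij' (fun y => Function.update y i (-1)) (fun y => Function.update y i 1)
    (by simp) (by simp) ?_ ?_ ?_
  · intro y hy
    simp only [Finset.mem_filter, Finset.mem_univ, true_and] at hy
    rw [Function.update_idem, ← hy, Function.update_eq_self]
  · intro y hy
    simp only [Finset.mem_filter, Finset.mem_univ, true_and] at hy
    rw [Function.update_idem, ← hy, Function.update_eq_self]
  · intro y hy
    simp only [Finset.mem_filter, Finset.mem_univ, true_and] at hy
    rw [Function.update_idem, ← hy, Function.update_eq_self]

end Model

section Model

variable {Ω : Type*} [MeasurableSpace Ω] {P : Measure Ω} [IsProbabilityMeasure P]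
  {n d : ℕ} {α β R : ℝ} {y : Ω → Fin n → ℤˣ} {μ : Ω → EuclideanSpace ℝ (Fin d)}
  {A : Ω → Fin n → Fin n → ℝ} {x : Ω → Fin n → EuclideanSpace ℝ (Fin d)}

/-- Uniform labels make flipping y_i a bijection between equally weighted halves of the label space,
so only the likelihood ratio remains. This is Bayes' formula in weak form, tested against functions
that do not see y_i. -/
lemma IsCSBM.lintegral_label_one (h : IsCSBM P n d α β R y μ A x) (i : Fin n)
    {g : (Fin n → ℤˣ) × (Fin n → Fin n → ℝ) × (Fin n → EuclideanSpace ℝ (Fin d)) → ENNReal}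
    (hg : Measurable g) (hgi : ∀ y s A x, g (Function.update y i s, A, x) = g (y, A, x)) :
    ∫⁻ ω in {ω | y ω i = 1}, g (y ω, A ω, x ω) ∂P
      = ∫⁻ ω in {ω | y ω i = 1}ᶜ, ENNReal.ofReal (genieRatio α β R i (y ω) (A ω) (x ω)) *
        g (y ω, A ω, x ω) ∂P := by
  have hd : 0 < d := by have := h.two_le_dim; omega
  have hy := h.measurable_labels
  have hΛ := measurable_genieRatio (α := α) (β := β) (R := R) hd i
  have hs : MeasurableSet {ω | y ω i = 1} := ((measurable_pi_apply i).comp hy) (.singleton 1)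
  rw [← lintegral_indicator hs, ← lintegral_indicator hs.compl]
  have hT : MeasurableSet {y : Fin n → ℤˣ | y i = 1} := .of_discrete
  have hp : Measurable fun p : ((Fin n → ℤˣ) × EuclideanSpace ℝ (Fin d)) ×
      ((Fin n → Fin n → ℝ) × (Fin n → EuclideanSpace ℝ (Fin d))) => (p.1.1, p.2.1, p.2.2) :=
    measurable_fst.fst.prodMk measurable_snd
  have m1 := ((measurable_one (α := ENNReal)).indicator hT).comp (measurable_fst.comp hp)
  have m2 := ((measurable_one (α := ENNReal)).indicator hT.compl).comp (measurable_fst.comp hp)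
  have mg := hg.comp hp
  have e1 := h.lintegral_eq (g := fun p => {y : Fin n → ℤˣ | y i = 1}.indicator 1 p.1.1 *
    g (p.1.1, p.2.1, p.2.2)) (m1.mul mg)
  have e2 := h.lintegral_eq (g := fun p => {y : Fin n → ℤˣ | y i = 1}ᶜ.indicator 1 p.1.1 *
    (ENNReal.ofReal (genieRatio α β R i p.1.1 p.2.1 p.2.2) * g (p.1.1, p.2.1, p.2.2)))
    (m2.mul ((hΛ.comp hp).ennreal_ofReal.mul mg))
  have f1 : ∀ ω, {ω | y ω i = 1}.indicator (fun ω => g (y ω, A ω, x ω)) ω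
      = {y : Fin n → ℤˣ | y i = 1}.indicator 1 (y ω) * g (y ω, A ω, x ω) := by
    intro ω
    by_cases hω : y ω i = 1 <;> simp [Set.indicator, hω]
  have f2 : ∀ ω, {ω | y ω i = 1}ᶜ.indicator (fun ω =>
      ENNReal.ofReal (genieRatio α β R i (y ω) (A ω) (x ω)) * g (y ω, A ω, x ω)) ω
      = {y : Fin n → ℤˣ | y i = 1}ᶜ.indicator 1 (y ω) *
        (ENNReal.ofReal (genieRatio α β R i (y ω) (A ω) (x ω)) * g (y ω, A ω, x ω)) := by
    intro ω
    by_cases hω : y ω i = 1 <;> simp [Set.indicator, hω]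
  simp only [f1, f2]
  rw [e1, e2, lintegral_uniformOn_univ, lintegral_uniformOn_univ]
  congr 1
  have k1 : ∀ y : Fin n → ℤˣ, ∫⁻ μ, ∫⁻ A, ∫⁻ x, {y : Fin n → ℤˣ | y i = 1}.indicator 1 y *
      g (y, A, x) ∂(gmm μ y) ∂(sbm α β y) ∂(uniformSphere d R)
      = if y i = 1 then ∫⁻ μ, ∫⁻ A, ∫⁻ x, g (y, A, x) ∂(gmm μ y) ∂(sbm α β y)
        ∂(uniformSphere d R) else 0 := by
    intro y
    by_cases hy : y i = 1 <;> simp [Set.indicator, hy]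
  have k2 : ∀ y : Fin n → ℤˣ, ∫⁻ μ, ∫⁻ A, ∫⁻ x, {y : Fin n → ℤˣ | y i = 1}ᶜ.indicator 1 y *
      (ENNReal.ofReal (genieRatio α β R i y A x) * g (y, A, x)) ∂(gmm μ y) ∂(sbm α β y)
        ∂(uniformSphere d R)
      = if y i = -1 then ∫⁻ μ, ∫⁻ A, ∫⁻ x, ENNReal.ofReal (genieRatio α β R i y A x) *
        g (y, A, x) ∂(gmm μ y) ∂(sbm α β y) ∂(uniformSphere d R) else 0 := by
    intro y
    have hne : (1 : ℤˣ) ≠ -1 := by decide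
    rcases Int.units_eq_one_or (y i) with hy | hy <;> simp [Set.indicator, hy, hne, hne.symm]
  simp only [k1, k2]
  rw [sum_filter_apply_eq_one]
  refine Finset.sum_congr rfl fun y _ => ?_
  split_ifs with hyi
  · simp only [hgi]
    rw [lintegral_sbm_gmm_update h.alpha_mem h.beta_mem hd h.radius_pos.le i y
      (g := fun p => g (y, p)) (by fun_prop)]
    rw [show Function.update y i (-1) = y by rw [← hyi, Function.update_eq_self]]
  · rfl

end Model

/-! ### Posterior probabilities and the exact log-odds -/

/-- Since L/(1+L) = L · 1/(1+L), the odds identity moves the integral of L/(1+L) over T ∩ Sᶜ to that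
of 1/(1+L) over T ∩ S. Adding the integral of L/(1+L) over T ∩ S gives P(T ∩ S). -/
lemma condExp_indicator_eq_of_odds {Ω : Type*} {m mΩ : MeasurableSpace Ω} {P : Measure Ω}
    [IsProbabilityMeasure P] (hm : m ≤ mΩ) {S : Set Ω} (hS : MeasurableSet S) {L : Ω → ℝ}
    (hL : Measurable[m] L) (hL0 : ∀ ω, 0 < L ω)
    (h : ∀ T, MeasurableSet[m] T → ∫⁻ ω in S, T.indicator (fun ω => ENNReal.ofReal (1 / (1 + L ω))) ω ∂P
      = ∫⁻ ω in Sᶜ, ENNReal.ofReal (L ω) *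
        T.indicator (fun ω => ENNReal.ofReal (1 / (1 + L ω))) ω ∂P) :
    P⟦S | m⟧ =ᵐ[P] fun ω => L ω / (1 + L ω) := by
  have hL' : Measurable L := hL.mono hm le_rfl
  have hb : ∀ ω, 0 ≤ L ω / (1 + L ω) ∧ L ω / (1 + L ω) ≤ 1 := fun ω => by
    have := hL0 ω
    exact ⟨by positivity, by rw [div_le_one (by positivity)]; linarith⟩
  have hLm : Measurable fun ω => L ω / (1 + L ω) := hL'.div (measurable_const.add hL')
  have hint : Integrable (fun ω => L ω / (1 + L ω)) P :=
    Integrable.of_bound (C := 1) hLm.aestronglyMeasurable (Eventually.of_forall fun ω => by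
      rw [Real.norm_eq_abs, abs_of_nonneg (hb ω).1]; exact (hb ω).2)
  refine (ae_eq_condExp_of_forall_setIntegral_eq hm
    ((integrable_const (1 : ℝ)).indicator hS) (fun _ _ _ => hint.integrableOn) ?_ ?_).symm
  · intro T hT _
    have hT' := hm T hT
    rw [integral_eq_lintegral_of_nonneg_ae (Eventually.of_forall fun ω => (hb ω).1)
        hLm.aestronglyMeasurable,
      integral_eq_lintegral_of_nonneg_ae
        (Eventually.of_forall fun ω => Set.indicator_nonneg (fun _ _ => zero_le_one) ω)
        ((measurable_const.indicator hS).aestronglyMeasurable)]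
    congr 1
    rw [← lintegral_indicator hT', ← lintegral_add_compl _ hS]
    have e2 : ∫⁻ ω in Sᶜ, T.indicator (fun ω => ENNReal.ofReal (L ω / (1 + L ω))) ω ∂P
        = ∫⁻ ω in Sᶜ, ENNReal.ofReal (L ω) *
          T.indicator (fun ω => ENNReal.ofReal (1 / (1 + L ω))) ω ∂P := by
      refine lintegral_congr fun ω => ?_
      by_cases hω : ω ∈ T
      · rw [Set.indicator_of_mem hω, Set.indicator_of_mem hω, ← ENNReal.ofReal_mul (hL0 ω).le,
          mul_one_div]
      · simp [hω]
    rw [e2, ← h T hT, ← lintegral_add_left ((by fun_prop : Measurable fun ω =>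
      ENNReal.ofReal (L ω / (1 + L ω))).indicator hT'), ← lintegral_indicator hS,
      ← lintegral_indicator hT']
    refine lintegral_congr fun ω => ?_
    by_cases hω : ω ∈ T
    · by_cases hω' : ω ∈ S
      · rw [Set.indicator_of_mem hω', Set.indicator_of_mem hω, Set.indicator_of_mem hω,
          Set.indicator_of_mem hω, Set.indicator_of_mem hω', ← ENNReal.ofReal_add (hb ω).1
          (by have := hL0 ω; positivity)]
        congr 1
        have := hL0 ω
        field_simp
        ring
      · simp [Set.indicator, hω']
    · by_cases hω' : ω ∈ S <;> simp [hω, hω']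
  · have : Measurable[m] fun ω => L ω / (1 + L ω) := hL.div (measurable_const.add hL)
    exact this.aestronglyMeasurable

lemma condExp_indicator_compl {Ω : Type*} {m mΩ : MeasurableSpace Ω} {P : Measure Ω}
    [IsProbabilityMeasure P] (hm : m ≤ mΩ) {S : Set Ω} (hS : MeasurableSet S) :
    P⟦Sᶜ | m⟧ =ᵐ[P] fun ω => 1 - (P⟦S | m⟧) ω := by
  have h := condExp_sub (m := m) (integrable_const (1 : ℝ)) ((integrable_const (1 : ℝ)).indicator hS)
    (μ := P)
  have e : (Sᶜ.indicator fun _ => (1 : ℝ)) = (fun _ => (1 : ℝ)) - S.indicator fun _ => (1 : ℝ) :=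
    Set.indicator_compl S _
  rw [e]
  filter_upwards [h] with ω hω
  rw [hω, Pi.sub_apply, condExp_const hm]

section Model

variable {Ω : Type*} [MeasurableSpace Ω] {P : Measure Ω} [IsProbabilityMeasure P]
  {n d : ℕ} {α β R : ℝ} {y : Ω → Fin n → ℤˣ} {μ : Ω → EuclideanSpace ℝ (Fin d)}
  {A : Ω → Fin n → Fin n → ℝ} {x : Ω → Fin n → EuclideanSpace ℝ (Fin d)}

lemma IsCSBM.genieProb_one (h : IsCSBM P n d α β R y μ A x) (i : Fin n) :
    genieProb P y A x i 1 =ᵐ[P] fun ω => genieRatio α β R i (y ω) (A ω) (x ω) /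
      (1 + genieRatio α β R i (y ω) (A ω) (x ω)) := by
  have hd : 0 < d := by have := h.two_le_dim; omega
  have hy := h.measurable_labels
  have hA := h.measurable_network
  have hx := h.measurable_attributes
  have hΛ := measurable_genieRatio (α := α) (β := β) (R := R) hd i
  let res : (Fin n → ℤˣ) → {j : Fin n // j ≠ i} → ℤˣ := fun y j => y j
  -- The value 1 at i is arbitrary: the ratio ignores y_i. Factoring it through this extension shows
  -- that it is measurable for the conditioning σ-algebra.
  let ext : ({j : Fin n // j ≠ i} → ℤˣ) → Fin n → ℤˣ := fun r j => if hj : j ≠ i then r ⟨j, hj⟩ else 1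
  have hext : ∀ y, ∀ j ≠ i, y j = ext (res y) j := fun y j hj => by simp [ext, res, hj]
  have hm : genieSigma y A x i ≤ ‹MeasurableSpace Ω› := by
    refine Measurable.comap_le ?_
    fun_prop
  refine condExp_indicator_eq_of_odds hm (S := {ω | y ω i = 1})
    (hy.eval (.singleton (1 : ℤˣ))) ?_
    (fun ω => genieRatio_pos hd _ _ _ _) ?_
  · have : (fun ω => genieRatio α β R i (y ω) (A ω) (x ω))
        = (fun p : (Fin n → Fin n → ℝ) × (Fin n → EuclideanSpace ℝ (Fin d)) ×
          ({j : Fin n // j ≠ i} → ℤˣ) => genieRatio α β R i (ext p.2.2) p.1 p.2.1) ∘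
          (fun ω => (A ω, x ω, fun j : {j : Fin n // j ≠ i} => y ω j)) := by
      ext ω
      exact genieRatio_congr (hext (y ω)) _ _
    rw [this]
    have hext' : Measurable ext := measurable_of_finite _
    refine Measurable.comp (?_ : Measurable _) (comap_measurable _)
    have hq : Measurable fun p : (Fin n → Fin n → ℝ) ×
        (Fin n → EuclideanSpace ℝ (Fin d)) × ({j : Fin n // j ≠ i} → ℤˣ) =>
        (ext p.2.2, p.1, p.2.1) :=
      (hext'.comp measurable_snd.snd).prodMk (measurable_fst.prodMk measurable_snd.fst)
    have h1 := hΛ.comp hq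
    simpa only [Function.comp_def] using h1
  · rintro T ⟨T', hT', rfl⟩
    have hres : Measurable res := measurable_of_finite _
    have hq : Measurable fun p : (Fin n → ℤˣ) × (Fin n → Fin n → ℝ) ×
        (Fin n → EuclideanSpace ℝ (Fin d)) => (p.2.1, p.2.2, res p.1) :=
      measurable_snd.fst.prodMk (measurable_snd.snd.prodMk (hres.comp measurable_fst))
    refine h.lintegral_label_one i (g := fun p =>
      ((fun p : (Fin n → ℤˣ) × (Fin n → Fin n → ℝ) × (Fin n → EuclideanSpace ℝ (Fin d)) =>
        (p.2.1, p.2.2, res p.1)) ⁻¹' T').indicator (fun p =>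
        ENNReal.ofReal (1 / (1 + genieRatio α β R i p.1 p.2.1 p.2.2))) p) ?_ ?_
    · exact ((measurable_const.div (measurable_const.add hΛ)).ennreal_ofReal).indicator (hq hT')
    · intro y s A x
      have e1 : res (Function.update y i s) = res y := by
        funext j
        exact Function.update_of_ne j.2 _ _
      have e2 : genieRatio α β R i (Function.update y i s) A x = genieRatio α β R i y A x :=
        genieRatio_congr (fun j hj => Function.update_of_ne hj _ _) _ _
      have e3 : (Function.update y i s, A, x) ∈ (fun p : (Fin n → ℤˣ) × (Fin n → Fin n → ℝ) ×
          (Fin n → EuclideanSpace ℝ (Fin d)) => (p.2.1, p.2.2, res p.1)) ⁻¹' T' ↔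
          (y, A, x) ∈ (fun p : (Fin n → ℤˣ) × (Fin n → Fin n → ℝ) ×
          (Fin n → EuclideanSpace ℝ (Fin d)) => (p.2.1, p.2.2, res p.1)) ⁻¹' T' := by
        simp only [Set.mem_preimage, e1]
      by_cases hT : (y, A, x) ∈ (fun p : (Fin n → ℤˣ) × (Fin n → Fin n → ℝ) ×
          (Fin n → EuclideanSpace ℝ (Fin d)) => (p.2.1, p.2.2, res p.1)) ⁻¹' T'
      · rw [Set.indicator_of_mem hT, Set.indicator_of_mem (e3.2 hT), e2]
      · rw [Set.indicator_of_notMem hT, Set.indicator_of_notMem (mt e3.1 hT)]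

lemma IsCSBM.genieProb_neg_one (h : IsCSBM P n d α β R y μ A x) (i : Fin n) :
    genieProb P y A x i (-1) =ᵐ[P] fun ω =>
      1 / (1 + genieRatio α β R i (y ω) (A ω) (x ω)) := by
  have hd : 0 < d := by have := h.two_le_dim; omega
  have hy := h.measurable_labels
  have hA := h.measurable_network
  have hx := h.measurable_attributes
  have hm : genieSigma y A x i ≤ ‹MeasurableSpace Ω› := by
    refine Measurable.comap_le ?_
    fun_prop
  have e : {ω | y ω i = -1} = {ω | y ω i = 1}ᶜ := by
    ext ω
    have hne : (1 : ℤˣ) ≠ -1 := by decide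
    rcases Int.units_eq_one_or (y ω i) with h | h <;> simp [h, hne, hne.symm]
  filter_upwards [condExp_indicator_compl hm (S := {ω | y ω i = 1})
    (hy.eval (.singleton (1 : ℤˣ))) (P := P),
    h.genieProb_one i] with ω h1 h2
  rw [genieProb] at h2 ⊢
  rw [e, h1, h2]
  have := genieRatio_pos (α := α) (β := β) (R := R) hd i (y ω) (A ω) (x ω)
  field_simp
  ring

lemma IsCSBM.genieProb_pos (h : IsCSBM P n d α β R y μ A x) (i : Fin n) :
    ∀ᵐ ω ∂P, 0 < genieProb P y A x i 1 ω ∧ 0 < genieProb P y A x i (-1) ω := by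
  have hd : 0 < d := by have := h.two_le_dim; omega
  filter_upwards [h.genieProb_one i, h.genieProb_neg_one i] with ω h1 h2
  have := genieRatio_pos (α := α) (β := β) (R := R) hd i (y ω) (A ω) (x ω)
  rw [h1, h2]
  constructor <;> positivity

lemma IsCSBM.genieLogOdds_eq (h : IsCSBM P n d α β R y μ A x) (i : Fin n) :
    genieLogOdds P y A x i =ᵐ[P] fun ω => networkLogRatio α β i (y ω) (A ω) +
      (Real.log (sphereLaplace d (R • (signedSum i (y ω) (x ω) + x ω i))) -
        Real.log (sphereLaplace d (R • (signedSum i (y ω) (x ω) - x ω i)))) := by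
  have hd : 0 < d := by have := h.two_le_dim; omega
  filter_upwards [h.genieProb_one i, h.genieProb_neg_one i] with ω h1 h2
  have h3 := genieRatio_pos (α := α) (β := β) (R := R) hd i (y ω) (A ω) (x ω)
  rw [genieLogOdds, h1, h2, div_div_div_cancel_right₀ (by positivity), div_one, genieRatio,
    Real.log_mul (Real.exp_pos _).ne' (attributeRatio_pos hd _ _ _).ne', Real.log_exp,
    attributeRatio, Real.log_div (sphereLaplace_pos hd _).ne' (sphereLaplace_pos hd _).ne']

end Model

/-! ### Concentration of the noise and of the network row -/

/-- A combination of the noise of the signed sum of the other attributes and of the noise of `x i`. -/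
noncomputable def noise {n d : ℕ} (a b : ℝ) (i : Fin n) (y : Fin n → ℤˣ)
    (μ : EuclideanSpace ℝ (Fin d)) (x : Fin n → EuclideanSpace ℝ (Fin d)) :
    EuclideanSpace ℝ (Fin d) :=
  a • (signedSum i y x - ((n : ℝ) - 1) • μ) + b • (x i - ((y i : ℤ) : ℝ) • μ)

lemma intCast_units_mul_self (s : ℤˣ) : ((s : ℤ) : ℝ) * ((s : ℤ) : ℝ) = 1 := by
  rcases Int.units_eq_one_or s with h | h <;> simp [h]

/-- Since y_j² = 1 the multiples of μ cancel, leaving a linear combination of independent Gaussians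
with coefficients a y_j for j ≠ i and b at i. All the noise quantities needed later are instances of
this one family. -/
lemma gmm_map_noise {n d : ℕ} (a b : ℝ) {τ : ℝ} (i : Fin n) (y : Fin n → ℤˣ)
    (μ : EuclideanSpace ℝ (Fin d)) (hτ : ((n : ℝ) - 1) * a ^ 2 + b ^ 2 = τ ^ 2) :
    (gmm μ y).map (noise a b i y μ) = (stdGaussian (EuclideanSpace ℝ (Fin d))).map (τ • ·) := by
  have hn : 1 ≤ n := i.pos
  let c : Fin n → ℝ := fun j => if j = i then b else a * ((y j : ℤ) : ℝ)
  have hm : Measurable (noise a b i y μ) := by unfold noise signedSum; fun_prop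
  rw [gmm, Measure.map_map hm (by fun_prop), ← pi_stdGaussian_map_sum c]
  · congr 1
    funext z
    simp only [Function.comp, noise, signedSum]
    rw [← Finset.sum_erase_add _ _ (Finset.mem_univ i)]
    have e1 : ∑ j ∈ Finset.univ.erase i, c j • z j
        = a • ∑ j ∈ Finset.univ.erase i, ((y j : ℤ) : ℝ) • z j := by
      rw [Finset.smul_sum]
      refine Finset.sum_congr rfl fun j hj => ?_
      simp only [c, if_neg (Finset.ne_of_mem_erase hj), mul_smul]
    have e2 : ∑ j ∈ Finset.univ.erase i, ((y j : ℤ) : ℝ) • (((y j : ℤ) : ℝ) • μ + z j)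
        = ((n : ℝ) - 1) • μ + ∑ j ∈ Finset.univ.erase i, ((y j : ℤ) : ℝ) • z j := by
      simp only [smul_add, smul_smul, intCast_units_mul_self, one_smul, Finset.sum_add_distrib]
      congr 1
      rw [Finset.sum_const, Finset.card_erase_of_mem (Finset.mem_univ i), Finset.card_univ,
        Fintype.card_fin, ← Nat.cast_smul_eq_nsmul ℝ, Nat.cast_sub hn, Nat.cast_one]
    rw [e1, e2, add_sub_cancel_left, add_sub_cancel_left]
    simp [c]
  · rw [← hτ, ← Finset.sum_erase_add _ _ (Finset.mem_univ i)]
    have e : ∀ j ∈ Finset.univ.erase i, c j ^ 2 = a ^ 2 := fun j hj => by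
      simp only [c, if_neg (Finset.ne_of_mem_erase hj), mul_pow]
      rw [sq ((y j : ℤ) : ℝ), intCast_units_mul_self, mul_one]
    rw [Finset.sum_congr rfl e]
    simp [c, Finset.card_erase_of_mem, Nat.cast_sub hn]

lemma measurable_noise {n d : ℕ} (a b : ℝ) (i : Fin n) :
    Measurable fun p : ((Fin n → ℤˣ) × EuclideanSpace ℝ (Fin d)) ×
      ((Fin n → Fin n → ℝ) × (Fin n → EuclideanSpace ℝ (Fin d))) =>
      noise a b i p.1.1 p.1.2 p.2.2 := by
  have hc : Measurable fun s : ℤˣ => ((s : ℤ) : ℝ) := measurable_of_finite _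
  unfold noise signedSum
  fun_prop

section Model

variable {Ω : Type*} [MeasurableSpace Ω] {P : Measure Ω} [IsProbabilityMeasure P]
  {n d : ℕ} {α β R : ℝ} {y : Ω → Fin n → ℤˣ} {μ : Ω → EuclideanSpace ℝ (Fin d)}
  {A : Ω → Fin n → Fin n → ℝ} {x : Ω → Fin n → EuclideanSpace ℝ (Fin d)}

lemma IsCSBM.noise_norm_sq_tail (h : IsCSBM P n d α β R y μ A x) (i : Fin n) (a b : ℝ) {τ K q : ℝ}
    (hτ0 : 0 < τ) (hτ : ((n : ℝ) - 1) * a ^ 2 + b ^ 2 = τ ^ 2) (hq : 0 < q) :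
    P {ω | K * (τ ^ 2 * (√(d * q) + q)) ≤
        |‖noise a b i (y ω) (μ ω) (x ω)‖ ^ 2 - τ ^ 2 * d|}
      ≤ 2 * ENNReal.ofReal (Real.exp (-(K / 4 - 1 / 2) * q)) := by
  refine h.measure_le (B := {p | K * (τ ^ 2 * (√(d * q) + q)) ≤
    |‖noise a b i p.1.1 p.1.2 p.2.2‖ ^ 2 - τ ^ 2 * d|}) ?_ ?_
  · have := measurable_noise (d := d) a b i
    exact measurableSet_le measurable_const (by fun_prop)
  · intro y μ _
    have hm : Measurable (noise a b i y μ) := by unfold noise signedSum; fun_prop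
    have hs : MeasurableSet {g : EuclideanSpace ℝ (Fin d) |
        K * (τ ^ 2 * (√(d * q) + q)) ≤ |‖g‖ ^ 2 - τ ^ 2 * d|} :=
      measurableSet_le measurable_const (by fun_prop)
    have e : gmm μ y {x | K * (τ ^ 2 * (√(d * q) + q)) ≤ |‖noise a b i y μ x‖ ^ 2 - τ ^ 2 * d|}
        ≤ 2 * ENNReal.ofReal (Real.exp (-(K / 4 - 1 / 2) * q)) := by
      have := congrArg (fun ν => ν {g : EuclideanSpace ℝ (Fin d) |
        K * (τ ^ 2 * (√(d * q) + q)) ≤ |‖g‖ ^ 2 - τ ^ 2 * d|}) (gmm_map_noise a b i y μ hτ)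
      simp only at this
      rw [Measure.map_apply hm hs, Measure.map_apply (by fun_prop) hs] at this
      refine this.trans_le (le_trans (measure_mono fun g hg => ?_)
        (stdGaussian_norm_sq_tail hq))
      simp only [Set.mem_preimage, Set.mem_ofPred_eq] at hg ⊢
      rw [norm_smul, mul_pow, Real.norm_eq_abs, sq_abs, ← mul_sub, abs_mul,
        abs_of_pos (by positivity : 0 < τ ^ 2), mul_left_comm] at hg
      exact le_of_mul_le_mul_left hg (by positivity)
    calc _ ≤ ∫⁻ _A, 2 * ENNReal.ofReal (Real.exp (-(K / 4 - 1 / 2) * q)) ∂(sbm α β y) :=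
          lintegral_mono fun _ => e
      _ = _ := by simp

lemma IsCSBM.noise_inner_tail (h : IsCSBM P n d α β R y μ A x) (i : Fin n) (a b : ℝ) {τ K q : ℝ}
    (hτ0 : 0 < τ) (hτ : ((n : ℝ) - 1) * a ^ 2 + b ^ 2 = τ ^ 2) (hq : 0 < q) :
    P {ω | K * (τ * (R * √q)) ≤ |inner ℝ (μ ω) (noise a b i (y ω) (μ ω) (x ω))|}
      ≤ 2 * ENNReal.ofReal (Real.exp (-(K - 1 / 2) * q)) := by
  refine h.measure_le (B := {p | K * (τ * (R * √q)) ≤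
    |inner ℝ p.1.2 (noise a b i p.1.1 p.1.2 p.2.2)|}) ?_ ?_
  · have := measurable_noise (d := d) a b i
    exact measurableSet_le measurable_const (by fun_prop)
  · intro y μ hμ
    have hμ0 : μ ≠ 0 := by
      rw [← norm_pos_iff, hμ]; exact h.radius_pos
    have hm : Measurable (noise a b i y μ) := by unfold noise signedSum; fun_prop
    have hs : MeasurableSet {g : EuclideanSpace ℝ (Fin d) |
        K * (τ * (R * √q)) ≤ |inner ℝ μ g|} :=
      measurableSet_le measurable_const (by fun_prop)
    have e : gmm μ y {x | K * (τ * (R * √q)) ≤ |inner ℝ μ (noise a b i y μ x)|}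
        ≤ 2 * ENNReal.ofReal (Real.exp (-(K - 1 / 2) * q)) := by
      have := congrArg (fun ν => ν {g : EuclideanSpace ℝ (Fin d) |
        K * (τ * (R * √q)) ≤ |inner ℝ μ g|}) (gmm_map_noise a b i y μ hτ)
      simp only at this
      rw [Measure.map_apply hm hs, Measure.map_apply (by fun_prop) hs] at this
      refine this.trans_le (le_trans (measure_mono fun g hg => ?_)
        (stdGaussian_inner_tail μ hq.le hμ0))
      simp only [Set.mem_preimage, Set.mem_ofPred_eq] at hg ⊢
      rw [real_inner_smul_right, abs_mul, abs_of_pos hτ0, mul_left_comm] at hg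
      rw [hμ]
      exact le_of_mul_le_mul_left hg hτ0
    calc _ ≤ ∫⁻ _A, 2 * ENNReal.ofReal (Real.exp (-(K - 1 / 2) * q)) ∂(sbm α β y) :=
          lintegral_mono fun _ => e
      _ = _ := by simp

lemma IsCSBM.measure_network_le (h : IsCSBM P n d α β R y μ A x)
    {T : Set ((Fin n → ℤˣ) × (Fin n → Fin n → ℝ))} (hT : MeasurableSet T) {c : ENNReal}
    (hc : ∀ y, sbm α β y {A | (y, A) ∈ T} ≤ c) : P {ω | (y ω, A ω) ∈ T} ≤ c := by
  have hp : Measurable fun p : ((Fin n → ℤˣ) × EuclideanSpace ℝ (Fin d)) ×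
      ((Fin n → Fin n → ℝ) × (Fin n → EuclideanSpace ℝ (Fin d))) => (p.1.1, p.2.1) :=
    measurable_fst.fst.prodMk measurable_snd.fst
  refine h.measure_le (hp hT) fun y μ _ => le_trans (le_of_eq ?_) (hc y)
  refine Eq.trans ?_ (lintegral_indicator_one (measurable_prodMk_left hT))
  refine lintegral_congr fun A => ?_
  by_cases hA : (y, A) ∈ T
  · rw [Set.indicator_of_mem (by exact hA)]
    simp [hA]
  · rw [Set.indicator_of_notMem (by exact hA)]
    simp [hA]

lemma IsCSBM.network_tail (h : IsCSBM P n d α β R y μ A x) (i : Fin n) (s : ℝ) :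
    P {ω | s ≤ |∑ j ∈ Finset.univ.erase i, ((y ω j : ℤ) : ℝ) * A ω i j|}
      ≤ 2 * ENNReal.ofReal (Real.exp (2 * n * (α + β) - s)) := by
  have hc : Measurable fun s : ℤˣ => ((s : ℤ) : ℝ) := measurable_of_finite _
  have hs : MeasurableSet {p : (Fin n → ℤˣ) × (Fin n → Fin n → ℝ) |
      s ≤ |∑ j ∈ Finset.univ.erase i, ((p.1 j : ℤ) : ℝ) * p.2 i j|} :=
    measurableSet_le measurable_const (by fun_prop)
  exact h.measure_network_le hs fun y => sbm_row_tail h.alpha_mem h.beta_mem i y s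

lemma IsCSBM.network_diag (h : IsCSBM P n d α β R y μ A x) (i : Fin n) :
    P {ω | A ω i i ≠ 0} = 0 := by
  have hs : MeasurableSet {p : (Fin n → ℤˣ) × (Fin n → Fin n → ℝ) | p.2 i i ≠ 0} :=
    (measurableSet_eq_fun (by fun_prop) measurable_const).compl
  refine le_antisymm (h.measure_network_le hs fun y => le_of_eq ?_) zero_le
  have hm : MeasurableSet {A : Fin n → Fin n → ℝ | A i i ≠ 0} :=
    (measurableSet_eq_fun (by fun_prop) measurable_const).compl
  rw [sbm]
  refine (Measure.map_apply measurable_symmMatrix hm).trans ?_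
  simp [symmMatrix]

end Model

lemma IsCSBM.labels_tail {Ω : Type*} [MeasurableSpace Ω] {P : Measure Ω}
    {n d : ℕ} {α β R : ℝ} {y : Ω → Fin n → ℤˣ} {μ : Ω → EuclideanSpace ℝ (Fin d)}
    {A : Ω → Fin n → Fin n → ℝ} {x : Ω → Fin n → EuclideanSpace ℝ (Fin d)}
    (h : IsCSBM P n d α β R y μ A x) (i : Fin n) {K q : ℝ} (hq : 0 ≤ q) :
    P {ω | K * √(n * q) ≤ |∑ j ∈ Finset.univ.erase i, ((y ω j : ℤ) : ℝ)|}
      ≤ 2 * ENNReal.ofReal (Real.exp (-(K - 1 / 2) * q)) := by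
  have := uniformOn_labels_tail i (K := K) hq
  rwa [← h.law_labels.map_eq, Measure.map_apply h.measurable_labels .of_discrete] at this

/-! ### Deterministic estimates on the good event -/

section Deterministic

variable {N R c q d D K : ℝ}

lemma const_mul_q_le_sq (hN : 0 < N) (hR : 0 < R) (hc : 0 < c) (hq : 0 < q) (hd : 0 ≤ d)
    (hD : D = N * R ^ 2 + d) (heq : N * R ^ 4 = c * q * D) : c * q ≤ R ^ 2 := by
  have : c * q * (N * R ^ 2) ≤ R ^ 2 * (N * R ^ 2) := by
    have h1 : c * q * (N * R ^ 2) ≤ c * q * D := by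
      gcongr
      linarith
    nlinarith
  exact le_of_mul_le_mul_right this (by positivity)

lemma sqrt_mul_sqrt_le (hN : 0 < N) (hR : 0 < R) (hc : 0 < c) (hq : 0 < q) (hd : 0 ≤ d)
    (hD : D = N * R ^ 2 + d) (heq : N * R ^ 4 = c * q * D) : √c * √q ≤ R := by
  rw [← Real.sqrt_mul hc.le, Real.sqrt_le_left hR.le]
  exact const_mul_q_le_sq hN hR hc hq hd hD heq

/-- The coefficient of μ in S ± x_i is N or N - 2. After expansion, the leading part R²(N²R² + Nd)
equals D² - dD exactly. What remains is the change of m², the cross term with μ and the fluctuation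
of ‖V‖², each O(D²/√N) because cq ≤ R², NR² ≤ D and d ≤ D. -/
lemma shifted_norm_sq_bound {E : Type*} [NormedAddCommGroup E] [InnerProductSpace ℝ E] {m : ℝ}
    {μ V : E} (hN : 2 ≤ N) (hR : 0 < R) (hc : 0 < c) (hq : 0 < q) (hd : 0 ≤ d) (hK : 1 ≤ K)
    (hD : D = N * R ^ 2 + d) (heq : N * R ^ 4 = c * q * D) (hμ : ‖μ‖ = R)
    (hm : m = N ∨ m = N - 2) (hV : |inner ℝ μ V| ≤ 2 * K * (√N * (R * √q)))
    (hV2 : |‖V‖ ^ 2 - N * d| ≤ K * (N * (√(d * q) + q))) :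
    |‖R • (m • μ + V)‖ ^ 2 - (D ^ 2 - d * D)| ≤ K * (4 + 5 / √c + 1 / c) / √N * D ^ 2 := by
  have hN0 : 0 < N := by linarith
  have hD0 : 0 < D := by rw [hD]; positivity
  have hsN : 0 < √N := Real.sqrt_pos.2 hN0
  have hsc : 0 < √c := Real.sqrt_pos.2 hc
  have hsq : 0 < √q := Real.sqrt_pos.2 hq
  have hNN : √N * √N = N := Real.mul_self_sqrt hN0.le
  have hND : N * R ^ 2 ≤ D := by linarith
  have hdD : d ≤ D := by rw [hD]; nlinarith [sq_nonneg R]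
  have hcqR := const_mul_q_le_sq hN0 hR hc hq hd hD heq
  have hcqR' := sqrt_mul_sqrt_le hN0 hR hc hq hd hD heq
  have hcqD : c * q * N ≤ D := by nlinarith
  have hD2 : N ^ 2 * R ^ 4 ≤ D ^ 2 := by
    have : (N * R ^ 2) ^ 2 ≤ D ^ 2 := by gcongr
    linarith
  have hsNN : √N ≤ N := by
    rw [Real.sqrt_le_left hN0.le]; nlinarith
  have t1 : N * R ^ 4 ≤ D ^ 2 / √N := by
    rw [le_div_iff₀ hsN]
    calc N * R ^ 4 * √N ≤ N * R ^ 4 * N := by gcongr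
      _ = N ^ 2 * R ^ 4 := by ring
      _ ≤ _ := hD2
  have t2 : N * R ^ 2 * (√N * (R * √q)) ≤ 1 / √c * (D ^ 2 / √N) := by
    rw [div_mul_div_comm, one_mul, le_div_iff₀ (by positivity)]
    calc N * R ^ 2 * (√N * (R * √q)) * (√c * √N) = (N * (√N * √N)) * R ^ 3 * (√c * √q) := by ring
      _ ≤ (N * (√N * √N)) * R ^ 3 * R := by gcongr
      _ = N ^ 2 * R ^ 4 := by rw [hNN]; ring
      _ ≤ _ := hD2
  have t3 : R ^ 2 * (N * √(d * q)) ≤ 1 / √c * (D ^ 2 / √N) := by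
    rw [div_mul_div_comm, one_mul, le_div_iff₀ (by positivity)]
    have e : √(d * q) * (√c * √N) ≤ D := by
      rw [← Real.sqrt_mul hc.le, ← Real.sqrt_mul (by positivity), Real.sqrt_le_left hD0.le]
      calc d * q * (c * N) = d * (c * q * N) := by ring
        _ ≤ D * D := by gcongr
        _ = D ^ 2 := by ring
    calc R ^ 2 * (N * √(d * q)) * (√c * √N) = (N * R ^ 2) * (√(d * q) * (√c * √N)) := by ring
      _ ≤ D * D := by gcongr
      _ = D ^ 2 := by ring
  have t4 : R ^ 2 * (N * q) ≤ 1 / c * (D ^ 2 / √N) := by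
    rw [div_mul_div_comm, one_mul, le_div_iff₀ (by positivity)]
    calc R ^ 2 * (N * q) * (c * √N) = (N * R ^ 2) * (c * q * √N) := by ring
      _ ≤ D * D := by
        gcongr
        exact (by gcongr : c * q * √N ≤ c * q * N).trans hcqD
      _ = D ^ 2 := by ring
  have hexp : ‖R • (m • μ + V)‖ ^ 2 - (D ^ 2 - d * D)
      = (m ^ 2 - N ^ 2) * R ^ 4 + 2 * m * R ^ 2 * inner ℝ μ V + R ^ 2 * (‖V‖ ^ 2 - N * d) := by
    rw [norm_smul, mul_pow, norm_add_sq_real, norm_smul, real_inner_smul_left, mul_pow, hμ,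
      Real.norm_eq_abs, Real.norm_eq_abs, sq_abs, sq_abs, hD]
    ring
  have hm1 : |m ^ 2 - N ^ 2| ≤ 4 * N := by
    rcases hm with hm | hm
    · rw [hm, sub_self, abs_zero]; positivity
    · rw [hm, show (N - 2) ^ 2 - N ^ 2 = 4 - 4 * N by ring, abs_le]
      constructor <;> linarith
  have hm2 : |m| ≤ N := by
    rcases hm with hm | hm <;> rw [hm, abs_le] <;> constructor <;> linarith
  rw [hexp]
  refine (abs_add_three _ _ _).trans ?_
  have a1 : |(m ^ 2 - N ^ 2) * R ^ 4| ≤ 4 * (D ^ 2 / √N) := by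
    rw [abs_mul, abs_of_pos (by positivity : 0 < R ^ 4)]
    calc |m ^ 2 - N ^ 2| * R ^ 4 ≤ 4 * N * R ^ 4 := by gcongr
      _ = 4 * (N * R ^ 4) := by ring
      _ ≤ _ := by gcongr
  have a2 : |2 * m * R ^ 2 * inner ℝ μ V| ≤ 4 * K * (1 / √c * (D ^ 2 / √N)) := by
    rw [abs_mul, abs_mul, abs_mul, abs_two, abs_of_pos (by positivity : 0 < R ^ 2)]
    calc 2 * |m| * R ^ 2 * |inner ℝ μ V| ≤ 2 * N * R ^ 2 * (2 * K * (√N * (R * √q))) := by gcongr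
      _ = 4 * K * (N * R ^ 2 * (√N * (R * √q))) := by ring
      _ ≤ _ := by gcongr
  have a3 : |R ^ 2 * (‖V‖ ^ 2 - N * d)|
      ≤ K * (1 / √c * (D ^ 2 / √N) + 1 / c * (D ^ 2 / √N)) := by
    rw [abs_mul, abs_of_pos (by positivity : 0 < R ^ 2)]
    calc R ^ 2 * |‖V‖ ^ 2 - N * d| ≤ R ^ 2 * (K * (N * (√(d * q) + q))) := by gcongr
      _ = K * (R ^ 2 * (N * √(d * q)) + R ^ 2 * (N * q)) := by ring
      _ ≤ _ := by gcongr
  have a4 : 4 * (D ^ 2 / √N) ≤ K * (4 * (D ^ 2 / √N)) := by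
    have : 0 ≤ 4 * (D ^ 2 / √N) := by positivity
    nlinarith
  calc _ ≤ K * (4 * (D ^ 2 / √N)) + 4 * K * (1 / √c * (D ^ 2 / √N))
        + K * (1 / √c * (D ^ 2 / √N) + 1 / c * (D ^ 2 / √N)) := by linarith
    _ = _ := by ring

/-- This shows that the main term R²⟨S, x_i⟩/D has order q. The signal part is NR⁴ = cqD by the
signal-to-noise equation, and the noise parts are compared with it through √c √q ≤ R. -/
lemma inner_signal_bound {E : Type*} [NormedAddCommGroup E] [InnerProductSpace ℝ E] {s : ℝ}
    {μ W z : E} (hN : 2 ≤ N) (hR : 0 < R) (hc : 0 < c) (hq : 0 < q) (hd : 0 ≤ d) (hK : 1 ≤ K)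
    (hD : D = N * R ^ 2 + d) (heq : N * R ^ 4 = c * q * D) (hμ : ‖μ‖ = R) (hs : s = 1 ∨ s = -1)
    (hz : |inner ℝ μ z| ≤ K * (R * √q)) (hW : |inner ℝ μ W| ≤ K * (√N * (R * √q)))
    (hWz : |inner ℝ W z| ≤ K * (√N * (√(d * q) + q))) :
    R ^ 2 * |inner ℝ ((N - 1) • μ + W) (s • μ + z)| ≤ K * (c + 3 * √c + 1) * (q * D) := by
  have hN0 : 0 < N := by linarith
  have hD0 : 0 < D := by rw [hD]; positivity
  have hsN : 0 < √N := Real.sqrt_pos.2 hN0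
  have hsc : 0 < √c := Real.sqrt_pos.2 hc
  have hsq : 0 < √q := Real.sqrt_pos.2 hq
  have hcc : √c * √c = c := Real.mul_self_sqrt hc.le
  have hND : N * R ^ 2 ≤ D := by linarith
  have hdD : d ≤ D := by rw [hD]; nlinarith [sq_nonneg R]
  have hcqR' := sqrt_mul_sqrt_le hN0 hR hc hq hd hD heq
  have hsNN : √N ≤ N := by
    rw [Real.sqrt_le_left hN0.le]; nlinarith
  have t1 : R ^ 2 * (N * (R * √q)) ≤ √c * (q * D) := by
    have : √c * (R ^ 2 * (N * (R * √q))) ≤ √c * (√c * (q * D)) := by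
      calc √c * (R ^ 2 * (N * (R * √q))) = N * R ^ 3 * (√c * √q) := by ring
        _ ≤ N * R ^ 3 * R := by gcongr
        _ = c * q * D := by rw [← heq]; ring
        _ = √c * (√c * (q * D)) := by rw [← mul_assoc, hcc]; ring
    exact le_of_mul_le_mul_left this hsc
  have t2 : R ^ 2 * (√N * √(d * q)) ≤ √c * (q * D) := by
    refine abs_le_of_sq_le_sq' ?_ (by positivity) |>.2
    rw [mul_pow, mul_pow, mul_pow, Real.sq_sqrt hN0.le, Real.sq_sqrt (by positivity),
      Real.sq_sqrt hc.le]
    calc (R ^ 2) ^ 2 * (N * (d * q)) = (N * R ^ 4) * (d * q) := by ring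
      _ ≤ (N * R ^ 4) * (D * q) := by gcongr
      _ = c * (q * D) ^ 2 := by rw [heq]; ring
  have t3 : R ^ 2 * (√N * q) ≤ q * D := by
    calc R ^ 2 * (√N * q) ≤ R ^ 2 * (N * q) := by gcongr
      _ = q * (N * R ^ 2) := by ring
      _ ≤ _ := by gcongr
  have hs1 : |s| = 1 := by rcases hs with rfl | rfl <;> simp
  have hexp : inner ℝ ((N - 1) • μ + W) (s • μ + z)
      = (N - 1) * s * R ^ 2 + (N - 1) * inner ℝ μ z + s * inner ℝ μ W + inner ℝ W z := by
    rw [inner_add_left, inner_add_right, inner_add_right, real_inner_smul_left,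
      real_inner_smul_left, real_inner_smul_right, real_inner_smul_right, real_inner_self_eq_norm_sq,
      hμ, real_inner_comm W μ]
    ring
  have hb : |inner ℝ ((N - 1) • μ + W) (s • μ + z)| ≤ N * R ^ 2 + N * (K * (R * √q))
      + K * (√N * (R * √q)) + K * (√N * (√(d * q) + q)) := by
    rw [hexp]
    refine (abs_add_le _ _).trans (add_le_add ((abs_add_three _ _ _).trans ?_) hWz)
    rw [abs_mul, abs_mul, abs_mul, abs_mul, hs1, abs_of_pos (by linarith : 0 < N - 1),
      abs_of_pos (by positivity : 0 < R ^ 2), one_mul, mul_one]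
    have b1 : (N - 1) * R ^ 2 ≤ N * R ^ 2 :=
      mul_le_mul_of_nonneg_right (by linarith) (by positivity)
    have b2 : (N - 1) * |inner ℝ μ z| ≤ N * (K * (R * √q)) :=
      mul_le_mul (by linarith) hz (abs_nonneg _) hN0.le
    exact add_le_add (add_le_add b1 b2) hW
  have t4 : R ^ 2 * (√N * (R * √q)) ≤ √c * (q * D) :=
    (by gcongr : R ^ 2 * (√N * (R * √q)) ≤ R ^ 2 * (N * (R * √q))).trans t1
  have t5 : N * R ^ 4 ≤ K * (c * (q * D)) := by
    rw [heq, mul_assoc]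
    exact le_mul_of_one_le_left (by positivity) hK
  have hK0 : 0 ≤ K := by linarith
  have k1 := mul_le_mul_of_nonneg_left t1 hK0
  have k2 := mul_le_mul_of_nonneg_left t2 hK0
  have k3 := mul_le_mul_of_nonneg_left t3 hK0
  have k4 := mul_le_mul_of_nonneg_left t4 hK0
  calc R ^ 2 * |inner ℝ ((N - 1) • μ + W) (s • μ + z)|
      ≤ R ^ 2 * (N * R ^ 2 + N * (K * (R * √q))
        + K * (√N * (R * √q)) + K * (√N * (√(d * q) + q))) :=
        mul_le_mul_of_nonneg_left hb (by positivity)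
    _ = N * R ^ 4 + K * (R ^ 2 * (N * (R * √q))) + K * (R ^ 2 * (√N * (R * √q)))
        + (K * (R ^ 2 * (√N * √(d * q))) + K * (R ^ 2 * (√N * q))) := by ring
    _ ≤ K * (c * (q * D)) + K * (√c * (q * D)) + K * (√c * (q * D))
        + (K * (√c * (q * D)) + K * (q * D)) :=
      add_le_add (add_le_add (add_le_add t5 k1) k4) (add_le_add k2 k3)
    _ = _ := by ring

end Deterministic

/-- The Laplace increment replaces 1/(2y) by 1/(2D) with relative error O(K/√N), and the squared
norms differ by 4R²⟨S, x_i⟩, of order KqD. The product of the two accounts for K² q/√N. -/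
lemma attribute_log_ratio_bound {d : ℕ} (hd : 2 ≤ d) {N R c q K s : ℝ}
    {μ S z W xi : EuclideanSpace ℝ (Fin d)} (hN : 4 ≤ N) (hR : 0 < R) (hc : 0 < c) (hq : 0 < q)
    (hcq : 1 ≤ c * q) (hK : 1 ≤ K) (heq : R ^ 4 / (R ^ 2 + d / N) = c * q) (hμ : ‖μ‖ = R)
    (hs : s = 1 ∨ s = -1) (hSW : S = (N - 1) • μ + W) (hxz : xi = s • μ + z)
    (hz : |inner ℝ μ z| ≤ K * (R * √q)) (hW : |inner ℝ μ W| ≤ K * (√N * (R * √q)))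
    (hWz : |inner ℝ W z| ≤ K * (√N * (√(d * q) + q)))
    (hp : |‖W + z‖ ^ 2 - N * d| ≤ K * (N * (√(d * q) + q)))
    (hm : |‖W - z‖ ^ 2 - N * d| ≤ K * (N * (√(d * q) + q)))
    (hsmall : K * (6 + 5 / √c + 1 / c) / √N ≤ 1 / 4) :
    |Real.log (sphereLaplace d (R • (S + xi))) - Real.log (sphereLaplace d (R • (S - xi)))
        - 2 / (N + d / R ^ 2) * inner ℝ S xi|
      ≤ 8 * (c + 3 * √c + 1) * (6 + 5 / √c + 1 / c) * K ^ 2 * (q / √N) := by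
  have hN0 : 0 < N := by linarith
  have hsN : 0 < √N := Real.sqrt_pos.2 hN0
  have hsc : 0 < √c := Real.sqrt_pos.2 hc
  have hd0 : (0 : ℝ) ≤ d := Nat.cast_nonneg d
  obtain ⟨D, hD⟩ : ∃ D, D = N * R ^ 2 + d := ⟨_, rfl⟩
  have heq' : N * R ^ 4 = c * q * D := by
    rw [hD]
    have : 0 < R ^ 2 + d / N := by positivity
    rw [div_eq_iff this.ne'] at heq
    rw [heq]; field_simp
  have hcqR := const_mul_q_le_sq hN0 hR hc hq hd0 hD heq'
  have hND : N ≤ D := by nlinarith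
  have hD0 : 0 < D := by linarith
  have hdD : (d : ℝ) ≤ D := by rw [hD]; nlinarith [sq_nonneg R]
  have hin : ∀ e : ℝ, (e = 1 ∨ e = -1) →
      |inner ℝ μ (W + e • z)| ≤ 2 * K * (√N * (R * √q)) := by
    intro e he
    have he1 : |e| = 1 := by rcases he with rfl | rfl <;> simp
    rw [inner_add_right, real_inner_smul_right]
    have h1 : 1 ≤ √N := by rw [Real.one_le_sqrt]; linarith
    have h2 : R * √q ≤ √N * (R * √q) := le_mul_of_one_le_left (by positivity) h1
    calc |inner ℝ μ W + e * inner ℝ μ z| ≤ |inner ℝ μ W| + |e * inner ℝ μ z| := abs_add_le _ _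
      _ = |inner ℝ μ W| + |inner ℝ μ z| := by rw [abs_mul, he1, one_mul]
      _ ≤ K * (√N * (R * √q)) + K * (√N * (R * √q)) := by
        gcongr
        exact hz.trans (by gcongr)
      _ = _ := by ring
  have hin1 := hin 1 (Or.inl rfl)
  have hin2 := hin (-1) (Or.inr rfl)
  rw [one_smul] at hin1
  rw [neg_smul, one_smul, ← sub_eq_add_neg] at hin2
  have hv := shifted_norm_sq_bound (m := N - 1 + s) (by linarith) hR hc hq hd0 hK hD heq' hμ
    (by rcases hs with rfl | rfl; · left; ring
        · right; ring) hin1 hp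
  have hw := shifted_norm_sq_bound (m := N - 1 - s) (by linarith) hR hc hq hd0 hK hD heq' hμ
    (by rcases hs with rfl | rfl; · right; ring
        · left; ring) hin2 hm
  have ev : (N - 1 + s) • μ + (W + z) = S + xi := by rw [hSW, hxz, add_smul]; abel
  have ew : (N - 1 - s) • μ + (W - z) = S - xi := by rw [hSW, hxz, sub_smul]; abel
  rw [ev] at hv
  rw [ew] at hw
  -- Raising 4 to 6 absorbs 2/D, because D ≥ N ≥ √N and K ≥ 1; here D ≥ N rests on R² ≥ cq ≥ 1.
  have hδ : K * (4 + 5 / √c + 1 / c) / √N + 2 / D ≤ K * (6 + 5 / √c + 1 / c) / √N := by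
    have h1 : 2 / D ≤ K * 2 / √N := by
      have hsNN : √N ≤ N := by
        rw [Real.sqrt_le_left hN0.le]; nlinarith
      gcongr
      · linarith
      · linarith
    calc _ ≤ K * (4 + 5 / √c + 1 / c) / √N + K * 2 / √N := by gcongr
      _ = _ := by ring
  have main := abs_log_sphereLaplace_sub_le hd hdD (by linarith) (hδ.trans hsmall) hv hw
  have hdiff : ‖R • (S + xi)‖ ^ 2 - ‖R • (S - xi)‖ ^ 2 = 4 * (R ^ 2 * inner ℝ S xi) := by
    rw [norm_smul, norm_smul, mul_pow, mul_pow, norm_add_sq_real, norm_sub_sq_real,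
      Real.norm_eq_abs, sq_abs]
    ring
  have hcoef : 4 * (R ^ 2 * inner ℝ S xi) / (2 * D) = 2 / (N + d / R ^ 2) * inner ℝ S xi := by
    rw [hD]; field_simp; ring
  have hS := inner_signal_bound (s := s) (by linarith) hR hc hq hd0 hK hD heq' hμ hs hz hW hWz
  rw [← hSW, ← hxz] at hS
  rw [hdiff, hcoef] at main
  refine main.trans ?_
  have hab : |4 * (R ^ 2 * inner ℝ S xi)| / D ≤ 4 * (K * (c + 3 * √c + 1) * q) := by
    rw [abs_mul, abs_mul, abs_of_pos (by positivity : 0 < R ^ 2), div_le_iff₀ hD0]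
    calc |(4 : ℝ)| * (R ^ 2 * |inner ℝ S xi|) = 4 * (R ^ 2 * |inner ℝ S xi|) := by norm_num
      _ ≤ 4 * (K * (c + 3 * √c + 1) * (q * D)) := by gcongr
      _ = _ := by ring
  calc _ ≤ 4 * (K * (c + 3 * √c + 1) * q) * (2 * (K * (6 + 5 / √c + 1 / c) / √N)) := by
        gcongr
    _ = _ := by ring

/-- Polarization reduces ⟨W, z⟩ to two norms. Rescaling W by r = √(n-1) first balances it against z,
so the fluctuation is of order √n; without rescaling it would be of order n. -/
lemma inner_polarization_bound {E : Type*} [NormedAddCommGroup E] [InnerProductSpace ℝ E]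
    {W z : E} {r m t : ℝ} (hr : 0 < r) (hp : |‖r⁻¹ • W + z‖ ^ 2 - m| ≤ t)
    (hm : |‖r⁻¹ • W - z‖ ^ 2 - m| ≤ t) : |inner ℝ W z| ≤ r * (t / 2) := by
  have e : inner ℝ W z
      = r * (((‖r⁻¹ • W + z‖ ^ 2 - m) - (‖r⁻¹ • W - z‖ ^ 2 - m)) / 4) := by
    rw [norm_add_sq_real, norm_sub_sq_real, real_inner_smul_left]
    field_simp
    ring
  rw [e, abs_mul, abs_of_pos hr]
  gcongr
  rw [abs_div, abs_of_pos (by norm_num : (0 : ℝ) < 4)]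
  have := abs_sub (‖r⁻¹ • W + z‖ ^ 2 - m) (‖r⁻¹ • W - z‖ ^ 2 - m)
  linarith

lemma abs_log_one_sub_le {p : ℝ} (h0 : 0 < p) (h1 : p ≤ 1 / 2) : |Real.log (1 - p)| ≤ 2 * p := by
  have hp : 0 < 1 - p := by linarith
  rw [abs_of_nonpos (Real.log_nonpos hp.le (by linarith)), ← Real.log_inv]
  refine (Real.log_le_sub_one_of_pos (by positivity)).trans ?_
  rw [inv_eq_one_div, div_sub_one hp.ne', div_le_iff₀ hp]
  nlinarith

/-- The absent-edge coefficient factors out of the error. It is O(q/n), and it multiplies a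
difference of two sums of size at most K√(nq), since q ≤ √(nq). -/
lemma network_log_ratio_bound {n : ℕ} {α β K q t : ℝ} (i : Fin n) (y : Fin n → ℤˣ)
    (A : Fin n → Fin n → ℝ) (hα : 0 < α) (hβ : 0 < β) (hα1 : α ≤ 1 / 2) (hβ1 : β ≤ 1 / 2)
    (hab : α + β = t * (q / n)) (hq : 0 < q) (hqn : q ≤ n)
    (hy : |∑ j ∈ Finset.univ.erase i, ((y j : ℤ) : ℝ)| ≤ K * √(n * q))
    (hA : |∑ j ∈ Finset.univ.erase i, ((y j : ℤ) : ℝ) * A i j| ≤ K * q) (hK : 0 ≤ K) :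
    |networkLogRatio α β i y A
        - Real.log (α / β) * ∑ j ∈ Finset.univ.erase i, ((y j : ℤ) : ℝ) * A i j|
      ≤ 4 * t * K * (q * √(q / n)) := by
  have hn : (0 : ℝ) < n := hq.trans_le hqn
  have e : networkLogRatio α β i y A
      - Real.log (α / β) * ∑ j ∈ Finset.univ.erase i, ((y j : ℤ) : ℝ) * A i j
      = (∑ j ∈ Finset.univ.erase i, ((y j : ℤ) : ℝ) -
        ∑ j ∈ Finset.univ.erase i, ((y j : ℤ) : ℝ) * A i j) *
        (Real.log (1 - α) - Real.log (1 - β)) := by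
    have hl0 : Real.log ((1 - α) / (1 - β)) = Real.log (1 - α) - Real.log (1 - β) :=
      Real.log_div (by linarith) (by linarith)
    rw [networkLogRatio, Finset.mul_sum, ← Finset.sum_sub_distrib, ← Finset.sum_sub_distrib,
      Finset.sum_mul]
    refine Finset.sum_congr rfl fun j _ => ?_
    rw [hl0]
    ring
  have hqs : q ≤ √(n * q) := by
    rw [Real.le_sqrt' hq, sq]
    gcongr
  have hl : |Real.log (1 - α) - Real.log (1 - β)| ≤ 2 * (t * (q / n)) := by
    have h1 := abs_log_one_sub_le hα hα1
    have h2 := abs_log_one_sub_le hβ hβ1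
    have h3 := abs_sub (Real.log (1 - α)) (Real.log (1 - β))
    linarith
  have hsum : |∑ j ∈ Finset.univ.erase i, ((y j : ℤ) : ℝ) -
      ∑ j ∈ Finset.univ.erase i, ((y j : ℤ) : ℝ) * A i j| ≤ 2 * (K * √(n * q)) := by
    have h3 := abs_sub (∑ j ∈ Finset.univ.erase i, ((y j : ℤ) : ℝ))
      (∑ j ∈ Finset.univ.erase i, ((y j : ℤ) : ℝ) * A i j)
    have h4 : K * q ≤ K * √(n * q) := by gcongr
    linarith
  have hsq : √(n * q) = n * √(q / n) := by
    rw [← Real.sqrt_sq hn.le, ← Real.sqrt_mul (by positivity), Real.sqrt_sq hn.le]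
    congr 1
    field_simp
  rw [e, abs_mul]
  calc _ ≤ 2 * (K * √(n * q)) * (2 * (t * (q / n))) := by gcongr
    _ = _ := by rw [hsq]; field_simp; ring

lemma linear_part_eq {n d : ℕ} (i : Fin n) (k1 k2 : ℝ) (y : Fin n → ℤˣ) (A : Fin n → Fin n → ℝ)
    (x : Fin n → EuclideanSpace ℝ (Fin d)) (hA : A i i = 0) :
    ((k1 • Matrix.of A + k2 • hollowedGram x).mulVec (labelVec y)) i
      = k1 * ∑ j ∈ Finset.univ.erase i, ((y j : ℤ) : ℝ) * A i j
        + k2 * inner ℝ (signedSum i y x) (x i) := by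
  rw [Matrix.mulVec, dotProduct, ← Finset.sum_erase_add _ _ (Finset.mem_univ i), signedSum,
    sum_inner, Finset.mul_sum, Finset.mul_sum, ← Finset.sum_add_distrib]
  have h0 : (k1 • Matrix.of A + k2 • hollowedGram x) i i * labelVec y i = 0 := by
    simp [hollowedGram, hA]
  rw [h0, add_zero]
  refine Finset.sum_congr rfl fun j hj => ?_
  have hij : i ≠ j := (Finset.ne_of_mem_erase hj).symm
  simp only [Matrix.add_apply, Matrix.smul_apply, Matrix.of_apply, hollowedGram, if_neg hij,
    labelVec, smul_eq_mul, real_inner_smul_left, real_inner_comm (x i) (x j)]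
  rw [real_inner_comm]
  ring

/-! ### The error bound and its probability -/

section Model

variable {Ω : Type*} [MeasurableSpace Ω] {P : Measure Ω}
  {n d : ℕ} {α β R : ℝ} {y : Ω → Fin n → ℤˣ} {μ : Ω → EuclideanSpace ℝ (Fin d)}
  {A : Ω → Fin n → Fin n → ℝ} {x : Ω → Fin n → EuclideanSpace ℝ (Fin d)}

lemma IsCSBM.norm_center (h : IsCSBM P n d α β R y μ A x) : ∀ᵐ ω ∂P, ‖μ ω‖ = R := by
  have h1 : ∀ᵐ u ∂(P.map μ), ‖u‖ = R := by
    rw [h.law_center.map_eq]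
    exact norm_eq_of_uniformSphere h.radius_pos.le
  exact ae_of_ae_map h.measurable_center.aemeasurable h1

variable [IsProbabilityMeasure P]

/-- Deterministic bound for the error of the linear approximation to the log-odds, on the event
that the labels, the network and the noise are controlled. -/
lemma log_odds_error_bound {c q K t : ℝ} (i : Fin n) {y : Fin n → ℤˣ}
    {μ : EuclideanSpace ℝ (Fin d)} {A : Fin n → Fin n → ℝ} {x : Fin n → EuclideanSpace ℝ (Fin d)}
    (hd : 2 ≤ d) (hR0 : 0 < R) (hα : 0 < α) (hβ : 0 < β) (hα1 : α ≤ 1 / 2) (hβ1 : β ≤ 1 / 2)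
    (hn : (4 : ℝ) ≤ n) (hc : 0 < c) (hq : 1 ≤ q) (hqn : q ≤ n) (hcq : 1 ≤ c * q) (hK : 1 ≤ K)
    (hab : α + β = t * (q / n)) (hR : R ^ 4 / (R ^ 2 + d / n) = c * q)
    (hsmall : K * (6 + 5 / √c + 1 / c) / √n ≤ 1 / 4) (hA0 : A i i = 0) (hμ : ‖μ‖ = R)
    (b1 : |∑ j ∈ Finset.univ.erase i, ((y j : ℤ) : ℝ)| ≤ K * √(n * q))
    (b2 : |∑ j ∈ Finset.univ.erase i, ((y j : ℤ) : ℝ) * A i j| ≤ K * q)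
    (b3 : |inner ℝ μ (noise 0 1 i y μ x)| ≤ K * (1 * (R * √q)))
    (b4 : |inner ℝ μ (noise 1 0 i y μ x)| ≤ K * (√((n : ℝ) - 1) * (R * √q)))
    (b5 : |‖noise 1 1 i y μ x‖ ^ 2 - √n ^ 2 * d| ≤ K * (√n ^ 2 * (√(d * q) + q)))
    (b6 : |‖noise 1 (-1) i y μ x‖ ^ 2 - √n ^ 2 * d| ≤ K * (√n ^ 2 * (√(d * q) + q)))
    (b7 : |‖noise (√((n : ℝ) - 1))⁻¹ 1 i y μ x‖ ^ 2 - √2 ^ 2 * d| ≤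
      K * (√2 ^ 2 * (√(d * q) + q)))
    (b8 : |‖noise (√((n : ℝ) - 1))⁻¹ (-1) i y μ x‖ ^ 2 - √2 ^ 2 * d| ≤
      K * (√2 ^ 2 * (√(d * q) + q))) :
    |networkLogRatio α β i y A
        + (Real.log (sphereLaplace d (R • (signedSum i y x + x i)))
          - Real.log (sphereLaplace d (R • (signedSum i y x - x i))))
        - ((Real.log (α / β) • Matrix.of A + (2 / (n + d / R ^ 2)) • hollowedGram x).mulVec
          (labelVec y)) i|
      ≤ (8 * (c + 3 * √c + 1) * (6 + 5 / √c + 1 / c) * K ^ 2 + 4 * t * K) * (q * √(q / n)) := by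
  have hn0 : (0 : ℝ) < n := by linarith
  have hq0 : 0 < q := by linarith
  have hK0 : 0 < K := by linarith
  have hr : 0 < √((n : ℝ) - 1) := Real.sqrt_pos.2 (by linarith)
  have hrn : √((n : ℝ) - 1) ≤ √n := Real.sqrt_le_sqrt (by linarith)
  obtain ⟨W, hW⟩ : ∃ W, W = noise 1 0 i y μ x := ⟨_, rfl⟩
  obtain ⟨z, hz⟩ : ∃ z, z = noise 0 1 i y μ x := ⟨_, rfl⟩
  have e (a b : ℝ) : noise a b i y μ x = a • W + b • z := by simp [hW, hz, noise]
  have hS : signedSum i y x = ((n : ℝ) - 1) • μ + W := by simp [hW, noise]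
  have hx : x i = ((y i : ℤ) : ℝ) • μ + z := by simp [hz, noise]
  have hs : ((y i : ℤ) : ℝ) = 1 ∨ ((y i : ℤ) : ℝ) = -1 := by
    rcases Int.units_eq_one_or (y i) with h | h <;> simp [h]
  rw [← hz, one_mul] at b3
  rw [← hW] at b4
  rw [e, one_smul, one_smul, Real.sq_sqrt hn0.le] at b5
  rw [e, one_smul, neg_smul, one_smul, ← sub_eq_add_neg, Real.sq_sqrt hn0.le] at b6
  rw [e, one_smul, Real.sq_sqrt zero_le_two] at b7
  rw [e, neg_smul, one_smul, ← sub_eq_add_neg, Real.sq_sqrt zero_le_two] at b8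
  have hWz : |inner ℝ W z| ≤ K * (√n * (√(d * q) + q)) := by
    calc |inner ℝ W z| ≤ √((n : ℝ) - 1) * (K * (2 * (√(d * q) + q)) / 2) :=
          inner_polarization_bound hr b7 b8
      _ = K * (√((n : ℝ) - 1) * (√(d * q) + q)) := by ring
      _ ≤ _ := by gcongr
  have hWμ : |inner ℝ μ W| ≤ K * (√n * (R * √q)) := b4.trans (by gcongr)
  have hattr := attribute_log_ratio_bound hd hn hR0 hc hq0 hcq hK hR hμ hs hS hx b3 hWμ hWz b5 b6
    hsmall
  have hnet := network_log_ratio_bound i y A hα hβ hα1 hβ1 hab hq0 hqn b1 b2 hK0.le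
  -- As q ≥ 1, the attribute error q/√n is absorbed into the network rate q √(q/n).
  have hsqrt : q / √n ≤ q * √(q / n) := by
    rw [Real.sqrt_div hq0.le, ← mul_div_assoc]
    gcongr
    exact le_mul_of_one_le_right hq0.le (Real.one_le_sqrt.2 hq)
  rw [linear_part_eq i _ _ y A x hA0, add_sub_add_comm, add_mul, add_comm (_ * (q * √(q / n)))]
  refine (abs_add_le _ _).trans (add_le_add hnet (hattr.trans ?_))
  exact mul_le_mul_of_nonneg_left hsqrt (by positivity)

/-- A union bound over eight events, each of probability at most 2 exp(-Cq). The squared-norm tails,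
of exponent K/4 - 1/2, require K ≥ 4C + 2; the network row, whose log-moment is 2tq, requires K ≥ C
+ 2t. -/
lemma IsCSBM.genieLogOdds_error_tail (h : IsCSBM P n d α β R y μ A x) (i : Fin n)
    {c q K t C : ℝ} (hα1 : α ≤ 1 / 2) (hβ1 : β ≤ 1 / 2)
    (hn : (4 : ℝ) ≤ n) (hc : 0 < c) (hq : 1 ≤ q) (hqn : q ≤ n) (hcq : 1 ≤ c * q) (hK : 1 ≤ K)
    (hab : α + β = t * (q / n)) (hR : R ^ 4 / (R ^ 2 + d / n) = c * q)
    (hsmall : K * (6 + 5 / √c + 1 / c) / √n ≤ 1 / 4)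
    (hKC : 4 * C + 2 ≤ K) (htC : C + 2 * t ≤ K) :
    P {ω | (8 * (c + 3 * √c + 1) * (6 + 5 / √c + 1 / c) * K ^ 2 + 4 * t * K) * (q * √(q / n)) <
        |genieLogOdds P y A x i ω - ((Real.log (α / β) • Matrix.of (A ω) +
          (2 / (n + d / R ^ 2)) • hollowedGram (x ω)).mulVec (labelVec (y ω))) i|}
      ≤ 16 * ENNReal.ofReal (Real.exp (-C * q)) := by
  have hn0 : (0 : ℝ) < n := by linarith
  have hn1 : (0 : ℝ) < (n : ℝ) - 1 := by linarith
  have hq0 : 0 < q := by linarith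
  have hτ0 : ((n : ℝ) - 1) * 0 ^ 2 + 1 ^ 2 = (1 : ℝ) ^ 2 := by ring
  have hτ1 : ((n : ℝ) - 1) * 1 ^ 2 + 0 ^ 2 = √((n : ℝ) - 1) ^ 2 := by
    rw [Real.sq_sqrt hn1.le]; ring
  have hτ2 (s : ℝ) (hs : s ^ 2 = 1) : ((n : ℝ) - 1) * 1 ^ 2 + s ^ 2 = √(n : ℝ) ^ 2 := by
    rw [Real.sq_sqrt hn0.le, hs]; ring
  have hτ3 (s : ℝ) (hs : s ^ 2 = 1) :
      ((n : ℝ) - 1) * (√((n : ℝ) - 1))⁻¹ ^ 2 + s ^ 2 = √2 ^ 2 := by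
    rw [inv_pow, Real.sq_sqrt hn1.le, Real.sq_sqrt zero_le_two, hs, mul_inv_cancel₀ hn1.ne']
    norm_num
  have hr : 0 < √((n : ℝ) - 1) := Real.sqrt_pos.2 hn1
  have hexp {u : ℝ} (hu : u ≤ -C * q) :
      2 * ENNReal.ofReal (Real.exp u) ≤ 2 * ENNReal.ofReal (Real.exp (-C * q)) := by gcongr
  have u1 : -(K - 1 / 2) * q ≤ -C * q := by
    have : C * q ≤ (K - 1 / 2) * q := by gcongr; linarith
    linarith
  have u2 : -(K / 4 - 1 / 2) * q ≤ -C * q := by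
    have : C * q ≤ (K / 4 - 1 / 2) * q := by gcongr; linarith
    linarith
  have u3 : 2 * n * (α + β) - K * q ≤ -C * q := by
    have e : 2 * n * (α + β) = 2 * t * q := by rw [hab]; field_simp
    have : (C + 2 * t) * q ≤ K * q := by gcongr
    linarith
  have T1 := (h.labels_tail i hq0.le (K := K)).trans (hexp u1)
  have T2 := (h.network_tail i (K * q)).trans (hexp u3)
  have T3 := (h.noise_inner_tail i 0 1 (K := K) one_pos hτ0 hq0).trans (hexp u1)
  have T4 := (h.noise_inner_tail i 1 0 (K := K) hr hτ1 hq0).trans (hexp u1)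
  have T5 := (h.noise_norm_sq_tail i 1 1 (K := K) (by positivity) (hτ2 1 (by norm_num))
    hq0).trans (hexp u2)
  have T6 := (h.noise_norm_sq_tail i 1 (-1) (K := K) (by positivity) (hτ2 (-1) (by norm_num))
    hq0).trans (hexp u2)
  have T7 := (h.noise_norm_sq_tail i (√((n : ℝ) - 1))⁻¹ 1 (K := K) (by positivity)
    (hτ3 1 (by norm_num)) hq0).trans (hexp u2)
  have T8 := (h.noise_norm_sq_tail i (√((n : ℝ) - 1))⁻¹ (-1) (K := K) (by positivity)
    (hτ3 (-1) (by norm_num)) hq0).trans (hexp u2)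
  have hdiag : ∀ᵐ ω ∂P, A ω i i = 0 := ae_iff.2 (h.network_diag i)
  have htot := (measure_union_le _ _).trans (add_le_add ((measure_union_le _ _).trans (add_le_add
    ((measure_union_le _ _).trans (add_le_add ((measure_union_le _ _).trans (add_le_add
    ((measure_union_le _ _).trans (add_le_add ((measure_union_le _ _).trans (add_le_add
    ((measure_union_le _ _).trans (add_le_add T1 T2)) T3)) T4)) T5)) T6)) T7)) T8)
  -- The exact log-odds formula, the zero diagonal of A and ‖μ‖ = R hold only almost surely, so the
  -- inclusion of events is almost sure as well.
  refine (measure_mono_ae ?_).trans (htot.trans (le_of_eq (by ring)))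
  filter_upwards [h.genieLogOdds_eq i, hdiag, h.norm_center] with ω hω hA0 hμ hbad
  by_contra hcon
  replace hcon : ω ∉ (_ : Set Ω) := hcon
  simp only [Set.mem_union, Set.mem_ofPred_eq, not_or, not_le] at hcon
  obtain ⟨⟨⟨⟨⟨⟨⟨b1, b2⟩, b3⟩, b4⟩, b5⟩, b6⟩, b7⟩, b8⟩ := hcon
  refine absurd hbad (not_lt.2 ?_)
  rw [hω]
  exact log_odds_error_bound i h.two_le_dim h.radius_pos h.alpha_mem.1 h.beta_mem.1 hα1 hβ1 hn hc
    hq hqn hcq hK hab hR hsmall hA0 hμ b1.le b2.le b3.le b4.le b5.le b6.le b7.le b8.le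

end Model

/-! ### Passage to the limit -/

lemma tendsto_pnat_cast : Tendsto (fun n : ℕ+ => ((n : ℕ) : ℝ)) atTop atTop :=
  tendsto_natCast_atTop_atTop.comp tendsto_PNat_val_atTop_atTop

lemma tendsto_div_of_le_log {q : ℕ+ → ℝ} (hq_top : Tendsto q atTop atTop)
    (hq_log : ∀ᶠ n in atTop, q n ≤ Real.log n) :
    Tendsto (fun n : ℕ+ => q n / n) atTop (𝓝 0) := by
  have hlog : Tendsto (fun n : ℕ+ => Real.log n / n) atTop (𝓝 0) :=
    Real.isLittleO_log_id_atTop.tendsto_div_nhds_zero.comp tendsto_pnat_cast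
  refine tendsto_of_tendsto_of_tendsto_of_le_of_le' tendsto_const_nhds hlog ?_ ?_
  · exact (hq_top.eventually_ge_atTop 0).mono fun n hn => by positivity
  · exact hq_log.mono fun n hn => by gcongr

end ContextualSBM

theorem mainTheorem11 {Ω : ℕ+ → Type*} [∀ n, MeasurableSpace (Ω n)] (P : ∀ n, Measure (Ω n))
    [∀ n, IsProbabilityMeasure (P n)] (a b c : ℝ) (ha : 0 < a) (hb : 0 < b) (hc : 0 < c)
    (q R : ℕ+ → ℝ) (d : ℕ+ → ℕ) (hq_top : Tendsto q atTop atTop)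
    (hq_log : ∀ᶠ n in atTop, q n ≤ Real.log n)
    (hR : ∀ᶠ n in atTop, R n ^ 4 / (R n ^ 2 + d n / n) = c * q n)
    (y : ∀ n, Ω n → Fin n → ℤˣ) (μ : ∀ n, Ω n → EuclideanSpace ℝ (Fin (d n)))
    (A : ∀ n, Ω n → Fin n → Fin n → ℝ) (x : ∀ n, Ω n → Fin n → EuclideanSpace ℝ (Fin (d n)))
    (hmodel : ∀ᶠ n in atTop, ContextualSBM.IsCSBM (P n) n (d n) (a * q n / n) (b * q n / n) (R n)
      (y n) (μ n) (A n) (x n))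
    (i : ∀ n : ℕ+, Fin n) :
    (∀ᶠ n in atTop, ∀ᵐ ω ∂(P n), 0 < ContextualSBM.genieProb (P n) (y n) (A n) (x n) (i n) 1 ω ∧
      0 < ContextualSBM.genieProb (P n) (y n) (A n) (x n) (i n) (-1) ω) ∧
    ContextualSBM.IsLittleOP P
      (fun n ω => |ContextualSBM.genieLogOdds (P n) (y n) (A n) (x n) (i n) ω -
        ((Real.log (a / b) • Matrix.of (A n ω) +
          (2 / (n + d n / R n ^ 2)) • ContextualSBM.hollowedGram (x n ω)).mulVec
            (ContextualSBM.labelVec (y n ω))) (i n)|)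
      (fun n _ => q n) q := by
  -- The rate is w_n = √(q/n), and C₁ = 16 comes from eight two-sided tails; neither depends on C.
  refine ⟨hmodel.mono fun n h => h.genieProb_pos (i n), fun n => √(q n / n), ?_, 16, by norm_num,
    fun C hC => ?_⟩
  · have h0 := ContextualSBM.tendsto_div_of_le_log hq_top hq_log
    simpa using h0.sqrt
  have hdiv := ContextualSBM.tendsto_div_of_le_log hq_top hq_log
  -- This meets both requirements on K, with t = a + b since α + β = (a + b) q/n.
  obtain ⟨K, hK⟩ : ∃ K, K = 4 * C + 2 + 2 * (a + b) := ⟨_, rfl⟩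
  have hK1 : 1 ≤ K := by linarith
  have hsc : 0 < √c := Real.sqrt_pos.2 hc
  have hsmall : ∀ᶠ n : ℕ+ in atTop, K * (6 + 5 / √c + 1 / c) / √(n : ℝ) ≤ 1 / 4 :=
    ((Real.tendsto_sqrt_atTop.comp ContextualSBM.tendsto_pnat_cast).const_div_atTop
      (K * (6 + 5 / √c + 1 / c))).eventually_le_const (by norm_num)
  have hα : ∀ᶠ n : ℕ+ in atTop, a * q n / n ≤ 1 / 2 := by
    have := (hdiv.const_mul a).eventually_le_const (u := 1 / 2) (by norm_num)
    exact this.mono fun n hn => by rwa [mul_div_assoc]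
  have hβ : ∀ᶠ n : ℕ+ in atTop, b * q n / n ≤ 1 / 2 := by
    have := (hdiv.const_mul b).eventually_le_const (u := 1 / 2) (by norm_num)
    exact this.mono fun n hn => by rwa [mul_div_assoc]
  have hqn := hdiv.eventually_le_const zero_lt_one
  obtain ⟨N, hN⟩ := eventually_atTop.1 (hmodel.and (hR.and (hsmall.and (hα.and (hβ.and (hqn.and
    ((ContextualSBM.tendsto_pnat_cast.eventually_ge_atTop 4).and
    ((hq_top.eventually_ge_atTop 1).and (hq_top.eventually_ge_atTop c⁻¹)))))))))
  obtain ⟨B, hB⟩ : ∃ B, B = 8 * (c + 3 * √c + 1) * (6 + 5 / √c + 1 / c) * K ^ 2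
    + 4 * (a + b) * K := ⟨_, rfl⟩
  have hB0 : 0 ≤ B := by rw [hB]; positivity
  -- The tail bound concerns a strict inequality with constant B, whereas the definition uses a
  -- non-strict one; the extra 1 bridges them, since q √(q/n) > 0.
  refine ⟨B + 1, by linarith, N, fun n hn => ?_⟩
  obtain ⟨h, hRn, hs, hα1, hβ1, hqn, hn4, hq1, hcq⟩ := hN n hn
  have hn0 : (0 : ℝ) < n := by linarith
  have hq0 : 0 < q n := by linarith
  have tail := h.genieLogOdds_error_tail (i n) (C := C) (t := a + b) hα1 hβ1 hn4 hc hq1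
    ((div_le_one hn0).1 hqn) (by rwa [inv_le_iff_one_le_mul₀' hc] at hcq) hK1 (by ring) hRn hs
    (by linarith) (by linarith)
  have hratio : a * q n / n / (b * q n / n) = a / b := by field_simp
  rw [← hB, hratio] at tail
  rw [measureReal_def]
  refine ENNReal.toReal_le_of_le_ofReal (by positivity) ((measure_mono fun ω hω => ?_).trans
    (tail.trans (le_of_eq ?_)))
  · have hpos : 0 < q n * √(q n / n) := by positivity
    have hω' : (B + 1) * |√(q n / n) * q n| ≤ _ := hω
    rw [abs_abs, mul_comm (√(q n / n)), abs_of_pos hpos] at hω'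
    exact lt_of_lt_of_le (by linarith) hω'
  · rw [ENNReal.ofReal_mul (by norm_num)]
    norm_num
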